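/- **Model.** Time is slotted. Two servers $S_1,S_2$ send status update packets to a monitor. The service times on $S_m$ are independent and follow a discrete phase-type law $\mathrm{DPH}(\alpha^{(m)},B^{(m)})$ of order $N_m$: $\alpha^{(m)}$ is a probability vector, $B^{(m)}$ is a substochastic matrix all of whose phases are transient, and $b^{(m)}=(I-B^{(m)})\mathbf 1$. A packet starts service in a phase drawn from $\alpha^{(m)}$; in each later slot its service moves from phase $i$ to phase $i'$ with probability $B^{(m)}_{ii'}$, or is completed (the packet is received) with probability $b^{(m)}_i$. The freezing parameter is an integer $k\ge 1$: at least $k$ slots separate two consecutive sampling instants. As soon as $k$ slots have elapsed since the last sampling instant and some server is idle, a new packet is generated and starts service on an idle server, with a fixed server having priority if both are idle. The freezing clock $l\in\{0,\dots,k-1\}$ is the number of slots since the last sampling instant, stopped at $k-1$. A received packet is *up to date* if it was generated later than every packet received before (of two packets received in the same slot, the later-generated one counts), and *obsolete* otherwise. The age of information $\Delta(t)$ is the time elapsed since the generation of the freshest packet received by time $t$. The $n$-th peak age $\Phi_n$ is the value of $\Delta$ in the slot just before the one in which the $n$-th up-to-date packet is received. The system may start in any (possibly random) state. **The chain $W$.**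 The phases of the busy servers, the indication of which servers are idle, and the freezing clock form a finite Markov chain $W$. Let $p$ be a stationary probability vector of $W$, and assume that it is the only one carried by states which the system visits with positive probability (so the system has a well-defined steady state). **The absorbing chain $Y$.** Fix a packet $P^*$ and follow the system from its generation. Let $Y$ be the Markov chain on finitely many transient states, recording before the reception of $P^*$: the server serving $P^*$, whether the other server is idle or serves an older or a newer packet, the phases, and the freezing clock; and after the reception of $P^*$: which servers are idle, which packets in service are up to date (newer than $P^*$) or obsolete (older), the phases, and the freezing clock (omitted if both servers hold newer packets). $Y$ is absorbed in the *successful* state when, after $P^*$ has been received as an up-to-date packet, the first packet newer than $P^*$ is received; it is absorbed in the *unsuccessful* state when a packet newer than $P^*$ is received before, or in the same slot as, $P^*$. Let $A$ be the matrix of transition probabilities of $Y$ among transient states, $c_s$ the column vector of one-step probabilities of absorption into the successful state, and $\sigma$ the initial row vector of $Y$: the law of the state just after a packet $P^*$ has been generated, that is, the steady-state (under $p$) probabilities that in a given slot a packet is generated and leaves the system in the given state, normalized to total mass $1$. **Statement.** The matrix $I-A$ is invertible, $\kappa:=\sigma A(I-A)^{-1}c_s>0$, and $$u_\Phi(h)=\frac{\sigma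 A^h c_s}{\sigma A(I-A)^{-1}c_s},\qquad h=1,2,\dots,$$ is a probability mass function on $\{1,2,\dots\}$. It is the PMF of the steady-state peak age of information $\Phi$: for every $h\ge1$, $$\lim_{n\to\infty}\frac1n\sum_{m\le n}\Pr(\Phi_m=h)=u_\Phi(h),$$ and hence $\lim_{n\to\infty}\Pr(\Phi_n=h)=u_\Phi(h)$ whenever the latter limit exists. Moreover, $\Phi$ has the law of the absorption time of $Y$ into the successful state minus one, given that this absorption occurs: $\Pr(Y_h=\text{successful})\to\kappa$ as $h\to\infty$, and $u_\Phi(h)=\big(\Pr(Y_{h+1}=\text{successful})-\Pr(Y_h=\text{successful})\big)/\kappa$ for $h\ge1$. -/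

import Mathlib

open Filter Topology MeasureTheory Matrix

noncomputable section

namespace DTDQ

/-! ### Discrete phase-type distributions -/

/-- The data `(α, B)` of a discrete phase-type (DPH) distribution of order `N`: an initial
probability vector on the `N` phases, and a substochastic matrix of transition probabilities between
phases from which the phase process is eventually absorbed (all `N` phases are transient). The
DPH random variable is the time until absorption. -/
structure DPH (N : ℕ) where
  α : Fin N → ℝ
  B : Matrix (Fin N) (Fin N) ℝ
  α_nonneg : ∀ i, 0 ≤ α i
  α_sum : ∑ i, α i = 1
  B_nonneg : ∀ i j, 0 ≤ B i j
  B_sum_le : ∀ i, ∑ j, B i j ≤ 1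
  transient : ∀ i, Tendsto (fun n : ℕ => ∑ j, (B ^ n) i j) atTop (𝓝 0)

/-- The vector `b = (I - B) 1` of one-step absorption probabilities. -/
def DPH.b {N : ℕ} (D : DPH N) : Fin N → ℝ := (1 - D.B) *ᵥ 1

/-! ### Markov chains with countably many states -/

/-- `X` is, under `P`, a time-homogeneous Markov chain with one-step transition probabilities `K`;
its initial law is arbitrary. -/
structure IsMarkovChain {S Ω : Type*} [MeasurableSpace Ω] (K : S → S → ℝ) (P : Measure Ω)
    (X : ℕ → Ω → S) : Prop where
  measurable : ∀ t s, MeasurableSet {ω | X t ω = s}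
  step : ∀ (t : ℕ) (x : ℕ → S),
    P.real {ω | ∀ m ≤ t + 1, X m ω = x m} =
      P.real {ω | ∀ m ≤ t, X m ω = x m} * K (x t) (x (t + 1))

/-- `p` is a stationary probability vector of the transition matrix `R`. -/
structure IsStationary {S : Type*} [Fintype S] (R : Matrix S S ℝ) (p : S → ℝ) : Prop where
  nonneg : ∀ s, 0 ≤ p s
  sum_eq_one : ∑ s, p s = 1
  stationary : p ᵥ* R = p

/-! ### The dual-queue status update system -/

/-- The two servers. -/
inductive Server
  | S1
  | S2
  deriving DecidableEq

/-- State of the system in a slot. For each server: `none` if idle, otherwise the phase of the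
service and the age (number of slots since its generation) of the packet in service. `clock` is
the number of slots since the last sampling instant, stopped at `k - 1`. `aoi` is the age of the
freshest packet received so far, that is, the age of information `Δ`. -/
@[ext]
structure SysState (N₁ N₂ k : ℕ) where
  srv₁ : Option (Fin N₁ × ℕ)
  srv₂ : Option (Fin N₂ × ℕ)
  clock : Fin k
  aoi : ℕ
  deriving DecidableEq

/-- One slot of a server, before any new packet is started: probability that its status (`none` =
idle, `some i` = serving in phase `i`) changes from `s` to `o`. A busy server becomes idle when
the service is completed. -/
def serve {N : ℕ} (D : DPH N) : Option (Fin N) → Option (Fin N) → ℝ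
  | none, none => 1
  | none, some _ => 0
  | some i, none => D.b i
  | some i, some i' => D.B i i'

/-- The age of information after the packet `s` (phase and age at the beginning of the slot) of a
server is received, if it is (that is, if the server is busy, and is idle at the end `o` of the
slot); `d` is the age of information otherwise. A packet which is not fresher than the freshest
packet received so far is obsolete and changes nothing. -/
def deliver {N : ℕ} : Option (Fin N × ℕ) → Option (Fin N) → ℕ → ℕ
  | some (_, a), none, d => min d (a + 1)
  | _, _, d => d

/-- The server on which a packet is started when sampling is allowed: an idle server if there is
one, and the server `prio` if both are idle. -/
def sampler {N₁ N₂ : ℕ} (prio : Server) : Option (Fin N₁) → Option (Fin N₂) → Option Server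
  | none, none => some prio
  | none, some _ => some .S1
  | some _, none => some .S2
  | some _, some _ => none

/-- The freezing clock after one more slot without sampling. -/
def tickClock {k : ℕ} (l : Fin k) : Fin k :=
  if h : l.val + 1 < k then ⟨l.val + 1, h⟩ else l

/-- The state after one slot, if the servers move to the statuses `o₁`, `o₂`, and a newly
started packet begins its service in phase `n₁` on server 1, or in phase `n₂` on server 2. A packet
is sampled if the freezing period has elapsed and some server is idle. -/
def SysState.next {N₁ N₂ k : ℕ} [NeZero k] (prio : Server) (x : SysState N₁ N₂ k)
    (o₁ : Option (Fin N₁)) (o₂ : Option (Fin N₂)) (n₁ : Fin N₁) (n₂ : Fin N₂) :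
    SysState N₁ N₂ k :=
  let start : Option Server := if x.clock.val + 1 = k then sampler prio o₁ o₂ else none
  { srv₁ := if start = some .S1 then some (n₁, 0)
      else o₁.bind fun i => x.srv₁.map fun s => (i, s.2 + 1)
    srv₂ := if start = some .S2 then some (n₂, 0)
      else o₂.bind fun j => x.srv₂.map fun s => (j, s.2 + 1)
    clock := if start = none then tickClock x.clock else 0
    aoi := deliver x.srv₂ o₂ (deliver x.srv₁ o₁ (x.aoi + 1)) }

/-- Transition probabilities of the system: the two servers move independently, and the service of
a new packet starts in a phase drawn from `α`. -/
def sysKernel {N₁ N₂ k : ℕ} [NeZero k] (D₁ : DPH N₁) (D₂ : DPH N₂) (prio : Server)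
    (x y : SysState N₁ N₂ k) : ℝ :=
  ∑ o₁ : Option (Fin N₁), ∑ o₂ : Option (Fin N₂), ∑ n₁ : Fin N₁, ∑ n₂ : Fin N₂,
    if x.next prio o₁ o₂ n₁ n₂ = y then
      serve D₁ (x.srv₁.map Prod.fst) o₁ * serve D₂ (x.srv₂.map Prod.fst) o₂ * D₁.α n₁ * D₂.α n₂
    else 0

/-- Slot `t` is the last slot of a cycle of the age of information: an up-to-date packet is received
in slot `t + 1`, so that the age of information does not grow by one. -/
def IsCycleEnd {N₁ N₂ k : ℕ} (x : ℕ → SysState N₁ N₂ k) (t : ℕ) : Prop :=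
  (x (t + 1)).aoi < (x t).aoi + 1

/-- The peak age of information `Φ_n` of cycle `n` (`n = 0, 1, …`) along the trajectory `x`: the age
of information in the last slot of the cycle. -/
def peakAoI {N₁ N₂ k : ℕ} (x : ℕ → SysState N₁ N₂ k) (n : ℕ) : ℕ :=
  (x (Nat.nth (IsCycleEnd x) n)).aoi

/-! ### The recurrent Markov chain of the cyclic alternation of the servers -/

/-- States `(1,0,0,l)`, `(2,i,0,l)`, `(3,0,j,l)`, `(4,i,j,l)`: which servers are busy, with the
phases of their services, and the freezing clock. -/
inductive RMCState (N₁ N₂ k : ℕ)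
  | r1 (l : Fin k)
  | r2 (i : Fin N₁) (l : Fin k)
  | r3 (j : Fin N₂) (l : Fin k)
  | r4 (i : Fin N₁) (j : Fin N₂) (l : Fin k)
  deriving DecidableEq, Fintype

/-- The state of the recurrent Markov chain in a state of the system. -/
def SysState.toRMC {N₁ N₂ k : ℕ} (x : SysState N₁ N₂ k) : RMCState N₁ N₂ k :=
  match x.srv₁, x.srv₂ with
  | none, none => .r1 x.clock
  | some s, none => .r2 s.1 x.clock
  | none, some s => .r3 s.1 x.clock
  | some s, some s' => .r4 s.1 s'.1 x.clock

/-- Indicator of `l < k - 1` and `l' = l + 1`. -/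
def adv {k : ℕ} (l l' : Fin k) : ℝ := if l'.val = l.val + 1 then 1 else 0

/-- Indicator of `l = k - 1` and `l' = 0`. -/
def rst {k : ℕ} (l l' : Fin k) : ℝ := if l.val + 1 = k ∧ l'.val = 0 then 1 else 0

/-- Indicator of `l = k - 1`. -/
def atEnd {k : ℕ} (l : Fin k) : ℝ := if l.val + 1 = k then 1 else 0

/-- Indicator of `l < k - 1` and `l' = l + 1`, or `l = l' = k - 1`. -/
def stay {k : ℕ} (l l' : Fin k) : ℝ :=
  if l'.val = l.val + 1 ∨ (l.val + 1 = k ∧ l' = l) then 1 else 0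

/-- Indicator that server `s` has priority. -/
def prioInd (prio s : Server) : ℝ := if prio = s then 1 else 0

/-- Transition matrix of the recurrent Markov chain. -/
def rmcMatrix {N₁ N₂ k : ℕ} (D₁ : DPH N₁) (D₂ : DPH N₂) (prio : Server) :
    Matrix (RMCState N₁ N₂ k) (RMCState N₁ N₂ k) ℝ := fun w w' =>
  match w, w' with
  | .r1 l, .r1 l' => adv l l'
  | .r1 l, .r2 i' l' => prioInd prio .S1 * rst l l' * D₁.α i'
  | .r1 l, .r3 j' l' => prioInd prio .S2 * rst l l' * D₂.α j'
  | .r2 i l, .r1 l' => adv l l' * D₁.b i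
  | .r2 i l, .r2 i' l' =>
      prioInd prio .S1 * rst l l' * (D₁.b i * D₁.α i') + adv l l' * D₁.B i i'
  | .r2 i l, .r3 j' l' => prioInd prio .S2 * rst l l' * (D₁.b i * D₂.α j')
  | .r2 i l, .r4 i' j' l' => rst l l' * (D₁.B i i' * D₂.α j')
  | .r3 j l, .r1 l' => adv l l' * D₂.b j
  | .r3 j l, .r2 i' l' => prioInd prio .S1 * rst l l' * (D₂.b j * D₁.α i')
  | .r3 j l, .r3 j' l' =>
      prioInd prio .S2 * rst l l' * (D₂.b j * D₂.α j') + adv l l' * D₂.B j j'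
  | .r3 j l, .r4 i' j' l' => rst l l' * (D₂.B j j' * D₁.α i')
  | .r4 i j l, .r1 l' => adv l l' * (D₁.b i * D₂.b j)
  | .r4 i j l, .r2 i' l' =>
      prioInd prio .S1 * rst l l' * (D₁.b i * D₂.b j * D₁.α i')
        + adv l l' * (D₂.b j * D₁.B i i')
  | .r4 i j l, .r3 j' l' =>
      prioInd prio .S2 * rst l l' * (D₁.b i * D₂.b j * D₂.α j')
        + adv l l' * (D₁.b i * D₂.B j j')
  | .r4 i j l, .r4 i' j' l' =>
      rst l l' * (D₁.b i * D₂.B j j' * D₁.α i')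
        + rst l l' * (D₂.b j * D₁.B i i' * D₂.α j')
        + stay l l' * (D₁.B i i' * D₂.B j j')
  | _, _ => 0

/-! ### The absorbing Markov chain

It starts when a packet `P*` is generated and is absorbed successfully when the first packet fresher
than `P*` is received after `P*` was received as an up-to-date packet, and unsuccessfully when `P*`
becomes obsolete. -/

/-- The transient states. `i`, `j` are the phases of the services on servers 1, 2, and `l` is the
freezing clock; `τ₁`, `τ₂` are the generation instants of the packets in service on servers 1, 2.

* `t1`: `P*` on server 1, `τ₁ > τ₂`;  `t2`: `P*` on server 1, `τ₁ < τ₂`;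
* `t3`: `P*` on server 2, `τ₁ > τ₂`;  `t4`: `P*` on server 2, `τ₁ < τ₂`;
* `t5`: `P*` on server 1, server 2 idle;  `t6`: `P*` on server 2, server 1 idle.

In the other states `P*` has been received:

* `t7`: both servers idle;  `t8`: both packets in service up to date;
* `t9`: obsolete packet on server 1, server 2 idle;
* `t10`: obsolete packet on server 2, server 1 idle;
* `t11`: up-to-date packet on server 1, obsolete packet on server 2;
* `t12`: up-to-date packet on server 2, obsolete packet on server 1;
* `t13`: up-to-date packet on server 1, server 2 idle;
* `t14`: up-to-date packet on server 2, server 1 idle. -/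
inductive TState (N₁ N₂ k : ℕ)
  | t1 (i : Fin N₁) (j : Fin N₂) (l : Fin k)
  | t2 (i : Fin N₁) (j : Fin N₂) (l : Fin k)
  | t3 (i : Fin N₁) (j : Fin N₂) (l : Fin k)
  | t4 (i : Fin N₁) (j : Fin N₂) (l : Fin k)
  | t5 (i : Fin N₁) (l : Fin k)
  | t6 (j : Fin N₂) (l : Fin k)
  | t7 (l : Fin k)
  | t8 (i : Fin N₁) (j : Fin N₂)
  | t9 (i : Fin N₁) (l : Fin k)
  | t10 (j : Fin N₂) (l : Fin k)
  | t11 (i : Fin N₁) (j : Fin N₂) (l : Fin k)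
  | t12 (i : Fin N₁) (j : Fin N₂) (l : Fin k)
  | t13 (i : Fin N₁) (l : Fin k)
  | t14 (j : Fin N₂) (l : Fin k)
  deriving DecidableEq, Fintype

/-- The two absorbing states. -/
inductive Absorbed
  | success
  | failure
  deriving DecidableEq

instance : Fintype Absorbed := ⟨{.success, .failure}, by intro x; cases x <;> simp⟩

/-- The matrix `A` of transition probabilities between transient states. -/
def amcA {N₁ N₂ k : ℕ} (D₁ : DPH N₁) (D₂ : DPH N₂) (prio : Server) :
    Matrix (TState N₁ N₂ k) (TState N₁ N₂ k) ℝ := fun s s' =>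
  match s, s' with
  | .t1 i j l, .t10 j' l' => adv l l' * (D₁.b i * D₂.B j j')
  | .t1 i j l, .t11 i' j' l' => rst l l' * (D₁.b i * D₂.B j j' * D₁.α i')
  | .t1 i j l, .t7 l' => adv l l' * (D₁.b i * D₂.b j)
  | .t1 i j l, .t13 i' l' => prioInd prio .S1 * rst l l' * (D₁.b i * D₂.b j * D₁.α i')
  | .t1 i j l, .t14 j' l' => prioInd prio .S2 * rst l l' * (D₁.b i * D₂.b j * D₂.α j')
  | .t1 i j l, .t5 i' l' => adv l l' * (D₂.b j * D₁.B i i')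
  | .t1 i j l, .t2 i' j' l' => rst l l' * (D₂.b j * D₁.B i i' * D₂.α j')
  | .t1 i j l, .t1 i' j' l' => stay l l' * (D₁.B i i' * D₂.B j j')
  | .t2 i j l, .t14 j' l' => adv l l' * (D₁.b i * D₂.B j j')
  | .t2 i j l, .t8 i' j' => atEnd l * (D₁.b i * D₂.B j j' * D₁.α i')
  | .t2 i j l, .t2 i' j' l' => stay l l' * (D₁.B i i' * D₂.B j j')
  | .t3 i j l, .t13 i' l' => adv l l' * (D₂.b j * D₁.B i i')
  | .t3 i j l, .t8 i' j' => atEnd l * (D₂.b j * D₁.B i i' * D₂.α j')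
  | .t3 i j l, .t3 i' j' l' => stay l l' * (D₁.B i i' * D₂.B j j')
  | .t4 i j l, .t6 j' l' => adv l l' * (D₁.b i * D₂.B j j')
  | .t4 i j l, .t3 i' j' l' => rst l l' * (D₁.b i * D₂.B j j' * D₁.α i')
  | .t4 i j l, .t7 l' => adv l l' * (D₁.b i * D₂.b j)
  | .t4 i j l, .t13 i' l' => prioInd prio .S1 * rst l l' * (D₁.b i * D₂.b j * D₁.α i')
  | .t4 i j l, .t14 j' l' => prioInd prio .S2 * rst l l' * (D₁.b i * D₂.b j * D₂.α j')
  | .t4 i j l, .t9 i' l' => adv l l' * (D₂.b j * D₁.B i i')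
  | .t4 i j l, .t12 i' j' l' => rst l l' * (D₂.b j * D₁.B i i' * D₂.α j')
  | .t4 i j l, .t4 i' j' l' => stay l l' * (D₁.B i i' * D₂.B j j')
  | .t5 i l, .t7 l' => adv l l' * D₁.b i
  | .t5 i l, .t13 i' l' => prioInd prio .S1 * rst l l' * (D₁.b i * D₁.α i')
  | .t5 i l, .t14 j' l' => prioInd prio .S2 * rst l l' * (D₁.b i * D₂.α j')
  | .t5 i l, .t5 i' l' => adv l l' * D₁.B i i'
  | .t5 i l, .t2 i' j' l' => rst l l' * (D₁.B i i' * D₂.α j')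
  | .t6 j l, .t7 l' => adv l l' * D₂.b j
  | .t6 j l, .t13 i' l' => prioInd prio .S1 * rst l l' * (D₂.b j * D₁.α i')
  | .t6 j l, .t14 j' l' => prioInd prio .S2 * rst l l' * (D₂.b j * D₂.α j')
  | .t6 j l, .t6 j' l' => adv l l' * D₂.B j j'
  | .t6 j l, .t3 i' j' l' => rst l l' * (D₂.B j j' * D₁.α i')
  | .t7 l, .t7 l' => adv l l'
  | .t7 l, .t13 i' l' => prioInd prio .S1 * rst l l' * D₁.α i'
  | .t7 l, .t14 j' l' => prioInd prio .S2 * rst l l' * D₂.α j'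
  | .t8 i j, .t8 i' j' => D₁.B i i' * D₂.B j j'
  | .t9 i l, .t7 l' => adv l l' * D₁.b i
  | .t9 i l, .t13 i' l' => prioInd prio .S1 * rst l l' * (D₁.b i * D₁.α i')
  | .t9 i l, .t14 j' l' => prioInd prio .S2 * rst l l' * (D₁.b i * D₂.α j')
  | .t9 i l, .t9 i' l' => adv l l' * D₁.B i i'
  | .t9 i l, .t12 i' j' l' => rst l l' * (D₁.B i i' * D₂.α j')
  | .t10 j l, .t7 l' => adv l l' * D₂.b j
  | .t10 j l, .t13 i' l' => prioInd prio .S1 * rst l l' * (D₂.b j * D₁.α i')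
  | .t10 j l, .t14 j' l' => prioInd prio .S2 * rst l l' * (D₂.b j * D₂.α j')
  | .t10 j l, .t10 j' l' => adv l l' * D₂.B j j'
  | .t10 j l, .t11 i' j' l' => rst l l' * (D₂.B j j' * D₁.α i')
  | .t11 i j l, .t13 i' l' => adv l l' * (D₂.b j * D₁.B i i')
  | .t11 i j l, .t8 i' j' => atEnd l * (D₂.b j * D₁.B i i' * D₂.α j')
  | .t11 i j l, .t11 i' j' l' => stay l l' * (D₁.B i i' * D₂.B j j')
  | .t12 i j l, .t14 j' l' => adv l l' * (D₁.b i * D₂.B j j')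
  | .t12 i j l, .t8 i' j' => atEnd l * (D₁.b i * D₂.B j j' * D₁.α i')
  | .t12 i j l, .t12 i' j' l' => stay l l' * (D₁.B i i' * D₂.B j j')
  | .t13 i l, .t13 i' l' => adv l l' * D₁.B i i'
  | .t13 i l, .t8 i' j' => atEnd l * (D₁.B i i' * D₂.α j')
  | .t14 j l, .t14 j' l' => adv l l' * D₂.B j j'
  | .t14 j l, .t8 i' j' => atEnd l * (D₂.B j j' * D₁.α i')
  | _, _ => 0

/-- The vector `c_s` of one-step probabilities of absorption into the successful state. -/
def amcCs {N₁ N₂ k : ℕ} (D₁ : DPH N₁) (D₂ : DPH N₂) : TState N₁ N₂ k → ℝ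
  | .t8 i j => D₁.b i + D₂.b j - D₁.b i * D₂.b j
  | .t11 i _ _ => D₁.b i
  | .t12 _ j _ => D₂.b j
  | .t13 i _ => D₁.b i
  | .t14 j _ => D₂.b j
  | _ => 0

/-- The vector `c_u` of one-step probabilities of absorption into the unsuccessful state. -/
def amcCu {N₁ N₂ k : ℕ} (D₁ : DPH N₁) (D₂ : DPH N₂) : TState N₁ N₂ k → ℝ
  | .t2 _ j _ => D₂.b j
  | .t3 i _ _ => D₁.b i
  | _ => 0

/-- The transition matrix `Q = [A, c_s, c_u; 0, 1, 0; 0, 0, 1]` of the absorbing Markov chain. -/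
def amcQ {N₁ N₂ k : ℕ} (D₁ : DPH N₁) (D₂ : DPH N₂) (prio : Server) :
    Matrix (TState N₁ N₂ k ⊕ Absorbed) (TState N₁ N₂ k ⊕ Absorbed) ℝ :=
  Matrix.fromBlocks (amcA D₁ D₂ prio)
    (fun s o => match o with
      | .success => amcCs D₁ D₂ s
      | .failure => amcCu D₁ D₂ s)
    0 1

/-- The clock value `k - 1`. -/
def lastClock (k : ℕ) [NeZero k] : Fin k := ⟨k - 1, Nat.sub_one_lt (NeZero.ne k)⟩

/-- For each transient state, the probability that in a given slot of the steady state `p` of the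
recurrent Markov chain a packet is generated and the system is left in that state, where `P*` is
the new packet. -/
def initWeight {N₁ N₂ k : ℕ} [NeZero k] (D₁ : DPH N₁) (D₂ : DPH N₂) (prio : Server)
    (p : RMCState N₁ N₂ k → ℝ) : TState N₁ N₂ k → ℝ
  | .t1 i' j' l' => if l' = 0 then
      ∑ j, D₂.B j j' * D₁.α i' * p (.r3 j (lastClock k))
        + ∑ i, ∑ j, D₁.b i * D₂.B j j' * D₁.α i' * p (.r4 i j (lastClock k))
      else 0
  | .t4 i' j' l' => if l' = 0 then
      ∑ i, D₁.B i i' * D₂.α j' * p (.r2 i (lastClock k))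
        + ∑ i, ∑ j, D₂.b j * D₁.B i i' * D₂.α j' * p (.r4 i j (lastClock k))
      else 0
  | .t5 i' l' => if prio = .S1 ∧ l' = 0 then
      D₁.α i' * p (.r1 (lastClock k))
        + ∑ i, D₁.b i * D₁.α i' * p (.r2 i (lastClock k))
        + ∑ j, D₂.b j * D₁.α i' * p (.r3 j (lastClock k))
        + ∑ i, ∑ j, D₁.b i * D₂.b j * D₁.α i' * p (.r4 i j (lastClock k))
      else 0
  | .t6 j' l' => if prio = .S2 ∧ l' = 0 then
      D₂.α j' * p (.r1 (lastClock k))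
        + ∑ i, D₁.b i * D₂.α j' * p (.r2 i (lastClock k))
        + ∑ j, D₂.b j * D₂.α j' * p (.r3 j (lastClock k))
        + ∑ i, ∑ j, D₁.b i * D₂.b j * D₂.α j' * p (.r4 i j (lastClock k))
      else 0
  | _ => 0

/-- The initial probability vector `σ` of the absorbing Markov chain. -/
def sigma {N₁ N₂ k : ℕ} [NeZero k] (D₁ : DPH N₁) (D₂ : DPH N₂) (prio : Server)
    (p : RMCState N₁ N₂ k → ℝ) : TState N₁ N₂ k → ℝ := fun s =>
  initWeight D₁ D₂ prio p s / ∑ s', initWeight D₁ D₂ prio p s'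

/-- The law at time `h` of the absorbing Markov chain with initial vector `σ`. -/
def amcLaw {N₁ N₂ k : ℕ} [NeZero k] (D₁ : DPH N₁) (D₂ : DPH N₂) (prio : Server)
    (p : RMCState N₁ N₂ k → ℝ) (h : ℕ) : TState N₁ N₂ k ⊕ Absorbed → ℝ :=
  Sum.elim (sigma D₁ D₂ prio p) 0 ᵥ* amcQ D₁ D₂ prio ^ h

end DTDQ

end

noncomputable section

namespace DTDQ

/-! ### Phase-type services -/

namespace DPH

variable {N : ℕ} (D : DPH N)

/-! The law of the peak age is a quotient of two rates per slot: the rate of cycles of peak `h` over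
the rate of all cycles.

A cycle of peak `h` ends when the freshest received packet has age `h` and a fresher one arrives,
that is, when the packet generated `h` slots earlier is absorbed successfully. For each age `r`, the
state of the absorbing chain of the packet of age `r` is a function `label r x` of the system state,
depending only on how the other ages compare with `r`. Over one slot the labels follow `A`
(`sysMean_label_succ`), and the conditional probability that a cycle of peak `r` ends is `c_s` at
the label (`sysMean_cycleEnd`). The label of a packet just generated has a mean `genMean` depending
only on the state of `W`; averaged under `p` it is the unnormalised `σ` (`sum_genMean`). So a cycle
of peak `h` ends, `h + 1` slots after `W` was in state `w`, with mean `genMean (A ^ h c_s) w`. Time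
averages of `W` converge to `p` by uniqueness on the visited states
(`tendsto_cesaro_of_unique_stationary`), which gives the rate `p ⬝ᵥ genMean (A ^ h c_s)`.

Put `e = (1 - A)⁻¹ c_s`, the vector of success probabilities. The rate of all cycles is `λ = p ⬝ᵥ
genMean e`. Averaging over cycles instead of slots needs the number of cycles to be close to `λ T`
in `L¹`, not only in mean. This comes from a martingale: the sum of `e` over the labels of all
packets generated after time 0, plus a potential on `W`, is bounded because at most three ages
matter at a time; corrected by the number of ended cycles and by an almost constant compensator, it
has bounded orthogonal increments (`integral_sq_sum_le`, `exists_bound_freshInd`). Cycles due to the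
initial state are finitely many on each trajectory and disappear by dominated convergence
(`tendsto_integral_sub`). Then `tendsto_div_of_abs_sub_le` compares `n` cycles with about `n / λ`
slots.

It remains that the denominators do not vanish. A Lyapunov function makes the powers of `A` summable
(`exists_drift`); another shows that packets are generated at a positive rate
(`sum_initWeight_pos`); and since at most two packets in service are fresher than the received ones,
there are asymptotically at most two generations per cycle, whence `λ > 0`
(`dotProduct_genMean_one_le`). The normalisation of `σ` cancels in the quotient. -/

theorem b_eq (i : Fin N) : D.b i = 1 - ∑ j, D.B i j := by
  simp [DPH.b, mulVec, dotProduct, Matrix.one_apply]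

theorem b_nonneg (i : Fin N) : 0 ≤ D.b i := by
  rw [b_eq]; linarith [D.B_sum_le i]

@[simp] theorem sum_α_mul (c : ℝ) : ∑ n, D.α n * c = c := by
  rw [← Finset.sum_mul, D.α_sum, one_mul]

theorem sum_B (i : Fin N) : ∑ j, D.B i j = 1 - D.b i := by
  rw [b_eq]; ring

/-- Powers of a DPH matrix vanish in the limit. -/
theorem tendsto_pow (i j : Fin N) : Tendsto (fun n : ℕ => (D.B ^ n) i j) atTop (𝓝 0) := by
  have hn : ∀ n : ℕ, ∀ i j, 0 ≤ (D.B ^ n) i j := by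
    intro n
    induction n with
    | zero => intro i j; simp [Matrix.one_apply]; split_ifs <;> norm_num
    | succ n ih =>
      intro i j
      rw [pow_succ, Matrix.mul_apply]
      exact Finset.sum_nonneg fun l _ => mul_nonneg (ih i l) (D.B_nonneg l j)
  refine squeeze_zero (fun n => hn n i j) (fun n => ?_) (D.transient i)
  exact Finset.single_le_sum (f := fun j => (D.B ^ n) i j) (fun j _ => hn n i j) (Finset.mem_univ j)

end DPH

/-- If the powers of a matrix tend to zero, then `1 - M` is invertible. -/
theorem isUnit_one_sub_of_tendsto_pow {S : Type*} [Fintype S] [DecidableEq S] {M : Matrix S S ℝ}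
    (hM : ∀ i j, Tendsto (fun n : ℕ => (M ^ n) i j) atTop (𝓝 0)) : IsUnit (1 - M) := by
  rw [← Matrix.mulVec_injective_iff_isUnit]
  rw [← Matrix.coe_mulVecLin, ← LinearMap.ker_eq_bot, LinearMap.ker_eq_bot']
  intro v hv
  -- A vector killed by `1 - M` is fixed by `M`, hence by all its powers, which tend to zero.
  have h1 : M *ᵥ v = v := by
    simp only [Matrix.mulVecLin_apply, Matrix.sub_mulVec, Matrix.one_mulVec] at hv
    exact (sub_eq_zero.1 hv).symm
  have h2 : ∀ n : ℕ, M ^ n *ᵥ v = v := by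
    intro n
    induction n with
    | zero => simp
    | succ n ih => rw [pow_succ, ← Matrix.mulVec_mulVec, h1, ih]
  ext i
  have h3 : Tendsto (fun n : ℕ => (M ^ n *ᵥ v) i) atTop (𝓝 (∑ j, 0 * v j)) := by
    simp only [Matrix.mulVec, dotProduct]
    exact tendsto_finsetSum _ fun j _ => (hM i j).mul_const _
  simp only [h2, zero_mul, Finset.sum_const_zero] at h3
  exact tendsto_nhds_unique tendsto_const_nhds h3

theorem pow_entry_nonneg {S : Type*} [Fintype S] [DecidableEq S] {M : Matrix S S ℝ}
    (h0 : ∀ i j, 0 ≤ M i j) (n : ℕ) (i j : S) : 0 ≤ (M ^ n) i j := by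
  induction n generalizing i j with
  | zero => simp [Matrix.one_apply]; split_ifs <;> norm_num
  | succ n ih =>
    rw [pow_succ, Matrix.mul_apply]
    exact Finset.sum_nonneg fun l _ => mul_nonneg (ih i l) (h0 l j)

theorem mulVec_mono {S : Type*} [Fintype S] {M : Matrix S S ℝ}
    (h0 : ∀ i j, 0 ≤ M i j) {v w : S → ℝ} (h : ∀ i, v i ≤ w i) (i : S) :
    (M *ᵥ v) i ≤ (M *ᵥ w) i :=
  Finset.sum_le_sum fun j _ => mul_le_mul_of_nonneg_left (h j) (h0 i j)

/-- A nonnegative matrix with a Lyapunov function of drift `-1` has summable powers. -/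
theorem summable_pow_of_drift {S : Type*} [Fintype S] [DecidableEq S] {M : Matrix S S ℝ}
    (h0 : ∀ i j, 0 ≤ M i j) (V : S → ℝ) (hV : ∀ i, 0 ≤ V i)
    (hdrift : ∀ i, (M *ᵥ V) i ≤ V i - 1) (i j : S) : Summable fun n : ℕ => (M ^ n) i j := by
  have hn : ∀ n : ℕ, ∀ i j, 0 ≤ (M ^ n) i j := pow_entry_nonneg h0
  -- Each step spends at least one unit of `V`: the mean number of steps so far plus the mean of
  -- what is left stays below the initial value.
  have key : ∀ n : ℕ, ∀ i, ∑ m ∈ Finset.range n, (M ^ m *ᵥ 1) i + (M ^ n *ᵥ V) i ≤ V i := by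
    intro n
    induction n with
    | zero => intro i; simp
    | succ n ih =>
      intro i
      refine le_trans ?_ (ih i)
      rw [Finset.sum_range_succ, pow_succ, ← Matrix.mulVec_mulVec]
      have h1 : (M ^ n *ᵥ (M *ᵥ V)) i ≤ (M ^ n *ᵥ (V - 1)) i :=
        mulVec_mono (hn n) (fun j => by simpa using hdrift j) i
      rw [Matrix.mulVec_sub, Pi.sub_apply] at h1
      linarith
  refine summable_of_sum_range_le (c := V i) (fun n => hn n i j) fun n => ?_
  have h2 : 0 ≤ (M ^ n *ᵥ V) i := Finset.sum_nonneg fun l _ => mul_nonneg (hn n i l) (hV l)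
  refine le_trans (Finset.sum_le_sum fun m _ => ?_) (le_trans (le_add_of_nonneg_right h2) (key n i))
  simp only [Matrix.mulVec, dotProduct, Pi.one_apply, mul_one]
  exact Finset.single_le_sum (f := fun j => (M ^ m) i j) (fun j _ => hn m i j) (Finset.mem_univ j)

/-- The mean number of remaining slots of a service. -/
theorem DPH.exists_mean {N : ℕ} (D : DPH N) :
    ∃ f : Fin N → ℝ, (∀ i, 0 ≤ f i) ∧ ∀ i, ∑ j, D.B i j * f j = f i - 1 := by
  have hU := isUnit_one_sub_of_tendsto_pow D.tendsto_pow
  set f : Fin N → ℝ := (1 - D.B)⁻¹ *ᵥ 1 with hf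
  have h1 : D.B *ᵥ f = f - 1 := by
    have : (1 - D.B) *ᵥ f = 1 := by
      rw [hf, Matrix.mulVec_mulVec, Matrix.mul_nonsing_inv _ ((Matrix.isUnit_iff_isUnit_det _).1 hU),
        Matrix.one_mulVec]
    rw [Matrix.sub_mulVec, Matrix.one_mulVec] at this
    rw [← this]; abel
  have h2 : ∀ i, ∑ j, D.B i j * f j = f i - 1 := fun i => congrFun h1 i
  refine ⟨f, fun i => ?_, h2⟩
  -- The sign of `f` is not visible from the inverse matrix. It follows because `B f = f - 1 ≤ f`
  -- keeps `B ^ n f` below `f`, while `B ^ n f` tends to zero.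
  have h3 : ∀ n : ℕ, D.B ^ n *ᵥ f ≤ f := by
    intro n
    induction n with
    | zero => simp
    | succ n ih =>
      rw [pow_succ, ← Matrix.mulVec_mulVec, h1]
      intro i
      refine le_trans (mulVec_mono (pow_entry_nonneg D.B_nonneg n) (w := f) ?_ i) (ih i)
      intro j; simp
  have h4 : Tendsto (fun n : ℕ => (D.B ^ n *ᵥ f) i) atTop (𝓝 (∑ j, 0 * f j)) := by
    simp only [Matrix.mulVec, dotProduct]
    exact tendsto_finsetSum _ fun j _ => (D.tendsto_pow i j).mul_const _
  simp only [zero_mul, Finset.sum_const_zero] at h4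
  exact le_of_tendsto h4 (Eventually.of_forall fun n => h3 n i)

theorem serve_nonneg {N : ℕ} (D : DPH N) (s o : Option (Fin N)) : 0 ≤ serve D s o := by
  rcases s with _ | i <;> rcases o with _ | j <;> simp [serve, D.b_nonneg, D.B_nonneg]

theorem sum_serve {N : ℕ} (D : DPH N) (s : Option (Fin N)) : ∑ o, serve D s o = 1 := by
  rcases s with _ | i <;> simp [Fintype.sum_option, serve, D.sum_B]

theorem sum_serve_mul {N : ℕ} (D : DPH N) (s : Option (Fin N)) (c : ℝ) :
    ∑ o, serve D s o * c = c := by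
  rw [← Finset.sum_mul, sum_serve, one_mul]

/-! ### Mean over one slot -/

/-- The mean of `φ` over the outcome of a slot which begins with statuses `s₁`, `s₂` of the
servers: `o₁`, `o₂` are the statuses after the slot, and `n₁`, `n₂` the phases in which a new packet
would start. -/
def stepMean {N₁ N₂ : ℕ} (D₁ : DPH N₁) (D₂ : DPH N₂) (s₁ : Option (Fin N₁)) (s₂ : Option (Fin N₂))
    (φ : Option (Fin N₁) → Option (Fin N₂) → Fin N₁ → Fin N₂ → ℝ) : ℝ :=
  ∑ o₁, serve D₁ s₁ o₁ * ∑ o₂, serve D₂ s₂ o₂ * ∑ n₁, D₁.α n₁ * ∑ n₂, D₂.α n₂ * φ o₁ o₂ n₁ n₂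

section stepMean

variable {N₁ N₂ : ℕ} (D₁ : DPH N₁) (D₂ : DPH N₂) (s₁ : Option (Fin N₁)) (s₂ : Option (Fin N₂))

/-- An idle server becomes busy only through a new packet, so `serve` gives weight zero to the other
outcomes and only feasible ones need to be compared. -/
theorem stepMean_mono {φ ψ : Option (Fin N₁) → Option (Fin N₂) → Fin N₁ → Fin N₂ → ℝ}
    (h : ∀ o₁ o₂ n₁ n₂, (s₁ = none → o₁ = none) → (s₂ = none → o₂ = none) →
      φ o₁ o₂ n₁ n₂ ≤ ψ o₁ o₂ n₁ n₂) :
    stepMean D₁ D₂ s₁ s₂ φ ≤ stepMean D₁ D₂ s₁ s₂ ψ := by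
  unfold stepMean
  refine Finset.sum_le_sum fun o₁ _ => ?_
  by_cases h1 : s₁ = none ∧ o₁ ≠ none
  · have : serve D₁ s₁ o₁ = 0 := by
      rcases o₁ with _ | i
      · exact absurd rfl h1.2
      · rw [h1.1]; rfl
    simp [this]
  refine mul_le_mul_of_nonneg_left (Finset.sum_le_sum fun o₂ _ => ?_) (serve_nonneg _ _ _)
  by_cases h2 : s₂ = none ∧ o₂ ≠ none
  · have : serve D₂ s₂ o₂ = 0 := by
      rcases o₂ with _ | i
      · exact absurd rfl h2.2
      · rw [h2.1]; rfl
    simp [this]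
  refine mul_le_mul_of_nonneg_left (Finset.sum_le_sum fun n₁ _ => ?_) (serve_nonneg _ _ _)
  refine mul_le_mul_of_nonneg_left (Finset.sum_le_sum fun n₂ _ => ?_) (D₁.α_nonneg _)
  refine mul_le_mul_of_nonneg_left (h _ _ _ _ ?_ ?_) (D₂.α_nonneg _)
  · intro h; by_contra h'; exact h1 ⟨h, h'⟩
  · intro h; by_contra h'; exact h2 ⟨h, h'⟩

theorem stepMean_congr {φ ψ : Option (Fin N₁) → Option (Fin N₂) → Fin N₁ → Fin N₂ → ℝ}
    (h : ∀ o₁ o₂ n₁ n₂, (s₁ = none → o₁ = none) → (s₂ = none → o₂ = none) →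
      φ o₁ o₂ n₁ n₂ = ψ o₁ o₂ n₁ n₂) :
    stepMean D₁ D₂ s₁ s₂ φ = stepMean D₁ D₂ s₁ s₂ ψ :=
  le_antisymm (stepMean_mono _ _ _ _ fun _ _ _ _ h1 h2 => (h _ _ _ _ h1 h2).le)
    (stepMean_mono _ _ _ _ fun _ _ _ _ h1 h2 => (h _ _ _ _ h1 h2).ge)

theorem stepMean_const (c : ℝ) : stepMean D₁ D₂ s₁ s₂ (fun _ _ _ _ => c) = c := by
  simp only [stepMean, DPH.sum_α_mul, sum_serve_mul]

theorem stepMean_fst (g : Option (Fin N₁) → ℝ) :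
    stepMean D₁ D₂ s₁ s₂ (fun o₁ _ _ _ => g o₁) = ∑ o, serve D₁ s₁ o * g o := by
  simp only [stepMean, DPH.sum_α_mul, sum_serve_mul]

theorem stepMean_snd (g : Option (Fin N₂) → ℝ) :
    stepMean D₁ D₂ s₁ s₂ (fun _ o₂ _ _ => g o₂) = ∑ o, serve D₂ s₂ o * g o := by
  simp only [stepMean, DPH.sum_α_mul, sum_serve_mul]

theorem stepMean_add (φ ψ : Option (Fin N₁) → Option (Fin N₂) → Fin N₁ → Fin N₂ → ℝ) :
    stepMean D₁ D₂ s₁ s₂ (fun o₁ o₂ n₁ n₂ => φ o₁ o₂ n₁ n₂ + ψ o₁ o₂ n₁ n₂) =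
      stepMean D₁ D₂ s₁ s₂ φ + stepMean D₁ D₂ s₁ s₂ ψ := by
  simp [stepMean, mul_add, Finset.sum_add_distrib]

theorem stepMean_smul (c : ℝ) (φ : Option (Fin N₁) → Option (Fin N₂) → Fin N₁ → Fin N₂ → ℝ) :
    stepMean D₁ D₂ s₁ s₂ (fun o₁ o₂ n₁ n₂ => c * φ o₁ o₂ n₁ n₂) =
      c * stepMean D₁ D₂ s₁ s₂ φ := by
  simp only [stepMean, Finset.mul_sum]
  refine Finset.sum_congr rfl fun _ _ => Finset.sum_congr rfl fun _ _ =>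
    Finset.sum_congr rfl fun _ _ => Finset.sum_congr rfl fun _ _ => ?_
  ring

theorem stepMean_sum {ι : Type*} (I : Finset ι)
    (φ : ι → Option (Fin N₁) → Option (Fin N₂) → Fin N₁ → Fin N₂ → ℝ) :
    stepMean D₁ D₂ s₁ s₂ (fun o₁ o₂ n₁ n₂ => ∑ a ∈ I, φ a o₁ o₂ n₁ n₂) =
      ∑ a ∈ I, stepMean D₁ D₂ s₁ s₂ (φ a) := by
  classical
  induction I using Finset.induction_on with
  | empty => simp [stepMean]
  | insert a I ha ih => simp [Finset.sum_insert ha, stepMean_add, ih]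

end stepMean

end DTDQ

end

noncomputable section

namespace DTDQ

/-! ### The state of the absorbing chain relative to a packet in the system -/

variable {N₁ N₂ k : ℕ}

/-- The state of the absorbing chain, if the comparison of the age of information with the age of
`P*` is `d`, and the statuses of the servers are `s₁`, `s₂`, with the phases of the services and the
comparisons of the ages of the packets in service with the age of `P*`. The value is `none` if `P*`
is obsolete or was never generated, or if a fresher packet was received. -/
def relLabel (l : Fin k) :
    Ordering → Option (Fin N₁ × Ordering) → Option (Fin N₂ × Ordering) → Option (TState N₁ N₂ k)
  | .lt, _, _ => none
  | .eq, none, none => some (.t7 l)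
  | .eq, some (i, .lt), none => some (.t13 i l)
  | .eq, some (i, .eq), none | .eq, some (i, .gt), none => some (.t9 i l)
  | .eq, none, some (j, .lt) => some (.t14 j l)
  | .eq, none, some (j, .eq) | .eq, none, some (j, .gt) => some (.t10 j l)
  | .eq, some (i, .lt), some (j, .lt) => some (.t8 i j)
  | .eq, some (i, .lt), some (j, .eq) | .eq, some (i, .lt), some (j, .gt) => some (.t11 i j l)
  | .eq, some (i, .eq), some (j, .lt) | .eq, some (i, .gt), some (j, .lt) => some (.t12 i j l)
  | .gt, some (i, .eq), none => some (.t5 i l)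
  | .gt, none, some (j, .eq) => some (.t6 j l)
  | .gt, some (i, .eq), some (j, .gt) => some (.t1 i j l)
  | .gt, some (i, .eq), some (j, .lt) => some (.t2 i j l)
  | .gt, some (i, .gt), some (j, .eq) => some (.t4 i j l)
  | .gt, some (i, .lt), some (j, .eq) => some (.t3 i j l)
  | _, _, _ => none

/-- The state of the absorbing chain when the system is in state `x`, where `P*` is the packet of
age `r`. -/
def label (r : ℕ) (x : SysState N₁ N₂ k) : Option (TState N₁ N₂ k) :=
  relLabel x.clock (compare x.aoi r) (x.srv₁.map fun s => (s.1, compare s.2 r))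
    (x.srv₂.map fun s => (s.1, compare s.2 r))

/-- The minimum of two comparisons. -/
def ordMin : Ordering → Ordering → Ordering
  | .lt, _ => .lt
  | .eq, .lt => .lt
  | .eq, _ => .eq
  | .gt, c => c

theorem compare_min (a b r : ℕ) : compare (min a b) r = ordMin (compare a r) (compare b r) := by
  rcases lt_trichotomy a r with h | h | h <;> rcases lt_trichotomy b r with h' | h' | h' <;>
  simp only [compare_lt_iff_lt.2, compare_gt_iff_gt.2, compare_eq_iff_eq.2, h, h', ordMin] <;>
  first
  | exact compare_lt_iff_lt.2 (by omega)
  | exact compare_eq_iff_eq.2 (by omega)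
  | exact compare_gt_iff_gt.2 (show r < _ by omega)

theorem compare_succ (a r : ℕ) : compare (a + 1) (r + 1) = compare a r := by
  simp [Nat.compare_eq_ite_lt]

theorem compare_zero_succ (r : ℕ) : compare 0 (r + 1) = .lt := by
  simp [compare_lt_iff_lt]

/-- The state reached from an idle system, once `P*` has been received. -/
def idleNext [NeZero k] (prio : Server) (l : Fin k) (n₁ : Fin N₁) (n₂ : Fin N₂) : TState N₁ N₂ k :=
  if l.val + 1 = k then
    match prio with
    | .S1 => .t13 n₁ 0
    | .S2 => .t14 n₂ 0
  else .t7 (tickClock l)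

/-- The transient state reached in one slot, if any. -/
def TState.next [NeZero k] (prio : Server) :
    TState N₁ N₂ k → Option (Fin N₁) → Option (Fin N₂) → Fin N₁ → Fin N₂ → Option (TState N₁ N₂ k)
  | .t1 _ _ l, some i', some j', _, _ => some (.t1 i' j' (tickClock l))
  | .t1 _ _ l, some i', none, _, n₂ =>
      some (if l.val + 1 = k then .t2 i' n₂ 0 else .t5 i' (tickClock l))
  | .t1 _ _ l, none, some j', n₁, _ =>
      some (if l.val + 1 = k then .t11 n₁ j' 0 else .t10 j' (tickClock l))
  | .t1 _ _ l, none, none, n₁, n₂ => some (idleNext prio l n₁ n₂)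
  | .t2 _ _ l, some i', some j', _, _ => some (.t2 i' j' (tickClock l))
  | .t2 _ _ l, none, some j', n₁, _ =>
      some (if l.val + 1 = k then .t8 n₁ j' else .t14 j' (tickClock l))
  | .t2 _ _ _, _, none, _, _ => none
  | .t3 _ _ l, some i', some j', _, _ => some (.t3 i' j' (tickClock l))
  | .t3 _ _ l, some i', none, _, n₂ =>
      some (if l.val + 1 = k then .t8 i' n₂ else .t13 i' (tickClock l))
  | .t3 _ _ _, none, _, _, _ => none
  | .t4 _ _ l, some i', some j', _, _ => some (.t4 i' j' (tickClock l))
  | .t4 _ _ l, some i', none, _, n₂ =>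
      some (if l.val + 1 = k then .t12 i' n₂ 0 else .t9 i' (tickClock l))
  | .t4 _ _ l, none, some j', n₁, _ =>
      some (if l.val + 1 = k then .t3 n₁ j' 0 else .t6 j' (tickClock l))
  | .t4 _ _ l, none, none, n₁, n₂ => some (idleNext prio l n₁ n₂)
  | .t5 _ l, some i', _, _, n₂ =>
      some (if l.val + 1 = k then .t2 i' n₂ 0 else .t5 i' (tickClock l))
  | .t5 _ l, none, _, n₁, n₂ => some (idleNext prio l n₁ n₂)
  | .t6 _ l, _, some j', n₁, _ =>
      some (if l.val + 1 = k then .t3 n₁ j' 0 else .t6 j' (tickClock l))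
  | .t6 _ l, _, none, n₁, n₂ => some (idleNext prio l n₁ n₂)
  | .t7 l, _, _, n₁, n₂ => some (idleNext prio l n₁ n₂)
  | .t8 _ _, some i', some j', _, _ => some (.t8 i' j')
  | .t8 _ _, _, _, _, _ => none
  | .t9 _ l, some i', _, _, n₂ =>
      some (if l.val + 1 = k then .t12 i' n₂ 0 else .t9 i' (tickClock l))
  | .t9 _ l, none, _, n₁, n₂ => some (idleNext prio l n₁ n₂)
  | .t10 _ l, _, some j', n₁, _ =>
      some (if l.val + 1 = k then .t11 n₁ j' 0 else .t10 j' (tickClock l))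
  | .t10 _ l, _, none, n₁, n₂ => some (idleNext prio l n₁ n₂)
  | .t11 _ _ l, some i', some j', _, _ => some (.t11 i' j' (tickClock l))
  | .t11 _ _ l, some i', none, _, n₂ =>
      some (if l.val + 1 = k then .t8 i' n₂ else .t13 i' (tickClock l))
  | .t11 _ _ _, none, _, _, _ => none
  | .t12 _ _ l, some i', some j', _, _ => some (.t12 i' j' (tickClock l))
  | .t12 _ _ l, none, some j', n₁, _ =>
      some (if l.val + 1 = k then .t8 n₁ j' else .t14 j' (tickClock l))
  | .t12 _ _ _, _, none, _, _ => none
  | .t13 _ l, some i', _, _, n₂ =>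
      some (if l.val + 1 = k then .t8 i' n₂ else .t13 i' (tickClock l))
  | .t13 _ _, none, _, _, _ => none
  | .t14 _ l, _, some j', n₁, _ =>
      some (if l.val + 1 = k then .t8 n₁ j' else .t14 j' (tickClock l))
  | .t14 _ _, _, none, _, _ => none

/-- The status of server 1. -/
def TState.status₁ : TState N₁ N₂ k → Option (Fin N₁)
  | .t1 i _ _ | .t2 i _ _ | .t3 i _ _ | .t4 i _ _ | .t5 i _ => some i
  | .t8 i _ | .t9 i _ | .t11 i _ _ | .t12 i _ _ | .t13 i _ => some i
  | .t6 _ _ | .t7 _ | .t10 _ _ | .t14 _ _ => none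

/-- The status of server 2. -/
def TState.status₂ : TState N₁ N₂ k → Option (Fin N₂)
  | .t1 _ j _ | .t2 _ j _ | .t3 _ j _ | .t4 _ j _ | .t6 j _ => some j
  | .t8 _ j | .t10 j _ | .t11 _ j _ | .t12 _ j _ | .t14 j _ => some j
  | .t5 _ _ | .t7 _ | .t9 _ _ | .t13 _ _ => none

/-- A packet fresher than the received packet `P*` is received. -/
def TState.Success : TState N₁ N₂ k → Option (Fin N₁) → Option (Fin N₂) → Prop
  | .t8 _ _, o₁, o₂ => o₁ = none ∨ o₂ = none
  | .t11 _ _ _, o₁, _ | .t13 _ _, o₁, _ => o₁ = none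
  | .t12 _ _ _, _, o₂ | .t14 _ _, _, o₂ => o₂ = none
  | _, _, _ => False

/-- The packets in service are distinct, and not both obsolete, as far as packets generated after
time `0` are concerned. -/
def Regular (t : ℕ) (x : SysState N₁ N₂ k) : Prop :=
  ∀ i a j b, x.srv₁ = some (i, a) → x.srv₂ = some (j, b) →
    (a = b → t ≤ a) ∧ (x.aoi ≤ a → x.aoi ≤ b → t ≤ x.aoi)

/-- The statuses `o₁`, `o₂` may follow the state `x`: an idle server stays idle. -/
def Feasible (x : SysState N₁ N₂ k) (o₁ : Option (Fin N₁)) (o₂ : Option (Fin N₂)) : Prop :=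
  (x.srv₁ = none → o₁ = none) ∧ (x.srv₂ = none → o₂ = none)

variable [NeZero k] {prio : Server} {x : SysState N₁ N₂ k} {o₁ : Option (Fin N₁)}
  {o₂ : Option (Fin N₂)} {n₁ : Fin N₁} {n₂ : Fin N₂}

/-- The server on which a packet is started at the end of a slot. -/
def started (prio : Server) (l : Fin k) (o₁ : Option (Fin N₁)) (o₂ : Option (Fin N₂)) :
    Option Server :=
  if l.val + 1 = k then sampler prio o₁ o₂ else none

theorem next_eq : x.next prio o₁ o₂ n₁ n₂ =
    { srv₁ := if started prio x.clock o₁ o₂ = some .S1 then some (n₁, 0)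
        else o₁.bind fun i => x.srv₁.map fun s => (i, s.2 + 1)
      srv₂ := if started prio x.clock o₁ o₂ = some .S2 then some (n₂, 0)
        else o₂.bind fun j => x.srv₂.map fun s => (j, s.2 + 1)
      clock := if started prio x.clock o₁ o₂ = none then tickClock x.clock else 0
      aoi := deliver x.srv₂ o₂ (deliver x.srv₁ o₁ (x.aoi + 1)) } := rfl

theorem deliver_pos {N : ℕ} {s : Option (Fin N × ℕ)} {o : Option (Fin N)} {d : ℕ} (hd : 0 < d) :
    0 < deliver s o d := by
  rcases s with _ | ⟨i, a⟩ <;> rcases o with _ | i' <;> simp [deliver, hd]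

theorem deliver_some {N : ℕ} {s : Option (Fin N × ℕ)} {i : Fin N} {d : ℕ} :
    deliver s (some i) d = d := by
  rcases s with _ | ⟨i, a⟩ <;> simp [deliver]

/-- A packet is received at least one slot after its generation. Hence a packet of age zero is
fresher than everything received so far. -/
theorem next_aoi_pos : 0 < (x.next prio o₁ o₂ n₁ n₂).aoi :=
  deliver_pos (deliver_pos (Nat.succ_pos _))

theorem next_srv₁ {i : Fin N₁} {a : ℕ} (h : (x.next prio o₁ o₂ n₁ n₂).srv₁ = some (i, a)) :
    a = 0 ∨ ∃ i' b, o₁ = some i ∧ x.srv₁ = some (i', b) ∧ a = b + 1 := by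
  simp only [next_eq] at h
  split_ifs at h
  · simp at h; exact Or.inl h.2.symm
  · rcases o₁ with _ | o <;> simp at h
    obtain ⟨i', b, h1, h2, h3⟩ := h
    exact Or.inr ⟨i', b, by rw [h2], h1, h3.symm⟩

theorem next_srv₂ {i : Fin N₂} {a : ℕ} (h : (x.next prio o₁ o₂ n₁ n₂).srv₂ = some (i, a)) :
    a = 0 ∨ ∃ i' b, o₂ = some i ∧ x.srv₂ = some (i', b) ∧ a = b + 1 := by
  simp only [next_eq] at h
  split_ifs at h
  · simp at h; exact Or.inl h.2.symm
  · rcases o₂ with _ | o <;> simp at h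
    obtain ⟨i', b, h1, h2, h3⟩ := h
    exact Or.inr ⟨i', b, by rw [h2], h1, h3.symm⟩

theorem next_not_both_new {i : Fin N₁} {j : Fin N₂} :
    ¬((x.next prio o₁ o₂ n₁ n₂).srv₁ = some (i, 0) ∧ (x.next prio o₁ o₂ n₁ n₂).srv₂ = some (j, 0)) := by
  rintro ⟨h1, h2⟩
  simp only [next_eq] at h1 h2
  split_ifs at h1 h2 with h3 h4 h4
  · rw [h3] at h4; simp at h4
  · rcases o₂ with _ | o <;> simp at h2
  · rcases o₁ with _ | o <;> simp at h1
  · rcases o₁ with _ | o <;> simp at h1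

/-- The initial state is arbitrary, so two initial packets may have equal ages or both be obsolete.
Such anomalies concern ages at least `t` only, and this threshold moves by one per slot like the
ages. No new anomaly arises: at most one packet starts per slot, and its age zero is below the
positive age of information. -/
theorem Regular.next {t : ℕ} (hx : Regular t x) :
    Regular (t + 1) (x.next prio o₁ o₂ n₁ n₂) := by
  intro i a j b h1 h2
  have h0 := next_aoi_pos (x := x) (prio := prio) (o₁ := o₁) (o₂ := o₂) (n₁ := n₁) (n₂ := n₂)
  have h3 := next_not_both_new (x := x) (prio := prio) (o₁ := o₁) (o₂ := o₂) (n₁ := n₁) (n₂ := n₂)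
    (i := i) (j := j)
  rw [h1, h2] at h3
  rcases next_srv₁ h1 with rfl | ⟨i', a', rfl, h5, rfl⟩ <;>
  rcases next_srv₂ h2 with rfl | ⟨j', b', rfl, h6, rfl⟩
  · simp at h3
  · exact ⟨by omega, by omega⟩
  · exact ⟨by omega, by omega⟩
  · obtain ⟨h7, h8⟩ := hx _ _ _ _ h5 h6
    simp only [SysState.next, deliver_some]
    exact ⟨by omega, by omega⟩

/-- The comparison of the age of information with the age of `P*` after a slot. -/
def relDeliver {N : ℕ} : Option (Fin N × Ordering) → Option (Fin N) → Ordering → Ordering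
  | some (_, c), none, d => ordMin d c
  | _, _, d => d

/-- The age of `P*` grows by one per slot together with all the others, so the comparisons evolve
autonomously and the ages themselves can be forgotten. -/
theorem compare_deliver {N : ℕ} (s : Option (Fin N × ℕ)) (o : Option (Fin N)) (d r : ℕ) :
    compare (deliver s o d) (r + 1) =
      relDeliver (s.map fun s => (s.1, compare s.2 r)) o (compare d (r + 1)) := by
  rcases s with _ | ⟨i, a⟩ <;> rcases o with _ | i' <;>
  simp [deliver, relDeliver, compare_min, compare_succ]

/-- Only comparisons with the age of `P*` are left, so this is a finite check. The hypothesis `h`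
excludes the configurations for which it could fail: both servers holding `P*`, or two obsolete
packets in service after `P*` was received. The value `none` is preserved, since a packet that
became obsolete or was never generated stays so. -/
theorem relLabel_next {d : Ordering} {s₁ : Option (Fin N₁ × Ordering)}
    {s₂ : Option (Fin N₂ × Ordering)} {l : Fin k}
    (h₁ : s₁ = none → o₁ = none) (h₂ : s₂ = none → o₂ = none)
    (h : ∀ i c₁ j c₂, s₁ = some (i, c₁) → s₂ = some (j, c₂) →
      ¬(c₁ = .eq ∧ c₂ = .eq) ∧ (d = .eq → c₁ = .lt ∨ c₂ = .lt)) :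
    relLabel (if started prio l o₁ o₂ = none then tickClock l else 0)
        (relDeliver s₂ o₂ (relDeliver s₁ o₁ d))
        (if started prio l o₁ o₂ = some .S1 then some (n₁, .lt)
          else o₁.bind fun i => s₁.map fun s => (i, s.2))
        (if started prio l o₁ o₂ = some .S2 then some (n₂, .lt)
          else o₂.bind fun j => s₂.map fun s => (j, s.2)) =
      (relLabel l d s₁ s₂).bind fun y => y.next prio o₁ o₂ n₁ n₂ := by
  have hstart : started prio l o₁ o₂ = if l.val + 1 = k then sampler prio o₁ o₂ else none := rfl
  by_cases hl : l.val + 1 = k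
  all_goals
    simp only [hl, if_true, if_false] at hstart
    rcases s₁ with _ | ⟨i, c₁⟩
    · obtain rfl := h₁ rfl
      rcases s₂ with _ | ⟨j, c₂⟩
      · obtain rfl := h₂ rfl
        rcases prio <;> rw [hstart] <;> rcases d <;>
        first
        | rfl
        | exact congrArg some (if_pos hl).symm
        | exact congrArg some (if_neg hl).symm
      · rcases o₂ with _ | j' <;> rcases prio <;> rw [hstart] <;> rcases d <;> rcases c₂ <;>
        first
        | rfl
        | exact congrArg some (if_pos hl).symm
        | exact congrArg some (if_neg hl).symm
    · rcases s₂ with _ | ⟨j, c₂⟩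
      · obtain rfl := h₂ rfl
        rcases o₁ with _ | i' <;> rcases prio <;> rw [hstart] <;> rcases d <;> rcases c₁ <;>
        first
        | rfl
        | exact congrArg some (if_pos hl).symm
        | exact congrArg some (if_neg hl).symm
      · have h := h _ _ _ _ rfl rfl
        rcases o₁ with _ | i' <;> rcases o₂ with _ | j' <;> rcases prio <;> rw [hstart] <;>
        rcases d <;> rcases c₁ <;> rcases c₂ <;>
        first
        | rfl
        | exact congrArg some (if_pos hl).symm
        | exact congrArg some (if_neg hl).symm
        | simp at h

/-- The condition `r < t` says that `P*` was generated after time 0: the exceptions allowed by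
`Regular t` involve ages at least `t`, so none of them arises at the age `r`. -/
theorem label_next {r t : ℕ} (hr : r < t) (hx : Regular t x) (ho : Feasible x o₁ o₂) :
    label (r + 1) (x.next prio o₁ o₂ n₁ n₂) =
      (label r x).bind fun y => y.next prio o₁ o₂ n₁ n₂ := by
  rw [label, label, ← relLabel_next]
  · rw [next_eq]
    simp only [compare_deliver, compare_succ]
    congr 1
    · split_ifs
      · simp [compare_zero_succ]
      · rcases o₁ with _ | i' <;> simp [Function.comp_def, compare_succ]
    · split_ifs
      · simp [compare_zero_succ]
      · rcases o₂ with _ | i' <;> simp [Function.comp_def, compare_succ]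
  · intro h; exact ho.1 (by simpa using h)
  · intro h; exact ho.2 (by simpa using h)
  · rintro i c₁ j c₂ h1 h2
    rcases h3 : x.srv₁ with _ | ⟨i', a⟩ <;> simp [h3] at h1
    rcases h4 : x.srv₂ with _ | ⟨j', b⟩ <;> simp [h4] at h2
    obtain ⟨rfl, rfl⟩ := h1
    obtain ⟨rfl, rfl⟩ := h2
    obtain ⟨h5, h6⟩ := hx _ _ _ _ h3 h4
    simp only [compare_eq_iff_eq, compare_lt_iff_lt]
    omega

/-- The end of a cycle in terms of the absorbing chain. -/
theorem success_iff {r t : ℕ} (hr : r < t) (hx : Regular t x) (ho : Feasible x o₁ o₂) :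
    (x.aoi = r ∧ (x.next prio o₁ o₂ n₁ n₂).aoi < r + 1) ↔ ∃ y, label r x = some y ∧ y.Success o₁ o₂ := by
  rw [next_eq]
  rcases x with ⟨s₁, s₂, l, d⟩
  simp only [label]
  rw [← compare_lt_iff_lt, compare_deliver, compare_deliver, compare_succ, ← compare_eq_iff_eq]
  rcases s₁ with _ | ⟨i', a⟩
  · obtain rfl := ho.1 rfl
    rcases s₂ with _ | ⟨j', b⟩
    · obtain rfl := ho.2 rfl
      simp only [Option.map]
      generalize compare d r = c
      rcases c <;> simp [relDeliver, relLabel, TState.Success]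
    · simp only [Option.map]
      generalize compare d r = c
      generalize compare b r = c₂
      rcases c <;> rcases c₂ <;> rcases o₂ with _ | j' <;>
      simp [relDeliver, relLabel, TState.Success, ordMin]
  · rcases s₂ with _ | ⟨j', b⟩
    · obtain rfl := ho.2 rfl
      simp only [Option.map]
      generalize compare d r = c
      generalize compare a r = c₂
      rcases c <;> rcases c₂ <;> rcases o₁ with _ | j' <;>
      simp [relDeliver, relLabel, TState.Success, ordMin]
    · obtain ⟨h5, h6⟩ := hx _ _ _ _ rfl rfl
      have h7 : compare d r = .eq → compare a r = .lt ∨ compare b r = .lt := by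
        simp only [compare_eq_iff_eq, compare_lt_iff_lt]
        simp only at h6
        omega
      clear h5 h6
      simp only [Option.map]
      generalize compare d r = c at *
      generalize compare a r = c₁ at *
      generalize compare b r = c₂ at *
      rcases c <;> rcases c₁ <;> rcases c₂ <;> simp only [reduceCtorEq, false_or, true_or, or_false, imp_false, forall_const, not_true_eq_false] at h7 <;> rcases o₁ with _ | i' <;>
      rcases o₂ with _ | j' <;> simp [relDeliver, relLabel, TState.Success, ordMin]

end DTDQ

end

noncomputable section

namespace DTDQ

variable {N₁ N₂ k : ℕ}

/-! ### Row sums of the transition matrices -/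

theorem sum_TState (g : TState N₁ N₂ k → ℝ) :
    ∑ y, g y = (∑ i, ∑ j, ∑ l, g (.t1 i j l)) + (∑ i, ∑ j, ∑ l, g (.t2 i j l))
      + (∑ i, ∑ j, ∑ l, g (.t3 i j l)) + (∑ i, ∑ j, ∑ l, g (.t4 i j l))
      + (∑ i, ∑ l, g (.t5 i l)) + (∑ j, ∑ l, g (.t6 j l)) + (∑ l, g (.t7 l))
      + (∑ i, ∑ j, g (.t8 i j)) + (∑ i, ∑ l, g (.t9 i l)) + (∑ j, ∑ l, g (.t10 j l))
      + (∑ i, ∑ j, ∑ l, g (.t11 i j l)) + (∑ i, ∑ j, ∑ l, g (.t12 i j l))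
      + (∑ i, ∑ l, g (.t13 i l)) + (∑ j, ∑ l, g (.t14 j l)) := by
  let e : (Fin N₁ × Fin N₂ × Fin k) ⊕ (Fin N₁ × Fin N₂ × Fin k) ⊕ (Fin N₁ × Fin N₂ × Fin k) ⊕
      (Fin N₁ × Fin N₂ × Fin k) ⊕ (Fin N₁ × Fin k) ⊕ (Fin N₂ × Fin k) ⊕ Fin k ⊕ (Fin N₁ × Fin N₂) ⊕
      (Fin N₁ × Fin k) ⊕ (Fin N₂ × Fin k) ⊕ (Fin N₁ × Fin N₂ × Fin k) ⊕
      (Fin N₁ × Fin N₂ × Fin k) ⊕ (Fin N₁ × Fin k) ⊕ (Fin N₂ × Fin k) → TState N₁ N₂ k :=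
    Sum.elim (fun z => .t1 z.1 z.2.1 z.2.2) <| Sum.elim (fun z => .t2 z.1 z.2.1 z.2.2) <|
    Sum.elim (fun z => .t3 z.1 z.2.1 z.2.2) <| Sum.elim (fun z => .t4 z.1 z.2.1 z.2.2) <|
    Sum.elim (fun z => .t5 z.1 z.2) <| Sum.elim (fun z => .t6 z.1 z.2) <|
    Sum.elim (fun z => .t7 z) <| Sum.elim (fun z => .t8 z.1 z.2) <|
    Sum.elim (fun z => .t9 z.1 z.2) <| Sum.elim (fun z => .t10 z.1 z.2) <|
    Sum.elim (fun z => .t11 z.1 z.2.1 z.2.2) <| Sum.elim (fun z => .t12 z.1 z.2.1 z.2.2) <|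
    Sum.elim (fun z => .t13 z.1 z.2) (fun z => .t14 z.1 z.2)
  have he : Function.Bijective e := by
    constructor
    · rintro (x | x | x | x | x | x | x | x | x | x | x | x | x | x)
        (y | y | y | y | y | y | y | y | y | y | y | y | y | y) h <;>
      first
      | (cases h; done)
      | (cases h; rfl)
      | (simp only [e, Sum.elim_inl, Sum.elim_inr, TState.t1.injEq, TState.t2.injEq,
          TState.t3.injEq, TState.t4.injEq, TState.t5.injEq, TState.t6.injEq,
          TState.t8.injEq, TState.t9.injEq, TState.t10.injEq, TState.t11.injEq, TState.t12.injEq,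
          TState.t13.injEq, TState.t14.injEq] at h
         simp [Prod.ext_iff, h])
    · rintro (⟨i, j, l⟩ | ⟨i, j, l⟩ | ⟨i, j, l⟩ | ⟨i, j, l⟩ | ⟨i, l⟩ | ⟨j, l⟩ | l | ⟨i, j⟩ | ⟨i, l⟩ |
        ⟨j, l⟩ | ⟨i, j, l⟩ | ⟨i, j, l⟩ | ⟨i, l⟩ | ⟨j, l⟩)
      · exact ⟨.inl (i, j, l), rfl⟩
      · exact ⟨.inr (.inl (i, j, l)), rfl⟩
      · exact ⟨.inr (.inr (.inl (i, j, l))), rfl⟩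
      · exact ⟨.inr (.inr (.inr (.inl (i, j, l)))), rfl⟩
      · exact ⟨.inr (.inr (.inr (.inr (.inl (i, l))))), rfl⟩
      · exact ⟨.inr (.inr (.inr (.inr (.inr (.inl (j, l)))))), rfl⟩
      · exact ⟨.inr (.inr (.inr (.inr (.inr (.inr (.inl l)))))), rfl⟩
      · exact ⟨.inr (.inr (.inr (.inr (.inr (.inr (.inr (.inl (i, j)))))))), rfl⟩
      · exact ⟨.inr (.inr (.inr (.inr (.inr (.inr (.inr (.inr (.inl (i, l))))))))), rfl⟩
      · exact ⟨.inr (.inr (.inr (.inr (.inr (.inr (.inr (.inr (.inr (.inl (j, l)))))))))), rfl⟩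
      · exact ⟨.inr (.inr (.inr (.inr (.inr (.inr (.inr (.inr (.inr (.inr
          (.inl (i, j, l))))))))))), rfl⟩
      · exact ⟨.inr (.inr (.inr (.inr (.inr (.inr (.inr (.inr (.inr (.inr (.inr
          (.inl (i, j, l)))))))))))), rfl⟩
      · exact ⟨.inr (.inr (.inr (.inr (.inr (.inr (.inr (.inr (.inr (.inr (.inr (.inr
          (.inl (i, l))))))))))))), rfl⟩
      · exact ⟨.inr (.inr (.inr (.inr (.inr (.inr (.inr (.inr (.inr (.inr (.inr (.inr
          (.inr (j, l))))))))))))), rfl⟩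
  rw [← he.sum_comp g]
  simp only [Fintype.sum_sum_type, Fintype.sum_prod_type, e, Sum.elim_inl, Sum.elim_inr]
  ring

theorem sum_RMCState (g : RMCState N₁ N₂ k → ℝ) :
    ∑ w, g w = (∑ l, g (.r1 l)) + (∑ i, ∑ l, g (.r2 i l)) + (∑ j, ∑ l, g (.r3 j l))
      + ∑ i, ∑ j, ∑ l, g (.r4 i j l) := by
  let e : Fin k ⊕ (Fin N₁ × Fin k) ⊕ (Fin N₂ × Fin k) ⊕ (Fin N₁ × Fin N₂ × Fin k) →
      RMCState N₁ N₂ k :=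
    Sum.elim (fun z => .r1 z) <| Sum.elim (fun z => .r2 z.1 z.2) <|
    Sum.elim (fun z => .r3 z.1 z.2) (fun z => .r4 z.1 z.2.1 z.2.2)
  have he : Function.Bijective e := by
    constructor
    · rintro (x | x | x | x) (y | y | y | y) h <;>
      first
      | (cases h; done)
      | (cases h; rfl)
      | (simp only [e, Sum.elim_inl, Sum.elim_inr, RMCState.r2.injEq,
          RMCState.r3.injEq, RMCState.r4.injEq] at h
         simp [Prod.ext_iff, h])
    · rintro (l | ⟨i, l⟩ | ⟨j, l⟩ | ⟨i, j, l⟩)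
      · exact ⟨.inl l, rfl⟩
      · exact ⟨.inr (.inl (i, l)), rfl⟩
      · exact ⟨.inr (.inr (.inl (j, l))), rfl⟩
      · exact ⟨.inr (.inr (.inr (i, j, l))), rfl⟩
  rw [← he.sum_comp g]
  simp only [Fintype.sum_sum_type, Fintype.sum_prod_type, e, Sum.elim_inl, Sum.elim_inr]
  ring

theorem rst_of_eq [NeZero k] {l : Fin k} (hl : l.val + 1 = k) (l' : Fin k) :
    rst l l' = if l' = 0 then 1 else 0 := by
  simp only [rst, and_iff_right hl, Fin.ext_iff, Fin.val_zero]

theorem rst_of_ne {l : Fin k} (hl : ¬l.val + 1 = k) (l' : Fin k) : rst l l' = 0 := by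
  simp [rst, hl]

theorem adv_of_eq {l : Fin k} (hl : l.val + 1 = k) (l' : Fin k) : adv l l' = 0 := by
  have := l'.isLt
  simp only [adv, ite_eq_right_iff]
  omega

theorem adv_of_ne {l : Fin k} (hl : ¬l.val + 1 = k) (l' : Fin k) :
    adv l l' = if l' = tickClock l then 1 else 0 := by
  have h : l.val + 1 < k := by have := l.isLt; omega
  simp [adv, tickClock, h, Fin.ext_iff]

theorem stay_eq {l : Fin k} (l' : Fin k) : stay l l' = if l' = tickClock l then 1 else 0 := by
  have h1 := l.isLt
  have h2 := l'.isLt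
  by_cases h : l.val + 1 < k
  · simp only [stay, tickClock, h, dif_pos, Fin.ext_iff]
    congr 1
    simp only [eq_iff_iff]
    omega
  · simp only [stay, tickClock, h, dif_neg, not_false_eq_true, Fin.ext_iff]
    congr 1
    simp only [eq_iff_iff]
    omega

end DTDQ

end

/-! ### The table of the absorbing chain against the dynamics of a slot. -/

noncomputable section

namespace DTDQ

set_option linter.unusedSimpArgs false

variable {N₁ N₂ k : ℕ}

/-- In `stepMean` the phase of a running service on server 2 is summed before the starting phase on
server 1, whereas the sums over chain states take server 1 first. -/
theorem sum_B_sum_α (D₁ : DPH N₁) (D₂ : DPH N₂) (j : Fin N₂) (g : Fin N₁ → Fin N₂ → ℝ) :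
    ∑ j', D₂.B j j' * ∑ i', D₁.α i' * g i' j' = ∑ i', ∑ j', D₂.B j j' * (D₁.α i' * g i' j') := by
  rw [Finset.sum_comm]
  refine Finset.sum_congr rfl fun j' _ => ?_
  rw [Finset.mul_sum]
  

/-- The row of the transition matrix of the absorbing chain at a state. -/
theorem amcA_mulVec [NeZero k] (D₁ : DPH N₁) (D₂ : DPH N₂) (prio : Server) (v : TState N₁ N₂ k → ℝ)
    (y : TState N₁ N₂ k) :
    (amcA D₁ D₂ prio *ᵥ v) y = stepMean D₁ D₂ y.status₁ y.status₂
      fun o₁ o₂ n₁ n₂ => (y.next prio o₁ o₂ n₁ n₂).elim 0 v := by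
  rw [mulVec, dotProduct, sum_TState]
  rcases y with ⟨i, j, l⟩ | ⟨i, j, l⟩ | ⟨i, j, l⟩ | ⟨i, j, l⟩ | ⟨i, l⟩ | ⟨j, l⟩ | l | ⟨i, j⟩ | ⟨i, l⟩ |
    ⟨j, l⟩ | ⟨i, j, l⟩ | ⟨i, j, l⟩ | ⟨i, l⟩ | ⟨j, l⟩
  all_goals
    unfold amcA TState.status₁ TState.status₂
    dsimp only
    simp only [stepMean, Fintype.sum_option, serve, mul_zero, zero_mul, Finset.sum_const_zero,
      add_zero, zero_add, one_mul]
    unfold TState.next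
    dsimp only [Option.elim]
  case t8 =>
    simp only [DPH.sum_α_mul, mul_zero, zero_mul, Finset.sum_const_zero,
      add_zero, zero_add, Finset.mul_sum, mul_assoc]
  all_goals
    -- At clock `k - 1` the factor `adv` vanishes and `rst` selects clock 0; at any other clock
    -- `rst` vanishes and `adv` selects the next value.
    by_cases hl : l.val + 1 = k
    · rcases prio <;>
      simp only [rst_of_eq hl, adv_of_eq hl, stay_eq, atEnd, idleNext, hl, if_true, ite_mul,
        Finset.sum_ite_eq', Finset.mem_univ, mul_ite, mul_one, mul_zero, zero_mul,
        Finset.sum_const_zero, add_zero, zero_add, one_mul, DPH.sum_α_mul, Finset.sum_ite_eq,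
        prioInd, reduceCtorEq, if_false, sum_B_sum_α D₁ D₂] <;>
      (try simp only [Finset.mul_sum, mul_add, Finset.sum_add_distrib, mul_assoc]) <;>
      try ring_nf
    · simp only [rst_of_ne hl, adv_of_ne hl, stay_eq, atEnd, idleNext, hl, if_false, ite_mul,
        Finset.sum_ite_eq', Finset.mem_univ, if_true, mul_ite, mul_one, mul_zero, zero_mul,
        Finset.sum_const_zero, add_zero, zero_add, one_mul, DPH.sum_α_mul, Finset.sum_ite_eq]
      try simp only [Finset.mul_sum, mul_add, Finset.sum_add_distrib, mul_assoc]
      try ring_nf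

end DTDQ

end

noncomputable section

namespace DTDQ

set_option linter.unusedSimpArgs false

variable {N₁ N₂ k : ℕ}

/-! ### The means of functions of the system over one slot -/

/-- The mean of `F` over the state which follows `x`. -/
def sysMean [NeZero k] (D₁ : DPH N₁) (D₂ : DPH N₂) (prio : Server) (F : SysState N₁ N₂ k → ℝ)
    (x : SysState N₁ N₂ k) : ℝ :=
  stepMean D₁ D₂ (x.srv₁.map Prod.fst) (x.srv₂.map Prod.fst)
    fun o₁ o₂ n₁ n₂ => F (x.next prio o₁ o₂ n₁ n₂)

theorem feasible_of_map {x : SysState N₁ N₂ k} {o₁ : Option (Fin N₁)} {o₂ : Option (Fin N₂)}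
    (h₁ : x.srv₁.map Prod.fst = none → o₁ = none) (h₂ : x.srv₂.map Prod.fst = none → o₂ = none) :
    Feasible x o₁ o₂ :=
  ⟨fun h => h₁ (by simp [h]), fun h => h₂ (by simp [h])⟩

theorem status_of_label {r : ℕ} {x : SysState N₁ N₂ k} {y : TState N₁ N₂ k}
    (h : label r x = some y) :
    x.srv₁.map Prod.fst = y.status₁ ∧ x.srv₂.map Prod.fst = y.status₂ := by
  rcases x with ⟨s₁, s₂, l, d⟩
  simp only [label] at h
  generalize compare d r = c at h
  rcases s₁ with _ | ⟨i, a⟩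
  · rcases s₂ with _ | ⟨j, b⟩
    · rcases c <;> simp [relLabel] at h
      subst h
      exact ⟨rfl, rfl⟩
    · simp only [Option.map] at h
      generalize compare b r = c₂ at h
      rcases c <;> rcases c₂ <;> simp [relLabel] at h <;> subst h <;> exact ⟨rfl, rfl⟩
  · rcases s₂ with _ | ⟨j, b⟩
    · simp only [Option.map] at h
      generalize compare a r = c₂ at h
      rcases c <;> rcases c₂ <;> simp [relLabel] at h <;> subst h <;> exact ⟨rfl, rfl⟩
    · simp only [Option.map] at h
      generalize compare a r = c₁ at h
      generalize compare b r = c₂ at h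
      rcases c <;> rcases c₁ <;> rcases c₂ <;> simp [relLabel] at h <;> subst h <;>
        exact ⟨rfl, rfl⟩

/-- The labels of a packet follow the absorbing chain. -/
theorem sysMean_label_succ [NeZero k] (D₁ : DPH N₁) (D₂ : DPH N₂) (prio : Server) {r t : ℕ}
    (hr : r < t) {x : SysState N₁ N₂ k} (hx : Regular t x) (v : TState N₁ N₂ k → ℝ) :
    sysMean D₁ D₂ prio (fun x' => (label (r + 1) x').elim 0 v) x =
      (label r x).elim 0 (amcA D₁ D₂ prio *ᵥ v) := by
  rw [sysMean, stepMean_congr D₁ D₂ _ _ (fun o₁ o₂ n₁ n₂ h₁ h₂ => by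
    rw [label_next hr hx (feasible_of_map h₁ h₂)])]
  rcases h : label r x with _ | y
  · exact stepMean_const D₁ D₂ _ _ 0
  · obtain ⟨h1, h2⟩ := status_of_label h
    rw [h1, h2]
    exact (amcA_mulVec D₁ D₂ prio v y).symm

open scoped Classical in
theorem amcCs_eq (D₁ : DPH N₁) (D₂ : DPH N₂) (y : TState N₁ N₂ k) :
    amcCs D₁ D₂ y = stepMean D₁ D₂ y.status₁ y.status₂
      fun o₁ o₂ _ _ => if y.Success o₁ o₂ then 1 else 0 := by
  rcases y with ⟨i, j, l⟩ | ⟨i, j, l⟩ | ⟨i, j, l⟩ | ⟨i, j, l⟩ | ⟨i, l⟩ | ⟨j, l⟩ | l | ⟨i, j⟩ | ⟨i, l⟩ |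
    ⟨j, l⟩ | ⟨i, j, l⟩ | ⟨i, j, l⟩ | ⟨i, l⟩ | ⟨j, l⟩ <;>
  simp [stepMean, TState.status₁, TState.status₂, TState.Success, Fintype.sum_option, serve, amcCs,
    D₁.α_sum, D₂.α_sum, D₁.sum_B, D₂.sum_B, ← Finset.sum_mul]
  -- The state `t8` is left: at least one of two independent completions.
  ring

open scoped Classical in
/-- The conditional probability of the end of a cycle of peak `r`. -/
theorem sysMean_cycleEnd [NeZero k] (D₁ : DPH N₁) (D₂ : DPH N₂) (prio : Server) {r t : ℕ}
    (hr : r < t) {x : SysState N₁ N₂ k} (hx : Regular t x) :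
    sysMean D₁ D₂ prio (fun x' => if x.aoi = r ∧ x'.aoi < r + 1 then 1 else 0) x =
      (label r x).elim 0 (amcCs D₁ D₂) := by
  rw [sysMean, stepMean_congr D₁ D₂ _ _ (fun o₁ o₂ n₁ n₂ h₁ h₂ => by
    rw [if_congr (success_iff hr hx (feasible_of_map h₁ h₂)) rfl rfl])]
  rcases h : label r x with _ | y
  · simp only [reduceCtorEq, false_and, exists_false, if_false]
    exact stepMean_const D₁ D₂ _ _ 0
  · obtain ⟨h1, h2⟩ := status_of_label h
    rw [h1, h2]
    simpa using (amcCs_eq D₁ D₂ y).symm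

/-! ### The recurrent chain -/

/-- The state of the recurrent chain with given statuses of the servers. -/
def rmcOf : Option (Fin N₁) → Option (Fin N₂) → Fin k → RMCState N₁ N₂ k
  | none, none, l => .r1 l
  | some i, none, l => .r2 i l
  | none, some j, l => .r3 j l
  | some i, some j, l => .r4 i j l

/-- The state of the recurrent chain at the end of a slot. -/
def rmcNext [NeZero k] (prio : Server) (l : Fin k) (o₁ : Option (Fin N₁)) (o₂ : Option (Fin N₂))
    (n₁ : Fin N₁) (n₂ : Fin N₂) : RMCState N₁ N₂ k :=
  rmcOf (if started prio l o₁ o₂ = some .S1 then some n₁ else o₁)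
    (if started prio l o₁ o₂ = some .S2 then some n₂ else o₂)
    (if started prio l o₁ o₂ = none then tickClock l else 0)

theorem toRMC_eq (x : SysState N₁ N₂ k) :
    x.toRMC = rmcOf (x.srv₁.map Prod.fst) (x.srv₂.map Prod.fst) x.clock := by
  rcases x with ⟨_ | s₁, _ | s₂, l, d⟩ <;> rfl

theorem toRMC_next [NeZero k] {prio : Server} {x : SysState N₁ N₂ k} {o₁ : Option (Fin N₁)}
    {o₂ : Option (Fin N₂)} {n₁ : Fin N₁} {n₂ : Fin N₂} (ho : Feasible x o₁ o₂) :
    (x.next prio o₁ o₂ n₁ n₂).toRMC = rmcNext prio x.clock o₁ o₂ n₁ n₂ := by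
  rw [toRMC_eq, rmcNext, next_eq]
  dsimp only
  obtain ⟨h₁, h₂⟩ := ho
  congr 1
  · split_ifs
    · rfl
    · rcases h : x.srv₁ with _ | s
      · simp [h₁ h]
      · simp [Function.comp_def]
  · split_ifs
    · rfl
    · rcases h : x.srv₂ with _ | s
      · simp [h₂ h]
      · simp [Function.comp_def]

/-- Checks the table against the dynamics. Nonnegativity, unit row sums and the Markov property of
`W` are then read off from means over a slot. -/
theorem rmcMatrix_mulVec [NeZero k] (D₁ : DPH N₁) (D₂ : DPH N₂) (prio : Server)
    (φ : RMCState N₁ N₂ k → ℝ) (s₁ : Option (Fin N₁)) (s₂ : Option (Fin N₂)) (l : Fin k) :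
    (rmcMatrix D₁ D₂ prio *ᵥ φ) (rmcOf s₁ s₂ l) =
      stepMean D₁ D₂ s₁ s₂ fun o₁ o₂ n₁ n₂ => φ (rmcNext prio l o₁ o₂ n₁ n₂) := by
  rw [mulVec, dotProduct, sum_RMCState]
  rcases s₁ with _ | i <;> rcases s₂ with _ | j
  all_goals
    unfold rmcMatrix rmcOf
    dsimp only
    simp only [stepMean, Fintype.sum_option, serve, mul_zero, zero_mul, Finset.sum_const_zero,
      add_zero, zero_add, one_mul]
    unfold rmcNext started
    by_cases hl : l.val + 1 = k
    · rcases prio <;>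
      simp only [rst_of_eq hl, adv_of_eq hl, stay_eq, hl, if_true, ite_mul, sampler, rmcOf,
        Finset.sum_ite_eq', Finset.mem_univ, mul_ite, mul_one, mul_zero, zero_mul, add_mul,
        Finset.sum_const_zero, add_zero, zero_add, one_mul, DPH.sum_α_mul, Finset.sum_ite_eq,
        prioInd, reduceCtorEq, if_false, sum_B_sum_α D₁ D₂, Finset.sum_add_distrib,
        Option.some.injEq] <;>
      (try simp only [Finset.mul_sum, mul_add, Finset.sum_add_distrib, mul_assoc]) <;>
      try ring_nf
    · simp only [rst_of_ne hl, adv_of_ne hl, stay_eq, hl, if_false, ite_mul, rmcOf,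
        Finset.sum_ite_eq', Finset.mem_univ, if_true, mul_ite, mul_one, mul_zero, zero_mul,
        Finset.sum_const_zero, add_zero, zero_add, one_mul, DPH.sum_α_mul, Finset.sum_ite_eq,
        reduceCtorEq, Finset.sum_add_distrib]
      try simp only [Finset.mul_sum, mul_add, Finset.sum_add_distrib, mul_assoc]
      try ring_nf

/-- The states of the recurrent chain follow its transition matrix. -/
theorem sysMean_toRMC [NeZero k] (D₁ : DPH N₁) (D₂ : DPH N₂) (prio : Server)
    (φ : RMCState N₁ N₂ k → ℝ) (x : SysState N₁ N₂ k) :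
    sysMean D₁ D₂ prio (fun x' => φ x'.toRMC) x = (rmcMatrix D₁ D₂ prio *ᵥ φ) x.toRMC := by
  rw [toRMC_eq, rmcMatrix_mulVec, sysMean]
  exact stepMean_congr D₁ D₂ _ _ fun o₁ o₂ n₁ n₂ h₁ h₂ => by
    rw [toRMC_next (feasible_of_map h₁ h₂)]

/-! ### Generation of packets -/

/-- The state of the absorbing chain if a packet `P*` is generated in a slot. -/
def genNext [NeZero k] (prio : Server) (l : Fin k) (o₁ : Option (Fin N₁)) (o₂ : Option (Fin N₂))
    (n₁ : Fin N₁) (n₂ : Fin N₂) : Option (TState N₁ N₂ k) :=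
  match started prio l o₁ o₂ with
  | none => none
  | some .S1 => some (match o₂ with
    | none => .t5 n₁ 0
    | some j' => .t1 n₁ j' 0)
  | some .S2 => some (match o₁ with
    | none => .t6 n₂ 0
    | some i' => .t4 i' n₂ 0)

/-- Relative to age 0, the age of information and every packet already in service compare as
greater, so a label exists exactly when a packet has just started, and that packet is `P*`. -/
theorem label_zero_next [NeZero k] {prio : Server} {x : SysState N₁ N₂ k} {o₁ : Option (Fin N₁)}
    {o₂ : Option (Fin N₂)} {n₁ : Fin N₁} {n₂ : Fin N₂} (ho : Feasible x o₁ o₂) :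
    label 0 (x.next prio o₁ o₂ n₁ n₂) = genNext prio x.clock o₁ o₂ n₁ n₂ := by
  have h0 : compare (x.next prio o₁ o₂ n₁ n₂).aoi 0 = .gt := compare_gt_iff_gt.2 next_aoi_pos
  have h1 : ∀ a : ℕ, compare (a + 1) 0 = .gt := fun a => compare_gt_iff_gt.2 (Nat.succ_pos a)
  have h2 : compare 0 0 = Ordering.eq := rfl
  rw [label, h0, next_eq]
  unfold genNext
  dsimp only
  obtain ⟨ho₁, ho₂⟩ := ho
  rcases hs : started prio x.clock o₁ o₂ with _ | _ | _
  all_goals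
    rcases o₁ with _ | i <;> rcases o₂ with _ | j <;> rcases h₁ : x.srv₁ with _ | s₁ <;>
    rcases h₂ : x.srv₂ with _ | s₂ <;>
    simp [h₁, h₂] at ho₁ ho₂ <;> simp [relLabel, h1, h2]

/-- The mean of `v` over the state of the absorbing chain of a packet generated in the slot which
follows a state of the recurrent chain; zero if no packet is generated. -/
def genMean [NeZero k] (D₁ : DPH N₁) (D₂ : DPH N₂) (prio : Server) (v : TState N₁ N₂ k → ℝ) :
    RMCState N₁ N₂ k → ℝ
  | .r1 l => stepMean D₁ D₂ none none fun o₁ o₂ n₁ n₂ => (genNext prio l o₁ o₂ n₁ n₂).elim 0 v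
  | .r2 i l =>
      stepMean D₁ D₂ (some i) none fun o₁ o₂ n₁ n₂ => (genNext prio l o₁ o₂ n₁ n₂).elim 0 v
  | .r3 j l =>
      stepMean D₁ D₂ none (some j) fun o₁ o₂ n₁ n₂ => (genNext prio l o₁ o₂ n₁ n₂).elim 0 v
  | .r4 i j l =>
      stepMean D₁ D₂ (some i) (some j) fun o₁ o₂ n₁ n₂ => (genNext prio l o₁ o₂ n₁ n₂).elim 0 v

theorem sysMean_label_zero [NeZero k] (D₁ : DPH N₁) (D₂ : DPH N₂) (prio : Server)
    (v : TState N₁ N₂ k → ℝ) (x : SysState N₁ N₂ k) :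
    sysMean D₁ D₂ prio (fun x' => (label 0 x').elim 0 v) x = genMean D₁ D₂ prio v x.toRMC := by
  rw [sysMean, stepMean_congr D₁ D₂ _ _ (fun o₁ o₂ n₁ n₂ h₁ h₂ => by
    rw [label_zero_next (feasible_of_map h₁ h₂)])]
  rcases x with ⟨_ | s₁, _ | s₂, l, d⟩ <;> rfl

theorem genMean_of_ne [NeZero k] (D₁ : DPH N₁) (D₂ : DPH N₂) (prio : Server)
    (v : TState N₁ N₂ k → ℝ) {l : Fin k} (hl : ¬l.val + 1 = k) (s₁ : Option (Fin N₁))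
    (s₂ : Option (Fin N₂)) :
    stepMean D₁ D₂ s₁ s₂ (fun o₁ o₂ n₁ n₂ => (genNext prio l o₁ o₂ n₁ n₂).elim 0 v) = 0 := by
  have : ∀ o₁ o₂ n₁ n₂, genNext (N₁ := N₁) (N₂ := N₂) prio l o₁ o₂ n₁ n₂ = none := by
    intro o₁ o₂ n₁ n₂
    simp [genNext, started, hl]
  simp only [this]
  exact stepMean_const D₁ D₂ _ _ 0

theorem sum_comm₃ {α β γ : Type*} [Fintype α] [Fintype β] [Fintype γ] (f : α → β → γ → ℝ) :
    ∑ x, ∑ y, ∑ z, f x y z = ∑ z, ∑ x, ∑ y, f x y z := by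
  rw [Finset.sum_comm]
  rw [Finset.sum_congr rfl fun y _ => Finset.sum_comm, Finset.sum_comm]
  exact Finset.sum_congr rfl fun z _ => Finset.sum_comm

theorem sum_comm₄ {α β γ δ : Type*} [Fintype α] [Fintype β] [Fintype γ] [Fintype δ]
    (f : α → β → γ → δ → ℝ) :
    ∑ x, ∑ y, ∑ z, ∑ w, f x y z w = ∑ z, ∑ w, ∑ x, ∑ y, f x y z w := by
  rw [sum_comm₃]
  exact Finset.sum_congr rfl fun z _ => sum_comm₃ _

/-- Connects the tabulated initial weights with the system: the stationary mean of `genMean` is a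
pairing with `initWeight`. Only states with clock `k - 1` contribute, since otherwise no packet can
be generated. -/
theorem sum_genMean [NeZero k] (D₁ : DPH N₁) (D₂ : DPH N₂) (prio : Server)
    (p : RMCState N₁ N₂ k → ℝ) (v : TState N₁ N₂ k → ℝ) :
    p ⬝ᵥ genMean D₁ D₂ prio v = initWeight D₁ D₂ prio p ⬝ᵥ v := by
  have hlast : (lastClock k).val + 1 = k := Nat.sub_add_cancel (Nat.pos_of_ne_zero (NeZero.ne k))
  have hsum : ∀ g : Fin k → ℝ, (∀ l, ¬l.val + 1 = k → g l = 0) → ∑ l, g l = g (lastClock k) := by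
    intro g hg
    refine Finset.sum_eq_single _ (fun l _ h => hg l fun h' => h ?_) (fun h => absurd (Finset.mem_univ _) h)
    ext; omega
  rw [dotProduct, dotProduct, sum_RMCState, sum_TState]
  simp only [genMean]
  rw [hsum _ (fun l hl => by rw [genMean_of_ne D₁ D₂ prio v hl, mul_zero])]
  simp only [fun i => hsum (fun l => p (.r2 i l) * stepMean D₁ D₂ (some i) none
    fun o₁ o₂ n₁ n₂ => (genNext prio l o₁ o₂ n₁ n₂).elim 0 v)
      (fun l hl => by rw [genMean_of_ne D₁ D₂ prio v hl, mul_zero]),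
    fun j => hsum (fun l => p (.r3 j l) * stepMean D₁ D₂ none (some j)
    fun o₁ o₂ n₁ n₂ => (genNext prio l o₁ o₂ n₁ n₂).elim 0 v)
      (fun l hl => by rw [genMean_of_ne D₁ D₂ prio v hl, mul_zero]),
    fun i j => hsum (fun l => p (.r4 i j l) * stepMean D₁ D₂ (some i) (some j)
    fun o₁ o₂ n₁ n₂ => (genNext prio l o₁ o₂ n₁ n₂).elim 0 v)
      (fun l hl => by rw [genMean_of_ne D₁ D₂ prio v hl, mul_zero])]
  unfold initWeight
  dsimp only
  rcases prio <;>
  simp only [stepMean, Fintype.sum_option, serve, genNext, started, hlast, sampler, if_true, Option.elim,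
    ite_mul, zero_mul, mul_zero, Finset.sum_ite_eq', Finset.mem_univ, one_mul, true_and, false_and,
    reduceCtorEq, if_false, Finset.sum_const_zero, add_zero, zero_add, DPH.sum_α_mul]
  all_goals
    simp only [sum_B_sum_α D₁ D₂]
    simp only [Finset.mul_sum, Finset.sum_mul, mul_add, add_mul,
      Finset.sum_add_distrib]
    rw [sum_comm₃ fun i j j' => D₂.B j' j * D₁.α i * p (.r3 j' (lastClock k)) * v (.t1 i j 0),
      sum_comm₄ fun i j i' j' =>
        D₁.b i' * D₂.B j' j * D₁.α i * p (.r4 i' j' (lastClock k)) * v (.t1 i j 0),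
      sum_comm₃ fun i j i' => D₁.B i' i * D₂.α j * p (.r2 i' (lastClock k)) * v (.t4 i j 0),
      sum_comm₄ fun i j i' j' =>
        D₂.b j' * D₁.B i' i * D₂.α j * p (.r4 i' j' (lastClock k)) * v (.t4 i j 0)]
  · rw [Finset.sum_comm (f := fun i i' =>
        D₁.b i' * D₁.α i * p (.r2 i' (lastClock k)) * v (.t5 i 0)),
      Finset.sum_comm (f := fun i j' =>
        D₂.b j' * D₁.α i * p (.r3 j' (lastClock k)) * v (.t5 i 0)),
      ← sum_comm₃ fun i' j' i =>
        D₁.b i' * D₂.b j' * D₁.α i * p (.r4 i' j' (lastClock k)) * v (.t5 i 0)]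
    simp only [mul_comm, mul_left_comm, mul_assoc]
    ring
  · rw [Finset.sum_comm (f := fun i i' =>
        D₁.b i' * D₂.α i * p (.r2 i' (lastClock k)) * v (.t6 i 0)),
      Finset.sum_comm (f := fun i j' =>
        D₂.b j' * D₂.α i * p (.r3 j' (lastClock k)) * v (.t6 i 0)),
      ← sum_comm₃ fun i' j' i =>
        D₁.b i' * D₂.b j' * D₂.α i * p (.r4 i' j' (lastClock k)) * v (.t6 i 0)]
    simp only [mul_comm, mul_left_comm, mul_assoc]
    ring

end DTDQ

end

noncomputable section

namespace DTDQ

variable {N₁ N₂ k : ℕ}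

/-! ### Absorption, and generation of packets -/

theorem stepMean_nonneg (D₁ : DPH N₁) (D₂ : DPH N₂) (s₁ : Option (Fin N₁)) (s₂ : Option (Fin N₂))
    {φ : Option (Fin N₁) → Option (Fin N₂) → Fin N₁ → Fin N₂ → ℝ} (h : ∀ o₁ o₂ n₁ n₂, 0 ≤ φ o₁ o₂ n₁ n₂) :
    0 ≤ stepMean D₁ D₂ s₁ s₂ φ :=
  (stepMean_const D₁ D₂ s₁ s₂ 0).symm.le.trans
    (stepMean_mono D₁ D₂ s₁ s₂ fun _ _ _ _ _ _ => h _ _ _ _)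

theorem elim_nonneg {S : Type*} {v : S → ℝ} (hv : ∀ y, 0 ≤ v y) (o : Option S) : 0 ≤ o.elim 0 v := by
  rcases o with _ | y
  · exact le_rfl
  · exact hv y

/-- Applied to a unit vector, the row formula exhibits an entry as the mean of an indicator, so the
table need not be inspected. -/
theorem amcA_nonneg [NeZero k] (D₁ : DPH N₁) (D₂ : DPH N₂) (prio : Server) (y y' : TState N₁ N₂ k) :
    0 ≤ amcA D₁ D₂ prio y y' := by
  have h := amcA_mulVec D₁ D₂ prio (Pi.single y' 1) y
  rw [mulVec_single_one] at h
  change amcA D₁ D₂ prio y y' = _ at h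
  rw [h]
  refine stepMean_nonneg _ _ _ _ fun _ _ _ _ => elim_nonneg (fun z => ?_) _
  by_cases hz : z = y' <;> simp [hz]

theorem rmcOf_surjective (w : RMCState N₁ N₂ k) : ∃ s₁ s₂ l, w = rmcOf s₁ s₂ l := by
  rcases w with l | ⟨i, l⟩ | ⟨j, l⟩ | ⟨i, j, l⟩
  exacts [⟨none, none, l, rfl⟩, ⟨some i, none, l, rfl⟩, ⟨none, some j, l, rfl⟩,
    ⟨some i, some j, l, rfl⟩]

theorem rmcMatrix_nonneg [NeZero k] (D₁ : DPH N₁) (D₂ : DPH N₂) (prio : Server)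
    (w w' : RMCState N₁ N₂ k) : 0 ≤ rmcMatrix D₁ D₂ prio w w' := by
  obtain ⟨s₁, s₂, l, rfl⟩ := rmcOf_surjective w
  have h := rmcMatrix_mulVec D₁ D₂ prio (Pi.single w' 1) s₁ s₂ l
  rw [mulVec_single_one] at h
  change rmcMatrix D₁ D₂ prio _ w' = _ at h
  rw [h]
  refine stepMean_nonneg _ _ _ _ fun _ _ _ _ => ?_
  rw [Pi.single_apply]
  split_ifs <;> norm_num

theorem rmcMatrix_one [NeZero k] (D₁ : DPH N₁) (D₂ : DPH N₂) (prio : Server) :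
    rmcMatrix D₁ D₂ prio *ᵥ (1 : RMCState N₁ N₂ k → ℝ) = 1 := by
  ext w
  obtain ⟨s₁, s₂, l, rfl⟩ := rmcOf_surjective w
  rw [rmcMatrix_mulVec]
  exact stepMean_const D₁ D₂ _ _ 1

/-- One slot consumes one unit of the mean remaining service, a completed service counting as zero.
-/
theorem stepMean_elim_fst (D₁ : DPH N₁) (D₂ : DPH N₂) {f : Fin N₁ → ℝ}
    (hf : ∀ i, ∑ j, D₁.B i j * f j = f i - 1) (i : Fin N₁) (s₂ : Option (Fin N₂)) (C : ℝ) :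
    stepMean D₁ D₂ (some i) s₂ (fun o₁ _ _ _ => C + o₁.elim 0 f) = C + f i - 1 := by
  rw [stepMean_fst D₁ D₂ _ _ fun o₁ => C + o₁.elim 0 f]
  simp only [mul_add, Finset.sum_add_distrib, sum_serve_mul]
  simp only [Fintype.sum_option, serve, Option.elim, mul_zero, zero_add, hf]
  ring

theorem stepMean_elim_snd (D₁ : DPH N₁) (D₂ : DPH N₂) {f : Fin N₂ → ℝ}
    (hf : ∀ i, ∑ j, D₂.B i j * f j = f i - 1) (s₁ : Option (Fin N₁)) (j : Fin N₂) (C : ℝ) :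
    stepMean D₁ D₂ s₁ (some j) (fun _ o₂ _ _ => C + o₂.elim 0 f) = C + f j - 1 := by
  rw [stepMean_snd D₁ D₂ _ _ fun o₂ => C + o₂.elim 0 f]
  simp only [mul_add, Finset.sum_add_distrib, sum_serve_mul]
  simp only [Fintype.sum_option, serve, Option.elim, mul_zero, zero_add, hf]
  ring

/-- A Lyapunov function of the absorbing chain; `f₁`, `f₂` are the mean remaining service times and
`F` is a bound for them. -/
def drift (f₁ : Fin N₁ → ℝ) (f₂ : Fin N₂ → ℝ) (F : ℝ) : TState N₁ N₂ k → ℝ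
  | .t1 i _ _ | .t2 i _ _ | .t5 i _ => k + 3 * F + f₁ i
  | .t3 _ j _ | .t4 _ j _ | .t6 j _ => k + 3 * F + f₂ j
  | .t7 l => k - l + 2 * F
  | .t8 i _ => f₁ i
  | .t9 i _ => k + 2 * F + f₁ i
  | .t10 j _ => k + 2 * F + f₂ j
  | .t11 i _ _ | .t13 i _ => F + f₁ i
  | .t12 _ j _ | .t14 j _ => F + f₂ j

/-- The value of a state is the mean remaining service of the packet that is being waited for, plus
a bound for the stages that may follow. In `t8` it is enough to wait for server 1. From `t11` to
`t14` the fresh packet is awaited, with `F` in reserve for a passage to `t8`. The idle state `t7`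
waits for the clock and then for states worth at most `2 * F`. In `t9` and `t10` the obsolete packet
is awaited, and then states worth at most `k + 2 * F`. Before the reception of `P*` its own service
is awaited, with `k + 3 * F` in reserve. -/
theorem exists_drift [NeZero k] (D₁ : DPH N₁) (D₂ : DPH N₂) (prio : Server) :
    ∃ V : TState N₁ N₂ k → ℝ, (∀ y, 0 ≤ V y) ∧ ∀ y, (amcA D₁ D₂ prio *ᵥ V) y ≤ V y - 1 := by
  obtain ⟨f₁, hf₁, hB₁⟩ := D₁.exists_mean
  obtain ⟨f₂, hf₂, hB₂⟩ := D₂.exists_mean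
  set F : ℝ := ∑ i, f₁ i + ∑ j, f₂ j with hF
  have hS₁ : 0 ≤ ∑ i, f₁ i := Finset.sum_nonneg fun i _ => hf₁ i
  have hS₂ : 0 ≤ ∑ j, f₂ j := Finset.sum_nonneg fun i _ => hf₂ i
  have hF₁ : ∀ i, f₁ i ≤ F := fun i => by
    have := Finset.single_le_sum (f := f₁) (fun i _ => hf₁ i) (Finset.mem_univ i); linarith
  have hF₂ : ∀ j, f₂ j ≤ F := fun j => by
    have := Finset.single_le_sum (f := f₂) (fun i _ => hf₂ i) (Finset.mem_univ j); linarith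
  have hF0 : 0 ≤ F := by linarith
  have hl0 : ∀ l : Fin k, (0 : ℝ) ≤ l ∧ (l : ℝ) + 1 ≤ k := fun l =>
    ⟨Nat.cast_nonneg _, by exact_mod_cast l.isLt⟩
  have hidle : ∀ (l : Fin k) (n₁ : Fin N₁) (n₂ : Fin N₂),
      drift f₁ f₂ F (idleNext prio l n₁ n₂) ≤ k - l + 2 * F - 1 := by
    intro l n₁ n₂
    have h1 := hF₁ n₁
    have h2 := hF₂ n₂
    have h3 := hl0 l
    unfold idleNext
    split_ifs with hl
    · rcases prio <;> simp only [drift] <;> linarith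
    · have hl' : l.val + 1 < k := by have := l.isLt; omega
      simp only [drift, tickClock, hl', dif_pos]
      push_cast
      linarith
  refine ⟨drift f₁ f₂ F, fun y => ?_, fun y => ?_⟩
  · rcases y with ⟨i, j, l⟩ | ⟨i, j, l⟩ | ⟨i, j, l⟩ | ⟨i, j, l⟩ | ⟨i, l⟩ | ⟨j, l⟩ | l | ⟨i, j⟩ |
      ⟨i, l⟩ | ⟨j, l⟩ | ⟨i, j, l⟩ | ⟨i, j, l⟩ | ⟨i, l⟩ | ⟨j, l⟩ <;> simp only [drift] <;>
    first
    | (have := hf₁ i; positivity)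
    | (have := hf₂ j; positivity)
    | (have := hl0 l; linarith)
  · rw [amcA_mulVec]
    -- If the value is `C` plus the remaining service on server 1, it suffices that every outcome is
    -- worth at most `C` plus what then remains of that service.
    have key₁ : ∀ {C : ℝ} {y : TState N₁ N₂ k} {i : Fin N₁}, y.status₁ = some i →
        drift f₁ f₂ F y = C + f₁ i → (∀ o₁ o₂ n₁ n₂, (y.next prio o₁ o₂ n₁ n₂).elim 0 (drift f₁ f₂ F) ≤
          C + o₁.elim 0 f₁) → stepMean D₁ D₂ y.status₁ y.status₂
          (fun o₁ o₂ n₁ n₂ => (y.next prio o₁ o₂ n₁ n₂).elim 0 (drift f₁ f₂ F)) ≤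
          drift f₁ f₂ F y - 1 := by
      intro C y i hy hV h
      rw [hV, hy, ← stepMean_elim_fst D₁ D₂ hB₁ i y.status₂ C]
      exact stepMean_mono _ _ _ _ fun _ _ _ _ _ _ => h _ _ _ _
    have key₂ : ∀ {C : ℝ} {y : TState N₁ N₂ k} {j : Fin N₂}, y.status₂ = some j →
        drift f₁ f₂ F y = C + f₂ j → (∀ o₁ o₂ n₁ n₂, (y.next prio o₁ o₂ n₁ n₂).elim 0 (drift f₁ f₂ F) ≤
          C + o₂.elim 0 f₂) → stepMean D₁ D₂ y.status₁ y.status₂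
          (fun o₁ o₂ n₁ n₂ => (y.next prio o₁ o₂ n₁ n₂).elim 0 (drift f₁ f₂ F)) ≤
          drift f₁ f₂ F y - 1 := by
      intro C y j hy hV h
      rw [hV, hy, ← stepMean_elim_snd D₁ D₂ hB₂ y.status₁ j C]
      exact stepMean_mono _ _ _ _ fun _ _ _ _ _ _ => h _ _ _ _
    have hk : (0 : ℝ) ≤ k := Nat.cast_nonneg _
    rcases y with ⟨i, j, l⟩ | ⟨i, j, l⟩ | ⟨i, j, l⟩ | ⟨i, j, l⟩ | ⟨i, l⟩ | ⟨j, l⟩ | l | ⟨i, j⟩ |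
      ⟨i, l⟩ | ⟨j, l⟩ | ⟨i, j, l⟩ | ⟨i, j, l⟩ | ⟨i, l⟩ | ⟨j, l⟩
    case t7 =>
      refine (stepMean_mono _ _ _ _ fun o₁ o₂ n₁ n₂ _ _ => hidle l n₁ n₂).trans_eq ?_
      rw [stepMean_const]
      rfl
    case t8 => refine key₁ (C := 0) (i := i) rfl (zero_add _).symm fun o₁ o₂ n₁ n₂ => ?_
               rcases o₁ with _ | i' <;> rcases o₂ with _ | j' <;> 
                 simp [TState.next, drift, hf₁]
    case t1 | t2 | t5 | t9 | t11 | t13 =>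
      refine key₁ (i := i) rfl rfl fun o₁ o₂ n₁ n₂ => ?_
      have h1 := hidle l n₁ n₂
      have h2 := hl0 l
      have h3 := hF₁ n₁
      have h4 := hf₂ n₂
      have h5 := hF₂ n₂
      rcases o₁ with _ | i' <;> rcases o₂ with _ | j' <;> simp only [TState.next, Option.elim] <;>
      (try have h6 := hf₁ i') <;> (try have h7 := hF₂ j') <;> (try have h8 := hF₁ i') <;>
      (try split_ifs) <;> first | linarith | (simp only [drift]; linarith)
    case t3 | t4 | t6 | t10 | t12 | t14 =>
      refine key₂ (j := j) rfl rfl fun o₁ o₂ n₁ n₂ => ?_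
      have h1 := hidle l n₁ n₂
      have h2 := hl0 l
      have h3 := hF₁ n₁
      have h4 := hf₁ n₁
      have h5 := hF₂ n₂
      rcases o₁ with _ | i' <;> rcases o₂ with _ | j' <;> simp only [TState.next, Option.elim] <;>
      (try have h6 := hF₁ i') <;> (try have h7 := hf₂ j') <;> (try have h8 := hF₂ j') <;>
      (try split_ifs) <;> first | linarith | (simp only [drift]; linarith)

theorem genMean_rmcOf [NeZero k] (D₁ : DPH N₁) (D₂ : DPH N₂) (prio : Server) (v : TState N₁ N₂ k → ℝ)
    (s₁ : Option (Fin N₁)) (s₂ : Option (Fin N₂)) (l : Fin k) :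
    genMean D₁ D₂ prio v (rmcOf s₁ s₂ l) =
      stepMean D₁ D₂ s₁ s₂ fun o₁ o₂ n₁ n₂ => (genNext prio l o₁ o₂ n₁ n₂).elim 0 v := by
  rcases s₁ with _ | i <;> rcases s₂ with _ | j <;> rfl

theorem genMean_nonneg [NeZero k] (D₁ : DPH N₁) (D₂ : DPH N₂) (prio : Server)
    {v : TState N₁ N₂ k → ℝ} (hv : ∀ y, 0 ≤ v y) (w : RMCState N₁ N₂ k) :
    0 ≤ genMean D₁ D₂ prio v w := by
  obtain ⟨s₁, s₂, l, rfl⟩ := rmcOf_surjective w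
  rw [genMean_rmcOf]
  exact stepMean_nonneg _ _ _ _ fun _ _ _ _ => elim_nonneg hv _

theorem genNext_elim_one [NeZero k] (prio : Server) (l : Fin k) (o₁ : Option (Fin N₁))
    (o₂ : Option (Fin N₂)) (n₁ : Fin N₁) (n₂ : Fin N₂) :
    (genNext prio l o₁ o₂ n₁ n₂).elim 0 (1 : TState N₁ N₂ k → ℝ) =
      if started prio l o₁ o₂ = none then 0 else 1 := by
  unfold genNext
  rcases started prio l o₁ o₂ with _ | _ | _ <;> simp

/-- A function of the recurrent chain whose drift is negative as long as no packet is generated. -/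
theorem exists_rmc_drift [NeZero k] (D₁ : DPH N₁) (D₂ : DPH N₂) (prio : Server) :
    ∃ (φ : RMCState N₁ N₂ k → ℝ) (C : ℝ), ∀ w,
      (rmcMatrix D₁ D₂ prio *ᵥ φ) w ≤ φ w - 1 + C * genMean D₁ D₂ prio 1 w := by
  obtain ⟨f₁, hf₁, hB₁⟩ := D₁.exists_mean
  set F : ℝ := ∑ i, f₁ i with hF
  have hF0 : 0 ≤ F := Finset.sum_nonneg fun i _ => hf₁ i
  have hF₁ : ∀ i, f₁ i ≤ F := fun i =>
    Finset.single_le_sum (f := f₁) (fun i _ => hf₁ i) (Finset.mem_univ i)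
  have hl0 : ∀ l : Fin k, (0 : ℝ) ≤ l ∧ (l : ℝ) + 1 ≤ k := fun l =>
    ⟨Nat.cast_nonneg _, by exact_mod_cast l.isLt⟩
  -- With an idle server and no generation, the clock must advance and `k - l` drops by one. With
  -- both servers busy, the service on server 1 supplies the drift. The bound `k + F` of `φ` serves
  -- as the constant `C`, which pays for any slot with a generation.
  let φ : RMCState N₁ N₂ k → ℝ := fun w => match w with
    | .r1 l | .r2 _ l | .r3 _ l => k - l
    | .r4 i _ _ => k + f₁ i
  have hφ : ∀ w, φ w ≤ k + F := by
    intro w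
    rcases w with l | ⟨i, l⟩ | ⟨j, l⟩ | ⟨i, j, l⟩
    · have := hl0 l; simp only [φ]; linarith
    · have := hl0 l; simp only [φ]; linarith
    · have := hl0 l; simp only [φ]; linarith
    · have := hF₁ i; simp only [φ]; linarith
  refine ⟨φ, k + F, fun w => ?_⟩
  obtain ⟨s₁, s₂, l, rfl⟩ := rmcOf_surjective w
  rw [rmcMatrix_mulVec, genMean_rmcOf, ← stepMean_smul]
  simp only [genNext_elim_one]
  have h0 := hl0 l
  by_cases hs : s₁ = none ∨ s₂ = none
  · have hw : φ (rmcOf s₁ s₂ l) = k - l := by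
      rcases s₁ with _ | i <;> rcases s₂ with _ | j <;> simp at hs <;> rfl
    rw [← stepMean_const D₁ D₂ s₁ s₂ (φ (rmcOf s₁ s₂ l) - 1), ← stepMean_add]
    refine stepMean_mono _ _ _ _ fun o₁ o₂ n₁ n₂ h1 h2 => ?_
    rcases hst : started prio l o₁ o₂ with _ | s
    · have ho : o₁ = none ∨ o₂ = none := hs.imp h1 h2
      have hl : l.val + 1 < k := by
        have := l.isLt
        by_contra h
        have h' : l.val + 1 = k := by omega
        rcases o₁ with _ | i <;> rcases o₂ with _ | j <;> simp [started, h', sampler] at hst ho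
      have : φ (rmcNext prio l o₁ o₂ n₁ n₂) = k - (l + 1) := by
        simp only [rmcNext, hst, reduceCtorEq, if_false, if_true, tickClock, hl, dif_pos]
        rcases o₁ with _ | i <;> rcases o₂ with _ | j <;> simp at ho <;> simp [φ, rmcOf]
      rw [this, hw, if_pos rfl]
      linarith
    · rw [hw, if_neg (by simp)]
      have := hφ (rmcNext prio l o₁ o₂ n₁ n₂)
      linarith
  · push Not at hs
    obtain ⟨i, rfl⟩ := Option.ne_none_iff_exists'.1 hs.1
    obtain ⟨j, rfl⟩ := Option.ne_none_iff_exists'.1 hs.2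
    have : φ (rmcOf (some i) (some j) l) - 1 = k + f₁ i - 1 := rfl
    rw [this, ← stepMean_elim_fst D₁ D₂ hB₁ i (some j), ← stepMean_add]
    refine stepMean_mono _ _ _ _ fun o₁ o₂ n₁ n₂ _ _ => ?_
    have h1 : 0 ≤ o₁.elim 0 f₁ := elim_nonneg hf₁ o₁
    rcases hst : started prio l o₁ o₂ with _ | s
    · rw [if_pos rfl, mul_zero, add_zero, rmcNext, hst]
      simp only [reduceCtorEq, if_false, if_true]
      have h2 := hl0 (tickClock l)
      rcases o₁ with _ | i' <;> rcases o₂ with _ | j' <;> simp only [rmcOf, φ, Option.elim] at h1 ⊢ <;> linarith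
    · rw [if_neg (by simp)]
      have := hφ (rmcNext prio l o₁ o₂ n₁ n₂)
      linarith

/-- Packets are generated at a positive rate. -/
theorem sum_initWeight_pos [NeZero k] (D₁ : DPH N₁) (D₂ : DPH N₂) (prio : Server)
    {p : RMCState N₁ N₂ k → ℝ} (hp : IsStationary (rmcMatrix D₁ D₂ prio) p) :
    0 < p ⬝ᵥ genMean D₁ D₂ prio 1 := by
  obtain ⟨φ, C, h⟩ := exists_rmc_drift (k := k) D₁ D₂ prio
  have h0 : 0 ≤ p ⬝ᵥ genMean D₁ D₂ prio 1 :=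
    Finset.sum_nonneg fun w _ => mul_nonneg (hp.nonneg w)
      (genMean_nonneg D₁ D₂ prio (fun _ => zero_le_one) w)
  refine lt_of_le_of_ne h0 fun h1 => ?_
  -- Under the stationary vector the mean increment of `φ` is zero, so a zero generation rate would
  -- give `0 ≤ -1`.
  have h2 : p ⬝ᵥ (rmcMatrix D₁ D₂ prio *ᵥ φ) ≤ p ⬝ᵥ (φ - 1 + C • genMean D₁ D₂ prio 1) :=
    Finset.sum_le_sum fun w _ => mul_le_mul_of_nonneg_left (by simpa using h w) (hp.nonneg w)
  rw [dotProduct_mulVec, hp.stationary, dotProduct_add, dotProduct_sub, dotProduct_smul, ← h1,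
    dotProduct_one, hp.sum_eq_one] at h2
  simp at h2
  linarith

end DTDQ

end

noncomputable section

namespace DTDQ

/-! ### Time averages of a finite Markov chain -/

section cesaro

variable {S : Type*} [Fintype S] [DecidableEq S] {R : Matrix S S ℝ}

theorem pow_mulVec_one (hR1 : R *ᵥ 1 = 1) (n : ℕ) : R ^ n *ᵥ (1 : S → ℝ) = 1 := by
  induction n with
  | zero => simp
  | succ n ih => rw [pow_succ, ← mulVec_mulVec, hR1, ih]

theorem pow_eq_zero_of_closed (hR0 : ∀ i j, 0 ≤ R i j) {C : Set S}
    (hC : ∀ i ∈ C, ∀ j, 0 < R i j → j ∈ C) {i : S} (hi : i ∈ C) (n : ℕ) {j : S} (hj : j ∉ C) :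
    (R ^ n) i j = 0 := by
  induction n generalizing j with
  | zero =>
    rw [pow_zero, one_apply_ne]
    rintro rfl; exact hj hi
  | succ n ih =>
    rw [pow_succ, mul_apply]
    refine Finset.sum_eq_zero fun l _ => ?_
    by_cases hl : l ∈ C
    · have : R l j = 0 := by
        refine le_antisymm (not_lt.1 fun h => hj (hC l hl j h)) (hR0 l j)
      rw [this, mul_zero]
    · rw [ih hl, zero_mul]

/-- If a finite Markov chain has a unique stationary vector carried by a closed set of states, then
the time averages of its laws converge to this vector, for every initial state in the set. -/
theorem tendsto_cesaro_of_unique_stationary (hR0 : ∀ i j, 0 ≤ R i j) (hR1 : R *ᵥ 1 = 1) {C : Set S}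
    (hC : ∀ i ∈ C, ∀ j, 0 < R i j → j ∈ C) {p : S → ℝ}
    (hp : ∀ p', IsStationary R p' → (∀ w, p' w ≠ 0 → w ∈ C) → p' = p) {i : S} (hi : i ∈ C)
    (f : S → ℝ) :
    Tendsto (fun m : ℕ => (∑ n ∈ Finset.range m, (R ^ n *ᵥ f) i) / m) atTop (𝓝 (p ⬝ᵥ f)) := by
  have hn := pow_entry_nonneg hR0
  have hrow : ∀ n : ℕ, ∑ j, (R ^ n) i j = 1 := by
    intro n
    have := congrFun (pow_mulVec_one hR1 n) i
    simpa [mulVec, dotProduct] using this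
  set a : ℕ → S → ℝ := fun m j => (∑ n ∈ Finset.range m, (R ^ n) i j) / m with ha
  have hle : ∀ n j, (R ^ n) i j ≤ 1 := fun n j =>
    (Finset.single_le_sum (f := fun j => (R ^ n) i j) (fun j _ => hn n i j) (Finset.mem_univ j)).trans_eq
      (hrow n)
  have ha0 : ∀ m j, 0 ≤ a m j := fun m j =>
    div_nonneg (Finset.sum_nonneg fun n _ => hn n i j) (Nat.cast_nonneg _)
  have ha1 : ∀ m j, a m j ≤ 1 := fun m j => by
    refine div_le_one_of_le₀ ?_ (Nat.cast_nonneg _)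
    calc ∑ n ∈ Finset.range m, (R ^ n) i j ≤ ∑ n ∈ Finset.range m, 1 :=
          Finset.sum_le_sum fun n _ => hle n j
      _ = m := by simp
  have hsum : ∀ m : ℕ, m ≠ 0 → ∑ j, a m j = 1 := fun m hm => by
    simp only [ha]
    rw [← Finset.sum_div, Finset.sum_comm]
    simp [hrow, hm]
  -- The sum telescopes: one step of `R` changes the average of the first `m` laws by the difference
  -- of two probabilities divided by `m`.
  have hstep : ∀ m j, |(a m ᵥ* R) j - a m j| ≤ 1 / m := fun m j => by
    have h1 : (a m ᵥ* R) j - a m j = ((R ^ m) i j - (R ^ 0) i j) / m := by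
      rw [← Finset.sum_range_sub (fun n => (R ^ n) i j) m, Finset.sum_sub_distrib, sub_div]
      congr 1
      simp only [vecMul, dotProduct, ha, pow_succ, mul_apply]
      rw [Finset.sum_comm, Finset.sum_div]
      exact Finset.sum_congr rfl fun l _ => by rw [← Finset.sum_mul]; ring
    rw [h1, abs_div, Nat.abs_cast]
    gcongr
    rw [abs_le]
    constructor <;> linarith [hn m i j, hn 0 i j, hle m j, hle 0 j]
  -- The averages lie in a compact cube, and every limit point is a stationary vector carried by
  -- `C`, hence equal to `p`. No aperiodicity is needed.
  have hlim : Tendsto a atTop (𝓝 p) := by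
    refine tendsto_of_subseq_tendsto fun ns hns => ?_
    obtain ⟨p', -, φ, hφ, hlim⟩ := (isCompact_Icc (a := (0 : S → ℝ)) (b := 1)).tendsto_subseq
      (x := fun n => a (ns n)) fun n => ⟨fun j => ha0 _ j, fun j => ha1 _ j⟩
    refine ⟨φ, ?_⟩
    have hms : Tendsto (fun n => ns (φ n)) atTop atTop := hns.comp hφ.tendsto_atTop
    have hj : ∀ j, Tendsto (fun n => a (ns (φ n)) j) atTop (𝓝 (p' j)) := fun j =>
      (tendsto_pi_nhds.1 hlim) j
    have : p' = p := by
      refine hp p' ⟨fun j => ge_of_tendsto' (hj j) fun n => ha0 _ j, ?_, ?_⟩ ?_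
      · refine tendsto_nhds_unique (tendsto_finsetSum _ fun j _ => hj j) ?_
        refine tendsto_const_nhds.congr' ?_
        filter_upwards [hms.eventually_ne_atTop 0] with n hn
        exact (hsum _ hn).symm
      · ext j
        have h1 : Tendsto (fun n => (a (ns (φ n)) ᵥ* R) j - a (ns (φ n)) j) atTop
            (𝓝 ((p' ᵥ* R) j - p' j)) := by
          refine Tendsto.sub ?_ (hj j)
          simp only [vecMul, dotProduct]
          exact tendsto_finsetSum _ fun l _ => (hj l).mul_const _
        have h2 : Tendsto (fun n => (a (ns (φ n)) ᵥ* R) j - a (ns (φ n)) j) atTop (𝓝 0) := by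
          refine squeeze_zero_norm (fun n => hstep _ j) ?_
          exact (tendsto_const_div_atTop_nhds_zero_nat (1 : ℝ)).comp hms
        exact sub_eq_zero.1 (tendsto_nhds_unique h1 h2)
      · intro w hw
        by_contra hwC
        refine hw (tendsto_nhds_unique (hj w) ?_)
        refine tendsto_const_nhds.congr fun n => ?_
        simp [ha, pow_eq_zero_of_closed hR0 hC hi _ hwC]
    rw [← this]
    exact hlim
  have h2 : Tendsto (fun m => a m ⬝ᵥ f) atTop (𝓝 (p ⬝ᵥ f)) :=
    tendsto_finsetSum _ fun j _ => ((tendsto_pi_nhds.1 hlim) j).mul_const _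
  refine h2.congr fun m => ?_
  simp only [dotProduct, mulVec, ha]
  rw [Finset.sum_comm, Finset.sum_div]
  refine Finset.sum_congr rfl fun j _ => ?_
  rw [← Finset.sum_mul]; ring

/-- The mean over `m` steps of a function is the function up to the increment of a potential. -/
theorem exists_potential (R : Matrix S S ℝ) (f : S → ℝ) {m : ℕ} (hm : m ≠ 0) :
    ∃ ψ : S → ℝ, R *ᵥ ψ = ψ - f + (m : ℝ)⁻¹ • ∑ n ∈ Finset.range m, R ^ n *ᵥ f := by
  -- The average of the truncated potentials `∑ l < n, R ^ l f` over `n < m`. Applying `R` shifts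
  -- each of them, which costs `f` and adds `R ^ n f`; the exact Poisson equation need not be
  -- solved.
  refine ⟨(m : ℝ)⁻¹ • ∑ n ∈ Finset.range m, ∑ l ∈ Finset.range n, R ^ l *ᵥ f, ?_⟩
  have h1 : ∀ n : ℕ, R *ᵥ ∑ l ∈ Finset.range n, R ^ l *ᵥ f =
      ∑ l ∈ Finset.range n, R ^ l *ᵥ f - f + R ^ n *ᵥ f := by
    intro n
    induction n with
    | zero => simp
    | succ n ih =>
      rw [Finset.sum_range_succ, mulVec_add, ih, mulVec_mulVec, ← pow_succ']
      abel
  have hm' : (m : ℝ) ≠ 0 := Nat.cast_ne_zero.2 hm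
  have h2 : R *ᵥ ∑ n ∈ Finset.range m, ∑ l ∈ Finset.range n, R ^ l *ᵥ f =
      ∑ n ∈ Finset.range m, ∑ l ∈ Finset.range n, R ^ l *ᵥ f - (m : ℝ) • f +
        ∑ n ∈ Finset.range m, R ^ n *ᵥ f := by
    rw [mulVec_sum]
    simp only [h1, Finset.sum_add_distrib, Finset.sum_sub_distrib, Finset.sum_const,
      Finset.card_range, Nat.cast_smul_eq_nsmul]
  rw [mulVec_smul, h2, smul_add, smul_sub, smul_smul, inv_mul_cancel₀ hm', one_smul]

end cesaro

/-! ### Neumann series -/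

section neumann

variable {S : Type*} [Fintype S] [DecidableEq S] {M : Matrix S S ℝ}

theorem hasSum_pow_mulVec (hM : ∀ i j, Summable fun n : ℕ => (M ^ n) i j) (hU : IsUnit (1 - M)) (c : S → ℝ)
    (i : S) : HasSum (fun n : ℕ => (M ^ n *ᵥ c) i) (((1 - M)⁻¹ *ᵥ c) i) := by
  have hdet := (isUnit_iff_isUnit_det _).1 hU
  have h1 : Summable fun n : ℕ => (M ^ n *ᵥ c) i := by
    simp only [mulVec, dotProduct]
    exact summable_sum fun j _ => (hM i j).mul_right _
  refine (h1.hasSum_iff_tendsto_nat).2 ?_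
  have h2 : ∀ n : ℕ, ∑ l ∈ Finset.range n, M ^ l *ᵥ c = (1 - M)⁻¹ *ᵥ c - M ^ n *ᵥ ((1 - M)⁻¹ *ᵥ c) := by
    intro n
    have h3 : (∑ l ∈ Finset.range n, M ^ l) = (1 - M ^ n) * (1 - M)⁻¹ := by
      rw [← geom_sum_mul_neg M n, Matrix.mul_assoc, mul_nonsing_inv _ hdet, Matrix.mul_one]
    rw [← sum_mulVec, h3, mulVec_mulVec, ← sub_mulVec, Matrix.sub_mul, Matrix.one_mul]
  have h4 : Tendsto (fun n : ℕ => (M ^ n *ᵥ ((1 - M)⁻¹ *ᵥ c)) i) atTop (𝓝 (∑ j, 0 * ((1 - M)⁻¹ *ᵥ c) j)) := by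
    simp only [mulVec, dotProduct]
    exact tendsto_finsetSum _ fun j _ => ((hM i j).tendsto_atTop_zero).mul_const _
  simp only [zero_mul, Finset.sum_const_zero] at h4
  have h5 := (tendsto_const_nhds (x := ((1 - M)⁻¹ *ᵥ c) i)).sub h4
  rw [sub_zero] at h5
  refine h5.congr fun n => ?_
  rw [← Pi.sub_apply, ← h2, Finset.sum_apply]

end neumann

end DTDQ

end

noncomputable section

namespace DTDQ

/-! ### Markov chains with countably many states -/

section markov

variable {S Ω : Type*} [MeasurableSpace Ω] {P : Measure Ω}

theorem IsMarkovChain.measurableSet_path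
    {K : S → S → ℝ} {X : ℕ → Ω → S}
    (hX : IsMarkovChain K P X) (t : ℕ) (z : Fin (t + 1) → S) :
    MeasurableSet {ω | (fun m : Fin (t + 1) => X m ω) = z} := by
  have : {ω | (fun m : Fin (t + 1) => X m ω) = z} = ⋂ m : Fin (t + 1), {ω | X m ω = z m} := by
    ext ω; simp [funext_iff]
  rw [this]
  exact MeasurableSet.iInter fun m => hX.measurable m (z m)

/-- The state space carries no σ-algebra; measurable level sets suffice, since there are countably
many values. -/
theorem measurable_comp_of_countable {β : Type*} [Countable β] {Y : Ω → β}
    (hY : ∀ b, MeasurableSet {ω | Y ω = b}) (F : β → ℝ) : Measurable fun ω => F (Y ω) := by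
  intro T _
  have : (fun ω => F (Y ω)) ⁻¹' T = ⋃ b ∈ F ⁻¹' T, {ω | Y ω = b} := by
    ext ω; simp
  rw [this]
  exact MeasurableSet.biUnion (Set.to_countable _) fun b _ => hY b

variable [IsProbabilityMeasure P]

theorem integrable_comp_of_countable {β : Type*} [Countable β] {Y : Ω → β}
    (hY : ∀ b, MeasurableSet {ω | Y ω = b}) {F : β → ℝ} {C : ℝ} (hF : ∀ b, |F b| ≤ C) :
    Integrable (fun ω => F (Y ω)) P :=
  Integrable.of_bound (measurable_comp_of_countable hY F).aestronglyMeasurable C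
    (Eventually.of_forall fun ω => hF (Y ω))

theorem hasSum_integral_comp {β : Type*} [Countable β] {Y : Ω → β}
    (hY : ∀ b, MeasurableSet {ω | Y ω = b}) {F : β → ℝ} {C : ℝ} (hF : ∀ b, |F b| ≤ C) :
    HasSum (fun b => P.real {ω | Y ω = b} * F b) (∫ ω, F (Y ω) ∂P) := by
  have hU : (⋃ b, {ω | Y ω = b}) = Set.univ := by ext ω; simp
  have h := hasSum_integral_iUnion (μ := P) (f := fun ω => F (Y ω)) (s := fun b => {ω | Y ω = b}) hY
    (fun a b hab => Set.disjoint_left.2 fun ω (h1 : Y ω = a) (h2 : Y ω = b) => hab (h1.symm.trans h2))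
    (integrable_comp_of_countable hY hF).integrableOn
  rw [hU, setIntegral_univ] at h
  refine (congrArg (fun f => HasSum f _) (funext fun b => ?_)).mpr h
  rw [setIntegral_congr_fun (g := fun _ => F b) (hY b) fun ω (hω : Y ω = b) => by simp only [hω],
    setIntegral_const, smul_eq_mul]

variable [Countable S] {K : S → S → ℝ} {X : ℕ → Ω → S}

/-- `Q` depends only on the values of a path up to time `t`. -/
def DependsUpTo (t : ℕ) (Q : (ℕ → S) → ℝ) : Prop :=
  ∀ g g' : ℕ → S, (∀ m ≤ t, g m = g' m) → Q g = Q g'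

/-- The Markov property: the state at time `t + 1` may be replaced by its conditional mean, given the
path up to time `t`. -/
theorem IsMarkovChain.integral_step (hX : IsMarkovChain K P X) {L : (S → ℝ) → S → ℝ}
    (hL : ∀ G x, HasSum (fun y => K x y * G y) (L G x)) (t : ℕ) {Q : (ℕ → S) → ℝ}
    (hQ : DependsUpTo t Q) {CQ : ℝ} (hCQ : ∀ g, |Q g| ≤ CQ) {H : S → S → ℝ} {CH : ℝ}
    (hH : ∀ x y, |H x y| ≤ CH) (hLH : ∀ x, |L (H x) x| ≤ CH) :
    ∫ ω, Q (fun m => X m ω) * H (X t ω) (X (t + 1) ω) ∂P =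
      ∫ ω, Q (fun m => X m ω) * L (H (X t ω)) (X t ω) ∂P := by
  -- Freezes a path after time `t`. Since `Q` sees only the first `t + 1` states, both integrals
  -- become sums over countably many finite paths, where the law of the chain applies term by term.
  let ext : (Fin (t + 1) → S) → ℕ → S := fun z m => z ⟨min m t, by omega⟩
  let Z : Ω → Fin (t + 1) → S := fun ω m => X m ω
  have hZ : ∀ z, MeasurableSet {ω | Z ω = z} := hX.measurableSet_path t
  have hZX : ∀ zy : (Fin (t + 1) → S) × S, MeasurableSet {ω | (Z ω, X (t + 1) ω) = zy} := by
    rintro ⟨z, y⟩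
    have : {ω | (Z ω, X (t + 1) ω) = (z, y)} = {ω | Z ω = z} ∩ {ω | X (t + 1) ω = y} := by
      ext ω; simp
    rw [this]
    exact (hZ z).inter (hX.measurable (t + 1) y)
  have hQZ : ∀ ω, Q (fun m => X m ω) = Q (ext (Z ω)) := fun ω => by
    refine hQ _ _ fun m hm => ?_
    simp [ext, Z, min_eq_left hm]
  have hlast : ∀ ω, X t ω = Z ω (Fin.last t) := fun ω => rfl
  have hbound : ∀ a b : ℝ, |a| ≤ CQ → |b| ≤ CH → |a * b| ≤ CQ * CH := fun a b ha hb => by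
    rw [abs_mul]
    exact mul_le_mul ha hb (abs_nonneg _) ((abs_nonneg _).trans ha)
  have h1 := hasSum_integral_comp (P := P) hZX (F := fun zy => Q (ext zy.1) * H (zy.1 (Fin.last t)) zy.2)
    (C := CQ * CH) fun zy => hbound _ _ (hCQ _) (hH _ _)
  have h2 := hasSum_integral_comp (P := P) hZ (F := fun z => Q (ext z) * L (H (z (Fin.last t))) (z (Fin.last t)))
    (C := CQ * CH) fun z => hbound _ _ (hCQ _) (hLH _)
  have h3 : ∀ z y, P.real {ω | (Z ω, X (t + 1) ω) = (z, y)} =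
      P.real {ω | Z ω = z} * K (z (Fin.last t)) y := by
    intro z y
    let x : ℕ → S := fun m => if m ≤ t then ext z m else y
    have h := hX.step t x
    have e1 : {ω | ∀ m ≤ t + 1, X m ω = x m} = {ω | (Z ω, X (t + 1) ω) = (z, y)} := by
      ext ω
      simp only [Set.mem_ofPred_eq, Prod.mk.injEq, funext_iff, Z]
      constructor
      · intro h
        refine ⟨fun m => ?_, ?_⟩
        · have hm : m.val ≤ t := Nat.lt_succ_iff.1 m.isLt
          rw [h m (by omega)]
          simp [x, ext, hm]
        · rw [h _ le_rfl]; simp [x]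
      · rintro ⟨h4, h5⟩ m hm
        rcases Nat.lt_or_ge t m with h6 | h6
        · obtain rfl : m = t + 1 := by omega
          rw [h5]; simp [x]
        · simpa [x, ext, h6] using h4 ⟨m, by omega⟩
    have e2 : {ω | ∀ m ≤ t, X m ω = x m} = {ω | Z ω = z} := by
      ext ω
      simp only [Set.mem_ofPred_eq, funext_iff, Z]
      constructor
      · intro h m
        have hm : m.val ≤ t := Nat.lt_succ_iff.1 m.isLt
        rw [h m hm]
        simp [x, ext, hm]
      · intro h m hm
        simpa [x, ext, hm] using h ⟨m, by omega⟩
    rw [e1, e2] at h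
    rw [h]
    simp [x, ext, Fin.last]
  have h4 := h1.prod_fiberwise (g := fun z => P.real {ω | Z ω = z} *
    (Q (ext z) * L (H (z (Fin.last t))) (z (Fin.last t)))) fun z => by
      have := ((hL (H (z (Fin.last t))) (z (Fin.last t))).mul_left (P.real {ω | Z ω = z} * Q (ext z)))
      rw [← mul_assoc]
      refine (congrArg (fun f => HasSum f _) (funext fun y => ?_)).mpr this
      rw [h3]
      ring
  have h5 := h4.unique h2
  simp only [hQZ, hlast]
  exact h5

end markov

end DTDQ

end

noncomputable section

namespace DTDQ

/-! ### The Markov property of the system -/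

section system

variable {N₁ N₂ k : ℕ}

instance : Countable (SysState N₁ N₂ k) := by
  refine Function.Injective.countable
    (f := fun x : SysState N₁ N₂ k => (x.srv₁, x.srv₂, x.clock, x.aoi)) fun x y h => ?_
  simp only [Prod.mk.injEq] at h
  exact SysState.ext h.1 h.2.1 h.2.2.1 h.2.2.2

variable [NeZero k] {D₁ : DPH N₁} {D₂ : DPH N₂} {prio : Server}

/-- Each outcome of a slot leads to exactly one state, so a row of the kernel is a finite sum of
point masses and no bound on `G` is needed. -/
theorem hasSum_sysKernel (G : SysState N₁ N₂ k → ℝ) (x : SysState N₁ N₂ k) :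
    HasSum (fun y => sysKernel D₁ D₂ prio x y * G y) (sysMean D₁ D₂ prio G x) := by
  have h : HasSum (fun y => sysKernel D₁ D₂ prio x y * G y)
      (∑ o₁ : Option (Fin N₁), ∑ o₂ : Option (Fin N₂), ∑ n₁ : Fin N₁, ∑ n₂ : Fin N₂,
        serve D₁ (x.srv₁.map Prod.fst) o₁ * serve D₂ (x.srv₂.map Prod.fst) o₂ * D₁.α n₁ * D₂.α n₂ *
          G (x.next prio o₁ o₂ n₁ n₂)) := by
    simp only [sysKernel, Finset.sum_mul]
    refine hasSum_sum fun o₁ _ => hasSum_sum fun o₂ _ => hasSum_sum fun n₁ _ => hasSum_sum fun n₂ _ => ?_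
    have h1 := hasSum_single (f := fun y => (if x.next prio o₁ o₂ n₁ n₂ = y then
      serve D₁ (x.srv₁.map Prod.fst) o₁ * serve D₂ (x.srv₂.map Prod.fst) o₂ * D₁.α n₁ * D₂.α n₂
      else 0) * G y) (x.next prio o₁ o₂ n₁ n₂) fun y hy => by rw [if_neg (Ne.symm hy), zero_mul]
    simpa using h1
  convert h using 1
  simp only [sysMean, stepMean, Finset.mul_sum, mul_assoc]

theorem sysMean_mono {F G : SysState N₁ N₂ k → ℝ} (h : ∀ y, F y ≤ G y) (x : SysState N₁ N₂ k) :
    sysMean D₁ D₂ prio F x ≤ sysMean D₁ D₂ prio G x :=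
  stepMean_mono _ _ _ _ fun _ _ _ _ _ _ => h _

theorem sysMean_const (c : ℝ) (x : SysState N₁ N₂ k) : sysMean D₁ D₂ prio (fun _ => c) x = c :=
  stepMean_const _ _ _ _ c

theorem abs_sysMean_le {F : SysState N₁ N₂ k → ℝ} {C : ℝ} (h : ∀ y, |F y| ≤ C) (x : SysState N₁ N₂ k) :
    |sysMean D₁ D₂ prio F x| ≤ C := by
  rw [abs_le]
  constructor
  · rw [← sysMean_const (D₁ := D₁) (D₂ := D₂) (prio := prio) (-C) x]
    exact sysMean_mono (fun y => (abs_le.1 (h y)).1) x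
  · rw [← sysMean_const (D₁ := D₁) (D₂ := D₂) (prio := prio) C x]
    exact sysMean_mono (fun y => (abs_le.1 (h y)).2) x

variable {Ω : Type*} [MeasurableSpace Ω] {P : Measure Ω}
  {X : ℕ → Ω → SysState N₁ N₂ k}

theorem measurable_path (hX : IsMarkovChain (sysKernel D₁ D₂ prio) P X) (t : ℕ)
    (F : SysState N₁ N₂ k → ℝ) : Measurable fun ω => F (X t ω) :=
  measurable_comp_of_countable (hX.measurable t) F

theorem measurable_pair (hX : IsMarkovChain (sysKernel D₁ D₂ prio) P X) (t : ℕ)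
    (H : SysState N₁ N₂ k → SysState N₁ N₂ k → ℝ) : Measurable fun ω => H (X t ω) (X (t + 1) ω) := by
  refine measurable_comp_of_countable (Y := fun ω => (X t ω, X (t + 1) ω)) (fun b => ?_)
    fun z => H z.1 z.2
  have : {ω | (X t ω, X (t + 1) ω) = b} = {ω | X t ω = b.1} ∩ {ω | X (t + 1) ω = b.2} := by
    ext ω; simp [Prod.ext_iff]
  rw [this]
  exact (hX.measurable _ _).inter (hX.measurable _ _)

variable [IsProbabilityMeasure P]

theorem integral_pair (hX : IsMarkovChain (sysKernel D₁ D₂ prio) P X) (t : ℕ)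
    {H : SysState N₁ N₂ k → SysState N₁ N₂ k → ℝ} {C : ℝ} (hH : ∀ x y, |H x y| ≤ C) :
    ∫ ω, H (X t ω) (X (t + 1) ω) ∂P = ∫ ω, sysMean D₁ D₂ prio (H (X t ω)) (X t ω) ∂P := by
  have h := hX.integral_step (L := sysMean D₁ D₂ prio) hasSum_sysKernel t (Q := fun _ => 1)
    (fun _ _ _ => rfl) (CQ := 1) (fun _ => by simp) hH (fun x => abs_sysMean_le (hH x) x)
  simpa using h

theorem integral_succ (hX : IsMarkovChain (sysKernel D₁ D₂ prio) P X) (t : ℕ)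
    {F : SysState N₁ N₂ k → ℝ} {C : ℝ} (hF : ∀ x, |F x| ≤ C) :
    ∫ ω, F (X (t + 1) ω) ∂P = ∫ ω, sysMean D₁ D₂ prio F (X t ω) ∂P :=
  integral_pair hX t (H := fun _ => F) fun _ => hF

/-- The state `y` may follow the state `x`. -/
def Follows (prio : Server) (x y : SysState N₁ N₂ k) : Prop :=
  ∃ o₁ o₂ n₁ n₂, Feasible x o₁ o₂ ∧ y = x.next prio o₁ o₂ n₁ n₂

open scoped Classical in
-- The indicator of an impossible transition has conditional mean zero. This makes pathwise
-- arguments available on almost every trajectory.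
theorem ae_follows (hX : IsMarkovChain (sysKernel D₁ D₂ prio) P X) :
    ∀ᵐ ω ∂P, ∀ t, Follows prio (X t ω) (X (t + 1) ω) := by
  rw [ae_all_iff]
  intro t
  let H : SysState N₁ N₂ k → SysState N₁ N₂ k → ℝ := fun x y => if Follows prio x y then 0 else 1
  have hH : ∀ x y, |H x y| ≤ 1 := fun x y => by simp only [H]; split_ifs <;> simp
  have hH0 : ∀ x y, 0 ≤ H x y := fun x y => by simp only [H]; split_ifs <;> simp
  have h0 : ∀ x, sysMean D₁ D₂ prio (H x) x = 0 := fun x => by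
    rw [sysMean, stepMean_congr D₁ D₂ _ _ (ψ := fun _ _ _ _ => 0), stepMean_const]
    intro o₁ o₂ n₁ n₂ h1 h2
    exact if_pos ⟨o₁, o₂, n₁, n₂, feasible_of_map h1 h2, rfl⟩
  have h1 := integral_pair hX t hH
  simp only [h0, integral_zero] at h1
  have h2 : Integrable (fun ω => H (X t ω) (X (t + 1) ω)) P :=
    Integrable.of_bound (measurable_pair hX t H).aestronglyMeasurable 1
      (Eventually.of_forall fun ω => hH _ _)
  rw [integral_eq_zero_iff_of_nonneg (fun ω => hH0 _ _) h2] at h1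
  filter_upwards [h1] with ω hω
  by_contra h
  simp only [H, if_neg h, Pi.zero_apply] at hω
  norm_num at hω

/-- `Regular 0` excludes nothing, so the induction starts from any initial state. -/
theorem ae_regular (hX : IsMarkovChain (sysKernel D₁ D₂ prio) P X) :
    ∀ᵐ ω ∂P, ∀ t, Regular t (X t ω) := by
  filter_upwards [ae_follows hX] with ω hω t
  induction t with
  | zero => exact fun i a j b _ _ => ⟨fun _ => Nat.zero_le _, fun _ _ => Nat.zero_le _⟩
  | succ t ih =>
    obtain ⟨o₁, o₂, n₁, n₂, -, h⟩ := hω t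
    rw [h]
    exact ih.next

/-- A sum of bounded increments with conditional mean zero has a second moment of linear growth. -/
theorem integral_sq_sum_le (hX : IsMarkovChain (sysKernel D₁ D₂ prio) P X)
    {D : ℕ → SysState N₁ N₂ k → SysState N₁ N₂ k → ℝ} {C : ℝ} (hD : ∀ t x y, |D t x y| ≤ C)
    (hmean : ∀ t x, Regular t x → sysMean D₁ D₂ prio (D t x) x = 0) (T : ℕ) :
    ∫ ω, (∑ t ∈ Finset.range T, D t (X t ω) (X (t + 1) ω)) ^ 2 ∂P ≤ C ^ 2 * T := by
  have hmeas : ∀ T : ℕ, Measurable fun ω => ∑ t ∈ Finset.range T, D t (X t ω) (X (t + 1) ω) :=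
    fun T => Finset.measurable_sum _ fun t _ => measurable_pair hX t (D t)
  have hbd : ∀ (T : ℕ) (g : ℕ → SysState N₁ N₂ k),
      |∑ t ∈ Finset.range T, D t (g t) (g (t + 1))| ≤ T * C := fun T g => by
    refine (Finset.abs_sum_le_sum_abs _ _).trans ?_
    refine (Finset.sum_le_sum fun t _ => hD t _ _).trans ?_
    simp
  induction T with
  | zero => simp
  | succ T ih =>
    -- Orthogonality: given the past, the next increment has mean zero, so the cross term in the
    -- square vanishes.
    have h0 : ∫ ω, (∑ t ∈ Finset.range T, D t (X t ω) (X (t + 1) ω)) * D T (X T ω) (X (T + 1) ω) ∂P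
        = 0 := by
      rw [hX.integral_step (L := sysMean D₁ D₂ prio) hasSum_sysKernel T
        (Q := fun g => ∑ t ∈ Finset.range T, D t (g t) (g (t + 1))) ?_ (hbd T) (hD T)
        (fun x => abs_sysMean_le (hD T x) x)]
      · refine integral_eq_zero_of_ae ?_
        filter_upwards [ae_regular hX] with ω hω
        rw [hmean T _ (hω T), mul_zero, Pi.zero_apply]
      · intro g g' h
        refine Finset.sum_congr rfl fun t ht => ?_
        have := Finset.mem_range.1 ht
        rw [h t (by omega), h (t + 1) (by omega)]
    have hC : 0 ≤ C := (abs_nonneg _).trans (hD 0 (X 0 (Classical.choice (nonempty_of_isProbabilityMeasure P)))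
      (X 0 (Classical.choice (nonempty_of_isProbabilityMeasure P))))
    have i1 : Integrable (fun ω => (∑ t ∈ Finset.range T, D t (X t ω) (X (t + 1) ω)) ^ 2) P :=
      Integrable.of_bound ((hmeas T).pow_const 2).aestronglyMeasurable ((T * C) ^ 2)
        (Eventually.of_forall fun ω => by
          rw [Real.norm_eq_abs, abs_pow]
          exact pow_le_pow_left₀ (abs_nonneg _) (hbd T fun m => X m ω) 2)
    have i2 : Integrable (fun ω => (∑ t ∈ Finset.range T, D t (X t ω) (X (t + 1) ω)) *
        D T (X T ω) (X (T + 1) ω)) P :=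
      Integrable.of_bound ((hmeas T).mul (measurable_pair hX T (D T))).aestronglyMeasurable (T * C * C)
        (Eventually.of_forall fun ω => by
          rw [Real.norm_eq_abs, abs_mul]
          exact mul_le_mul (hbd T fun m => X m ω) (hD _ _ _) (abs_nonneg _) (by positivity))
    have i3 : Integrable (fun ω => D T (X T ω) (X (T + 1) ω) ^ 2) P :=
      Integrable.of_bound ((measurable_pair hX T (D T)).pow_const 2).aestronglyMeasurable (C ^ 2)
        (Eventually.of_forall fun ω => by
          rw [Real.norm_eq_abs, abs_pow]
          exact pow_le_pow_left₀ (abs_nonneg _) (hD _ _ _) 2)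
    have h3 : ∫ ω, D T (X T ω) (X (T + 1) ω) ^ 2 ∂P ≤ C ^ 2 := by
      refine (integral_mono i3 (integrable_const (C ^ 2)) fun ω => ?_).trans_eq (by simp)
      exact sq_le_sq' (abs_le.1 (hD T _ _)).1 (abs_le.1 (hD T _ _)).2
    calc ∫ ω, (∑ t ∈ Finset.range (T + 1), D t (X t ω) (X (t + 1) ω)) ^ 2 ∂P
        = ∫ ω, ((∑ t ∈ Finset.range T, D t (X t ω) (X (t + 1) ω)) ^ 2 +
          2 * ((∑ t ∈ Finset.range T, D t (X t ω) (X (t + 1) ω)) * D T (X T ω) (X (T + 1) ω)) +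
          D T (X T ω) (X (T + 1) ω) ^ 2) ∂P := by
            refine integral_congr_ae (Eventually.of_forall fun ω => ?_)
            simp only [Finset.sum_range_succ]
            ring
      _ = ∫ ω, (∑ t ∈ Finset.range T, D t (X t ω) (X (t + 1) ω)) ^ 2 ∂P +
          ∫ ω, D T (X T ω) (X (T + 1) ω) ^ 2 ∂P := by
            refine (integral_add (i1.add (i2.const_mul 2)) i3).trans ?_
            refine congrArg (· + _) ((integral_add i1 (i2.const_mul 2)).trans ?_)
            rw [integral_const_mul, h0, mul_zero, add_zero]
      _ ≤ C ^ 2 * T + C ^ 2 := add_le_add ih h3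
      _ = C ^ 2 * (T + 1 : ℕ) := by push_cast; ring

end system

end DTDQ

end

/-! ### Bounded sums of labels, and time averages along the system. -/

noncomputable section

namespace DTDQ

section ergodic

variable {N₁ N₂ k : ℕ}

theorem abs_le_sum_abs {S : Type*} [Fintype S] (g : S → ℝ) (w : S) : |g w| ≤ ∑ w, |g w| :=
  Finset.single_le_sum (f := fun w => |g w|) (fun _ _ => abs_nonneg _) (Finset.mem_univ w)

theorem abs_elim_le {S : Type*} [Fintype S] (v : S → ℝ) (o : Option S) : |o.elim 0 v| ≤ ∑ w, |v w| := by
  rcases o with _ | y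
  · simpa using Finset.sum_nonneg fun w _ => abs_nonneg (v w)
  · exact abs_le_sum_abs v y

/-- The age of information and the ages of the packets in service. -/
def SysState.ages (x : SysState N₁ N₂ k) : Finset ℕ :=
  insert x.aoi ((x.srv₁.map Prod.snd).toFinset ∪ (x.srv₂.map Prod.snd).toFinset)

theorem card_ages_le (x : SysState N₁ N₂ k) : x.ages.card ≤ 3 := by
  have h : ∀ o : Option ℕ, o.toFinset.card ≤ 1 := fun o => by rcases o with _ | a <;> simp
  refine (Finset.card_insert_le _ _).trans ?_
  have := (Finset.card_union_le (x.srv₁.map Prod.snd).toFinset (x.srv₂.map Prod.snd).toFinset)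
  have h1 := h (x.srv₁.map Prod.snd)
  have h2 := h (x.srv₂.map Prod.snd)
  omega

/-- As long as its chain is not absorbed, `P*` is either in service or the freshest received packet,
so its age occurs in the state. -/
theorem label_eq_none {x : SysState N₁ N₂ k} {r : ℕ} (hr : r ∉ x.ages) : label r x = none := by
  have hne : ∀ {a : ℕ}, a ≠ r → compare a r ≠ .eq := fun h h' => h (compare_eq_iff_eq.1 h')
  rcases x with ⟨s₁, s₂, l, d⟩
  simp only [SysState.ages, Finset.mem_insert, Finset.mem_union, not_or] at hr
  obtain ⟨h0, h1, h2⟩ := hr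
  have h0' := hne (Ne.symm h0)
  simp only [label]
  generalize compare d r = c at *
  rcases s₁ with _ | ⟨i, a⟩
  · rcases s₂ with _ | ⟨j, b⟩
    · rcases c <;> simp [relLabel] at h0' ⊢
    · have h2' : compare b r ≠ .eq := hne (by simpa [eq_comm] using h2)
      simp only [Option.map]
      generalize compare b r = c₂ at *
      rcases c <;> rcases c₂ <;> simp [relLabel] at h0' h2' ⊢
  · have h1' : compare a r ≠ .eq := hne (by simpa [eq_comm] using h1)
    rcases s₂ with _ | ⟨j, b⟩
    · simp only [Option.map]
      generalize compare a r = c₂ at *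
      rcases c <;> rcases c₂ <;> simp [relLabel] at h0' h1' ⊢
    · have h2' : compare b r ≠ .eq := hne (by simpa [eq_comm] using h2)
      simp only [Option.map]
      generalize compare a r = c₁ at *
      generalize compare b r = c₂ at *
      rcases c <;> rcases c₁ <;> rcases c₂ <;> simp [relLabel] at h0' h1' h2' ⊢

/-- At most three ages carry a label, so the sum is bounded uniformly in `t`, although it ranges
over all packets generated after time 0. -/
theorem abs_sum_label_le (v : TState N₁ N₂ k → ℝ) (t : ℕ) (x : SysState N₁ N₂ k) :
    |∑ r ∈ Finset.range t, (label r x).elim 0 v| ≤ 3 * ∑ y, |v y| := by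
  have h0 : 0 ≤ ∑ y, |v y| := Finset.sum_nonneg fun w _ => abs_nonneg (v w)
  have h1 : ∑ r ∈ Finset.range t, (label r x).elim 0 v =
      ∑ r ∈ Finset.range t ∩ x.ages, (label r x).elim 0 v := by
    symm
    refine Finset.sum_subset Finset.inter_subset_left fun r hr hr' => ?_
    rw [label_eq_none fun h => hr' (Finset.mem_inter.2 ⟨hr, h⟩)]
    rfl
  rw [h1]
  refine (Finset.abs_sum_le_sum_abs _ _).trans ?_
  refine (Finset.sum_le_card_nsmul _ _ (∑ y, |v y|) fun r _ => abs_elim_le v _).trans ?_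
  rw [nsmul_eq_mul]
  refine mul_le_mul_of_nonneg_right ?_ h0
  exact_mod_cast (Finset.card_le_card Finset.inter_subset_right).trans (card_ages_le x)

/-- Indicator of the end of a cycle of peak `r`. -/
def peakInd (r : ℕ) (x x' : SysState N₁ N₂ k) : ℝ := if x.aoi = r ∧ x'.aoi < r + 1 then 1 else 0

/-- Indicator of the end of a cycle whose packet was generated after time `0`, in slot `t`. -/
def freshInd (t : ℕ) (x x' : SysState N₁ N₂ k) : ℝ :=
  if x.aoi < t ∧ x'.aoi < x.aoi + 1 then 1 else 0

/-- Indicator of the end of a cycle. -/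
def endInd (x x' : SysState N₁ N₂ k) : ℝ := if x'.aoi < x.aoi + 1 then 1 else 0

/-- Only the term `r = x.aoi` can contribute, and it does so when this age is less than `t`. -/
theorem sum_peakInd (t : ℕ) (x x' : SysState N₁ N₂ k) :
    ∑ r ∈ Finset.range t, peakInd r x x' = freshInd t x x' := by
  unfold peakInd freshInd
  by_cases h : x'.aoi < x.aoi + 1
  · rw [Finset.sum_congr rfl fun r _ => if_congr (P := x.aoi = r ∧ x'.aoi < r + 1) (Q := x.aoi = r)
      ⟨fun h => h.1, fun h' => ⟨h', h' ▸ h⟩⟩ rfl rfl, Finset.sum_ite_eq]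
    simp [h]
  · rw [Finset.sum_congr rfl fun r _ => if_neg (c := x.aoi = r ∧ x'.aoi < r + 1)
      fun h' => h (by rw [h'.1]; exact h'.2)]
    simp [h]

theorem abs_peakInd_le (r : ℕ) (x x' : SysState N₁ N₂ k) : |peakInd r x x'| ≤ 1 := by
  unfold peakInd; split_ifs <;> simp

theorem abs_freshInd_le (t : ℕ) (x x' : SysState N₁ N₂ k) : |freshInd t x x'| ≤ 1 := by
  unfold freshInd; split_ifs <;> simp

theorem abs_endInd_le (x x' : SysState N₁ N₂ k) : |endInd x x'| ≤ 1 := by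
  unfold endInd; split_ifs <;> simp

variable {Ω : Type*} [MeasurableSpace Ω] {P : Measure Ω} {X : ℕ → Ω → SysState N₁ N₂ k}

/-- The states of the recurrent chain which are visited with positive probability. -/
def visited (P : Measure Ω) (X : ℕ → Ω → SysState N₁ N₂ k) : Set (RMCState N₁ N₂ k) :=
  {w | ∃ t, P {ω | (X t ω).toRMC = w} ≠ 0}

theorem ae_visited : ∀ᵐ ω ∂P, ∀ t, (X t ω).toRMC ∈ visited P X := by
  have : ∀ᵐ ω ∂P, ∀ t w, w ∉ visited P X → (X t ω).toRMC ≠ w := by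
    rw [ae_all_iff]
    intro t
    rw [ae_all_iff]
    intro w
    by_cases hw : w ∈ visited P X
    · exact Eventually.of_forall fun ω h => absurd hw h
    · have h0 : P {ω | (X t ω).toRMC = w} = 0 := by
        by_contra h
        exact hw ⟨t, h⟩
      filter_upwards [measure_eq_zero_iff_ae_notMem.1 h0] with ω hω _ h
      exact hω h
  filter_upwards [this] with ω hω t
  by_contra h
  exact hω t _ h rfl

variable [NeZero k] {D₁ : DPH N₁} {D₂ : DPH N₂} {prio : Server}

theorem sysMean_peakInd {r t : ℕ} (hr : r < t) {x : SysState N₁ N₂ k} (hx : Regular t x) :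
    sysMean D₁ D₂ prio (peakInd r x) x = (label r x).elim 0 (amcCs D₁ D₂) := by
  rw [← sysMean_cycleEnd D₁ D₂ prio hr hx]
  congr 1

theorem sysMean_add (F G : SysState N₁ N₂ k → ℝ) (x : SysState N₁ N₂ k) :
    sysMean D₁ D₂ prio (fun y => F y + G y) x = sysMean D₁ D₂ prio F x + sysMean D₁ D₂ prio G x :=
  stepMean_add _ _ _ _ _ _

theorem sysMean_sum {ι : Type*} (I : Finset ι) (F : ι → SysState N₁ N₂ k → ℝ) (x : SysState N₁ N₂ k) :
    sysMean D₁ D₂ prio (fun y => ∑ a ∈ I, F a y) x = ∑ a ∈ I, sysMean D₁ D₂ prio (F a) x :=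
  stepMean_sum _ _ _ _ _ _

/-- The mean number of successful packets among those present has the number of ends of cycles as
its decrements. -/
theorem sysMean_sum_label {e : TState N₁ N₂ k → ℝ} (he : amcA D₁ D₂ prio *ᵥ e = e - amcCs D₁ D₂) {t : ℕ}
    {x : SysState N₁ N₂ k} (hx : Regular t x) :
    sysMean D₁ D₂ prio (fun x' => ∑ r ∈ Finset.range (t + 1), (label r x').elim 0 e) x =
      ∑ r ∈ Finset.range t, (label r x).elim 0 e - sysMean D₁ D₂ prio (freshInd t x) x +
        genMean D₁ D₂ prio e x.toRMC := by
  rw [sysMean_sum, Finset.sum_range_succ', sysMean_label_zero]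
  have h1 : freshInd t x = fun x' => ∑ r ∈ Finset.range t, peakInd r x x' :=
    funext fun x' => (sum_peakInd t x x').symm
  rw [h1, sysMean_sum, ← Finset.sum_sub_distrib]
  congr 1
  refine Finset.sum_congr rfl fun r hr => ?_
  rw [sysMean_label_succ D₁ D₂ prio (Finset.mem_range.1 hr) hx, he,
    sysMean_peakInd (Finset.mem_range.1 hr) hx]
  rcases label r x with _ | y <;> simp

theorem measurableSet_toRMC (hX : IsMarkovChain (sysKernel D₁ D₂ prio) P X) (t : ℕ)
    (w : RMCState N₁ N₂ k) : MeasurableSet {ω | (X t ω).toRMC = w} := by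
  have : {ω | (X t ω).toRMC = w} = ⋃ x ∈ {x : SysState N₁ N₂ k | x.toRMC = w}, {ω | X t ω = x} := by
    ext ω; simp
  rw [this]
  exact MeasurableSet.biUnion (Set.to_countable _) fun x _ => hX.measurable t x

variable [IsProbabilityMeasure P]

theorem integral_toRMC_succ (hX : IsMarkovChain (sysKernel D₁ D₂ prio) P X) (t : ℕ)
    (g : RMCState N₁ N₂ k → ℝ) :
    ∫ ω, g (X (t + 1) ω).toRMC ∂P = ∫ ω, (rmcMatrix D₁ D₂ prio *ᵥ g) (X t ω).toRMC ∂P := by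
  rw [integral_succ hX t (F := fun x => g x.toRMC) fun x => abs_le_sum_abs g _]
  simp only [sysMean_toRMC]

theorem integral_toRMC (hX : IsMarkovChain (sysKernel D₁ D₂ prio) P X) (t : ℕ)
    (g : RMCState N₁ N₂ k → ℝ) :
    ∫ ω, g (X t ω).toRMC ∂P = ∫ ω, (rmcMatrix D₁ D₂ prio ^ t *ᵥ g) (X 0 ω).toRMC ∂P := by
  induction t generalizing g with
  | zero => simp
  | succ t ih => rw [integral_toRMC_succ hX, ih, mulVec_mulVec, pow_succ]

/-- If `w'` is never visited, its indicator has mean zero at time `t + 1`. By the Markov property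
this is the mean of `R (·, w')` at time `t`, which must then vanish at every state of positive
probability. -/
theorem visited_closed (hX : IsMarkovChain (sysKernel D₁ D₂ prio) P X) :
    ∀ w ∈ visited P X, ∀ w', 0 < rmcMatrix D₁ D₂ prio w w' → w' ∈ visited P X := by
  rintro w ⟨t, ht⟩ w' hR
  by_contra hw'
  have h0 : ∫ ω, (Pi.single w' 1 : RMCState N₁ N₂ k → ℝ) (X (t + 1) ω).toRMC ∂P = 0 := by
    refine integral_eq_zero_of_ae ?_
    filter_upwards [ae_visited (P := P) (X := X)] with ω hω
    have : (X (t + 1) ω).toRMC ≠ w' := fun h => hw' (h ▸ hω (t + 1))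
    simp [this]
  rw [integral_toRMC_succ hX, mulVec_single_one, integral_eq_zero_iff_of_nonneg] at h0
  · refine ht (measure_eq_zero_iff_ae_notMem.2 ?_)
    filter_upwards [h0] with ω hω h
    simp only [Pi.zero_apply, col_apply] at hω
    rw [show (X t ω).toRMC = w from h] at hω
    exact hR.ne' hω
  · intro ω; exact rmcMatrix_nonneg D₁ D₂ prio _ _
  · exact integrable_comp_of_countable (hX.measurable t)
      (F := fun x => (rmcMatrix D₁ D₂ prio).col w' x.toRMC) fun x => abs_le_sum_abs _ _

variable {p : RMCState N₁ N₂ k → ℝ}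

theorem tendsto_cesaro_visited (hX : IsMarkovChain (sysKernel D₁ D₂ prio) P X)
    (hp_unique : ∀ p' : RMCState N₁ N₂ k → ℝ, IsStationary (rmcMatrix D₁ D₂ prio) p' →
      (∀ w, p' w ≠ 0 → ∃ t, P {ω | (X t ω).toRMC = w} ≠ 0) → p' = p) {w : RMCState N₁ N₂ k}
    (hw : w ∈ visited P X) (g : RMCState N₁ N₂ k → ℝ) :
    Tendsto (fun m : ℕ => (∑ n ∈ Finset.range m, (rmcMatrix D₁ D₂ prio ^ n *ᵥ g) w) / m) atTop
      (𝓝 (p ⬝ᵥ g)) :=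
  tendsto_cesaro_of_unique_stationary (rmcMatrix_nonneg D₁ D₂ prio) (rmcMatrix_one D₁ D₂ prio)
    (visited_closed hX) hp_unique hw g

theorem tendsto_cesaro_integral (hX : IsMarkovChain (sysKernel D₁ D₂ prio) P X)
    (hp_unique : ∀ p' : RMCState N₁ N₂ k → ℝ, IsStationary (rmcMatrix D₁ D₂ prio) p' →
      (∀ w, p' w ≠ 0 → ∃ t, P {ω | (X t ω).toRMC = w} ≠ 0) → p' = p) (g : RMCState N₁ N₂ k → ℝ) :
    Tendsto (fun T : ℕ => (∑ t ∈ Finset.range T, ∫ ω, g (X t ω).toRMC ∂P) / T) atTop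
      (𝓝 (p ⬝ᵥ g)) := by
  have h0 : ∀ h : RMCState N₁ N₂ k → ℝ, ∫ ω, h (X 0 ω).toRMC ∂P =
      ∑ w, P.real {ω | (X 0 ω).toRMC = w} * h w := fun h =>
    (hasSum_integral_comp (P := P) (measurableSet_toRMC hX 0) (abs_le_sum_abs h)).unique
      (hasSum_fintype _)
  have h1 : ∑ w, P.real {ω | (X 0 ω).toRMC = w} = 1 := by
    simpa using (h0 fun _ => 1).symm
  have h2 : Tendsto (fun T : ℕ => ∑ w, P.real {ω | (X 0 ω).toRMC = w} *
      ((∑ n ∈ Finset.range T, (rmcMatrix D₁ D₂ prio ^ n *ᵥ g) w) / T)) atTop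
      (𝓝 (∑ w, P.real {ω | (X 0 ω).toRMC = w} * (p ⬝ᵥ g))) := by
    refine tendsto_finsetSum _ fun w _ => ?_
    by_cases hw : P {ω | (X 0 ω).toRMC = w} = 0
    · simp [Measure.real, hw]
    · exact (tendsto_cesaro_visited hX hp_unique ⟨0, hw⟩ g).const_mul _
  rw [← Finset.sum_mul, h1, one_mul] at h2
  refine h2.congr fun T => ?_
  rw [Finset.sum_congr rfl fun t _ => (integral_toRMC hX t g).trans (h0 _), Finset.sum_comm,
    Finset.sum_div]
  refine Finset.sum_congr rfl fun w _ => ?_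
  rw [← Finset.mul_sum, mul_div_assoc]

end ergodic

end DTDQ

end

/-! ### The number of cycles is close to `λ T` in mean absolute deviation. -/

noncomputable section

namespace DTDQ

section rates

section pathwise

variable {N₁ N₂ k : ℕ}

theorem freshInd_le_endInd (t : ℕ) (x y : SysState N₁ N₂ k) : freshInd t x y ≤ endInd x y := by
  unfold freshInd endInd
  split_ifs with h1 h2 h2
  · rfl
  · exact absurd h1.2 h2
  · norm_num
  · rfl

end pathwise

variable {N₁ N₂ k : ℕ} [NeZero k] {D₁ : DPH N₁} {D₂ : DPH N₂} {prio : Server}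
  {Ω : Type*} [MeasurableSpace Ω] {P : Measure Ω} [IsProbabilityMeasure P]
  {X : ℕ → Ω → SysState N₁ N₂ k} {p : RMCState N₁ N₂ k → ℝ}

/-- Expanding `(|Y| - δ) ^ 2 ≥ 0`. Used with `δ` proportional to `T`, it turns a second moment of
order `T` into a first moment of at most a small multiple of `T` plus a constant. -/
theorem integral_abs_le_of_sq {Y : Ω → ℝ} (hY : Measurable Y) {B : ℝ} (hB : ∀ ω, |Y ω| ≤ B) {δ : ℝ}
    (hδ : 0 < δ) : ∫ ω, |Y ω| ∂P ≤ (∫ ω, Y ω ^ 2 ∂P) / (2 * δ) + δ / 2 := by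
  have i1 : Integrable (fun ω => |Y ω|) P :=
    Integrable.of_bound hY.norm.aestronglyMeasurable B
      (Eventually.of_forall fun ω => by simpa using hB ω)
  have i2 : Integrable (fun ω => Y ω ^ 2) P :=
    Integrable.of_bound (hY.pow_const 2).aestronglyMeasurable (B ^ 2)
      (Eventually.of_forall fun ω => by
        rw [Real.norm_eq_abs, abs_pow]; exact pow_le_pow_left₀ (abs_nonneg _) (hB ω) 2)
  calc ∫ ω, |Y ω| ∂P ≤ ∫ ω, (Y ω ^ 2 / (2 * δ) + δ / 2) ∂P := by
        refine integral_mono i1 ((i2.div_const _).add (integrable_const _)) fun ω => ?_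
        have h := sq_nonneg (|Y ω| - δ)
        have h2 : |Y ω| * (2 * δ) ≤ Y ω ^ 2 + δ ^ 2 := by rw [← sq_abs (Y ω)]; linarith
        have h3 : |Y ω| ≤ (Y ω ^ 2 + δ ^ 2) / (2 * δ) := by rwa [le_div_iff₀ (by positivity)]
        refine h3.trans_eq ?_
        field_simp
    _ = (∫ ω, Y ω ^ 2 ∂P) / (2 * δ) + δ / 2 := by
        rw [integral_add (i2.div_const _) (integrable_const _), integral_div]
        simp

/-- The number of ends of cycles grows linearly in the mean, up to cycles of initial packets. -/
theorem exists_bound_freshInd (hX : IsMarkovChain (sysKernel D₁ D₂ prio) P X)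
    (hp_unique : ∀ p' : RMCState N₁ N₂ k → ℝ, IsStationary (rmcMatrix D₁ D₂ prio) p' →
      (∀ w, p' w ≠ 0 → ∃ t, P {ω | (X t ω).toRMC = w} ≠ 0) → p' = p)
    {e : TState N₁ N₂ k → ℝ} (he : amcA D₁ D₂ prio *ᵥ e = e - amcCs D₁ D₂) {ε : ℝ} (hε : 0 < ε) :
    ∃ K, ∀ T : ℕ, ∫ ω, |∑ t ∈ Finset.range T, freshInd t (X t ω) (X (t + 1) ω) -
      (p ⬝ᵥ genMean D₁ D₂ prio e) * T| ∂P ≤ ε * T + K := by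
  set f := genMean D₁ D₂ prio e with hf
  set lam := p ⬝ᵥ f with hlam
  -- There are finitely many visited states, so a single window length `m` brings all the averaged
  -- generation means within `ε / 2` of `λ`.
  obtain ⟨m, hm, hm0⟩ : ∃ m : ℕ, (∀ w ∈ visited P X,
      |(∑ n ∈ Finset.range m, (rmcMatrix D₁ D₂ prio ^ n *ᵥ f) w) / m - lam| ≤ ε / 2) ∧ m ≠ 0 := by
    refine (Eventually.and ?_ (eventually_ne_atTop 0)).exists
    rw [Filter.eventually_all_finite (Set.toFinite (visited P X))]
    intro w hw
    have := (tendsto_cesaro_visited hX hp_unique hw f)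
    filter_upwards [(Metric.tendsto_nhds.1 this) (ε / 2) (by positivity)] with m hm
    exact (Real.dist_eq _ _ ▸ hm).le
  obtain ⟨ψ, hψ⟩ := exists_potential (rmcMatrix D₁ D₂ prio) f hm0
  set fb : RMCState N₁ N₂ k → ℝ :=
    (m : ℝ)⁻¹ • ∑ n ∈ Finset.range m, rmcMatrix D₁ D₂ prio ^ n *ᵥ f with hfb
  have hfb' : ∀ w ∈ visited P X, |fb w - lam| ≤ ε / 2 := fun w hw => by
    have := hm w hw
    rwa [hfb, Pi.smul_apply, Finset.sum_apply, smul_eq_mul, inv_mul_eq_div]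
  -- The mean number of future successes among the packets generated after time 0 that are present,
  -- plus the potential which replaces the fluctuating generation mean `f` by its average `fb` over
  -- the window.
  set V : ℕ → SysState N₁ N₂ k → ℝ := fun t x =>
    ∑ r ∈ Finset.range t, (label r x).elim 0 e + ψ x.toRMC with hV
  set B := 3 * ∑ y, |e y| + ∑ w, |ψ w| with hB
  have hVB : ∀ t x, |V t x| ≤ B := fun t x =>
    (abs_add_le _ _).trans (add_le_add (abs_sum_label_le e t x) (abs_le_sum_abs ψ _))
  -- In conditional mean, `V` loses the ends of cycles and gains `fb`. Adding these back leaves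
  -- increments of mean zero at regular states.
  set D : ℕ → SysState N₁ N₂ k → SysState N₁ N₂ k → ℝ := fun t x y =>
    V (t + 1) y + (freshInd t x y + (-V t x - fb x.toRMC)) with hD
  set C := B + (1 + (B + ∑ w, |fb w|)) with hC
  have hDC : ∀ t x y, |D t x y| ≤ C := fun t x y => by
    refine (abs_add_le _ _).trans (add_le_add (hVB _ _) ?_)
    refine (abs_add_le _ _).trans (add_le_add (abs_freshInd_le _ _ _) ?_)
    refine (abs_sub _ _).trans (add_le_add ?_ (abs_le_sum_abs fb _))
    rw [abs_neg]; exact hVB _ _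
  have hmean : ∀ t x, Regular t x → sysMean D₁ D₂ prio (D t x) x = 0 := fun t x hx => by
    have h1 : sysMean D₁ D₂ prio (V (t + 1)) x =
        ∑ r ∈ Finset.range t, (label r x).elim 0 e - sysMean D₁ D₂ prio (freshInd t x) x +
          f x.toRMC + (ψ x.toRMC - f x.toRMC + fb x.toRMC) := by
      simp only [hV]
      rw [sysMean_add, sysMean_sum_label he hx, sysMean_toRMC, hψ]
      simp [hf]
    have h2 : sysMean D₁ D₂ prio (D t x) x = sysMean D₁ D₂ prio (V (t + 1)) x +
        (sysMean D₁ D₂ prio (freshInd t x) x + (-V t x - fb x.toRMC)) := by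
      rw [← sysMean_const (D₁ := D₁) (D₂ := D₂) (prio := prio) (-V t x - fb x.toRMC) x,
        ← sysMean_add (freshInd t x), ← sysMean_add (V (t + 1))]
    rw [h2, h1]
    simp only [hV]
    ring
  refine ⟨C ^ 2 / (2 * ε) + ε / 2 + 2 * B, fun T => ?_⟩
  have hmeas : Measurable fun ω => ∑ t ∈ Finset.range T, D t (X t ω) (X (t + 1) ω) :=
    Finset.measurable_sum _ fun t _ => measurable_pair hX t (D t)
  have hbd : ∀ ω, |∑ t ∈ Finset.range T, D t (X t ω) (X (t + 1) ω)| ≤ T * C := fun ω => by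
    refine (Finset.abs_sum_le_sum_abs _ _).trans ?_
    refine (Finset.sum_le_sum fun t _ => hDC t _ _).trans ?_
    simp
  have hsum : ∀ ω, ∑ t ∈ Finset.range T, freshInd t (X t ω) (X (t + 1) ω) - lam * T =
      ∑ t ∈ Finset.range T, D t (X t ω) (X (t + 1) ω) - V T (X T ω) + V 0 (X 0 ω) +
        ∑ t ∈ Finset.range T, (fb (X t ω).toRMC - lam) := fun ω => by
    have h1 := Finset.sum_range_sub (fun t => V t (X t ω)) T
    simp only [Finset.sum_sub_distrib] at h1
    simp only [hD, Finset.sum_add_distrib, Finset.sum_sub_distrib, Finset.sum_neg_distrib,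
      Finset.sum_const, Finset.card_range, nsmul_eq_mul]
    linarith
  have hae : ∀ᵐ ω ∂P, |∑ t ∈ Finset.range T, freshInd t (X t ω) (X (t + 1) ω) - lam * T| ≤
      |∑ t ∈ Finset.range T, D t (X t ω) (X (t + 1) ω)| + (2 * B + ε / 2 * T) := by
    filter_upwards [ae_visited (P := P) (X := X)] with ω hω
    rw [hsum]
    have h1 : |∑ t ∈ Finset.range T, (fb (X t ω).toRMC - lam)| ≤ ε / 2 * T := by
      refine (Finset.abs_sum_le_sum_abs _ _).trans ?_
      refine (Finset.sum_le_sum fun t _ => hfb' _ (hω t)).trans ?_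
      simp [mul_comm]
    have h2 := hVB T (X T ω)
    have h3 := hVB 0 (X 0 ω)
    rw [abs_le] at h1 h2 h3
    have h4 := le_abs_self (∑ t ∈ Finset.range T, D t (X t ω) (X (t + 1) ω))
    have h5 := neg_abs_le (∑ t ∈ Finset.range T, D t (X t ω) (X (t + 1) ω))
    rw [abs_le]
    constructor <;> linarith
  have hint : Integrable (fun ω => |∑ t ∈ Finset.range T, D t (X t ω) (X (t + 1) ω)|) P :=
    Integrable.of_bound hmeas.norm.aestronglyMeasurable (T * C)
      (Eventually.of_forall fun ω => by simpa using hbd ω)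
  have hint' : Integrable (fun ω => |∑ t ∈ Finset.range T, freshInd t (X t ω) (X (t + 1) ω) - lam * T|) P := by
    refine Integrable.mono' (hint.add (integrable_const (2 * B + ε / 2 * T))) ?_ ?_
    · exact (((Finset.measurable_sum _ fun t _ => measurable_pair hX t (freshInd t)).sub_const
        _).norm).aestronglyMeasurable
    · filter_upwards [hae] with ω hω
      simpa using hω
  -- With `δ = ε * (T + 1)` the martingale contributes `ε / 2 * T` and a constant. The other `ε / 2
  -- * T` comes from the distance between `fb` and `λ`.
  have h6 := integral_abs_le_of_sq (P := P) hmeas hbd (δ := ε * (T + 1)) (by positivity)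
  have h7 := integral_sq_sum_le hX hDC hmean T
  have h8 : (∫ ω, (∑ t ∈ Finset.range T, D t (X t ω) (X (t + 1) ω)) ^ 2 ∂P) / (2 * (ε * (T + 1))) ≤
      C ^ 2 / (2 * ε) := by
    rw [div_le_div_iff₀ (by positivity) (by positivity)]
    have : (C ^ 2 * T) * (2 * ε) ≤ C ^ 2 * (2 * (ε * (T + 1))) := by
      nlinarith [mul_nonneg (sq_nonneg C) hε.le]
    exact (mul_le_mul_of_nonneg_right h7 (by positivity)).trans this
  calc _ ≤ ∫ ω, (|∑ t ∈ Finset.range T, D t (X t ω) (X (t + 1) ω)| + (2 * B + ε / 2 * T)) ∂P :=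
        integral_mono_ae hint' (hint.add (integrable_const _)) hae
    _ = ∫ ω, |∑ t ∈ Finset.range T, D t (X t ω) (X (t + 1) ω)| ∂P + (2 * B + ε / 2 * T) := by
        rw [integral_add hint (integrable_const _)]; simp
    _ ≤ ε * T + (C ^ 2 / (2 * ε) + ε / 2 + 2 * B) := by linarith

theorem next_aoi_le {x y : SysState N₁ N₂ k} (h : Follows prio x y) : y.aoi ≤ x.aoi + 1 := by
  obtain ⟨o₁, o₂, n₁, n₂, -, rfl⟩ := h
  have h1 : ∀ {N : ℕ} (s : Option (Fin N × ℕ)) (o : Option (Fin N)) (d : ℕ), deliver s o d ≤ d := by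
    intro N s o d
    rcases s with _ | ⟨i, a⟩ <;> rcases o with _ | i' <;> simp [deliver]
  exact (h1 _ _ _).trans (h1 _ _ _)

/-- The number of cycles which end with the reception of an initial packet is bounded on every
trajectory. -/
theorem sum_endInd_sub_freshInd_le {x : ℕ → SysState N₁ N₂ k} (hx : ∀ t, Follows prio (x t) (x (t + 1)))
    (T : ℕ) : ∑ t ∈ Finset.range T, (endInd (x t) (x (t + 1)) - freshInd t (x t) (x (t + 1))) ≤
      (x 0).aoi + 1 := by
  -- The truncated difference `aoi + 1 - T` in `ℕ` serves as a potential: it never increases, and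
  -- drops by at least one whenever a cycle of peak at least `T` ends in slot `T`.
  have key : ∑ t ∈ Finset.range T, (endInd (x t) (x (t + 1)) - freshInd t (x t) (x (t + 1))) +
      (((x T).aoi + 1 - T : ℕ) : ℝ) ≤ (x 0).aoi + 1 := by
    induction T with
    | zero => simp
    | succ T ih =>
      rw [Finset.sum_range_succ]
      have h1 := next_aoi_le (hx T)
      have h2 : endInd (x T) (x (T + 1)) - freshInd T (x T) (x (T + 1)) +
          (((x (T + 1)).aoi + 1 - (T + 1) : ℕ) : ℝ) ≤ (((x T).aoi + 1 - T : ℕ) : ℝ) := by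
        unfold endInd freshInd
        by_cases h3 : (x (T + 1)).aoi < (x T).aoi + 1
        · by_cases h4 : (x T).aoi < T
          · simp only [h3, h4, and_self, if_true, sub_self, zero_add]
            exact_mod_cast (by omega)
          · simp only [h3, h4, false_and, if_true, if_false, sub_zero]
            exact_mod_cast (by omega)
        · simp only [h3, and_false, if_false, sub_self, zero_add]
          exact_mod_cast (by omega)
      linarith
  have : (0 : ℝ) ≤ (((x T).aoi + 1 - T : ℕ) : ℝ) := Nat.cast_nonneg _
  linarith

/-- On each trajectory the sum is bounded by the initial age of information, which may fail to be
integrable. After division by `T` the integrand is at most 1, so dominated convergence applies for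
every initial law. -/
theorem tendsto_integral_sub (hX : IsMarkovChain (sysKernel D₁ D₂ prio) P X) :
    Tendsto (fun T : ℕ => ∫ ω, (∑ t ∈ Finset.range T, (endInd (X t ω) (X (t + 1) ω) -
      freshInd t (X t ω) (X (t + 1) ω))) / (T : ℝ) ∂P) atTop (𝓝 0) := by
  rw [← integral_zero Ω ℝ (μ := P)]
  refine tendsto_integral_of_dominated_convergence (fun _ => 1) (fun T => ?_) (integrable_const _)
    (fun T => Eventually.of_forall fun ω => ?_) ?_
  · exact ((Finset.measurable_sum _ fun t _ => (measurable_pair hX t endInd).sub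
      (measurable_pair hX t (freshInd t))).div_const _).aestronglyMeasurable
  · have h0 : ∀ t, 0 ≤ endInd (X t ω) (X (t + 1) ω) - freshInd t (X t ω) (X (t + 1) ω) := fun t =>
      sub_nonneg.2 (freshInd_le_endInd _ _ _)
    have h1 : ∀ t, endInd (X t ω) (X (t + 1) ω) - freshInd t (X t ω) (X (t + 1) ω) ≤ 1 := fun t => by
      have h2 := (abs_le.1 (abs_endInd_le (X t ω) (X (t + 1) ω))).2
      have h3 : 0 ≤ freshInd t (X t ω) (X (t + 1) ω) := by unfold freshInd; split_ifs <;> simp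
      linarith
    rw [Real.norm_eq_abs, abs_of_nonneg (div_nonneg (Finset.sum_nonneg fun t _ => h0 t)
      (Nat.cast_nonneg _))]
    refine div_le_one_of_le₀ ?_ (Nat.cast_nonneg _)
    refine (Finset.sum_le_sum fun t _ => h1 t).trans_eq (by simp)
  · filter_upwards [ae_follows hX] with ω hω
    refine squeeze_zero (fun T => ?_) (fun T => ?_)
      (tendsto_const_div_atTop_nhds_zero_nat (((X 0 ω).aoi : ℝ) + 1))
    · exact div_nonneg (Finset.sum_nonneg fun t _ => sub_nonneg.2 (freshInd_le_endInd _ _ _))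
        (Nat.cast_nonneg _)
    · exact div_le_div_of_nonneg_right (sum_endInd_sub_freshInd_le hω T) (Nat.cast_nonneg _)

end rates

end DTDQ

end

/-! ### Counting fresh packets in service. -/

noncomputable section

namespace DTDQ

/-- The number of packets in service which are fresher than all received packets. -/
def SysState.freshCount {N₁ N₂ k : ℕ} (x : SysState N₁ N₂ k) : ℕ :=
  (x.srv₁.elim 0 fun s => if s.2 < x.aoi then 1 else 0) +
    x.srv₂.elim 0 fun s => if s.2 < x.aoi then 1 else 0

theorem freshCount_le {N₁ N₂ k : ℕ} (x : SysState N₁ N₂ k) : x.freshCount ≤ 2 := by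
  have h : ∀ {N : ℕ} (s : Option (Fin N × ℕ)), (s.elim 0 fun s => if s.2 < x.aoi then 1 else 0) ≤ 1 := by
    intro N s
    rcases s with _ | s
    · simp
    · simp only [Option.elim]; split_ifs <;> simp
  exact Nat.add_le_add (h _) (h _)

/-- A generated packet is fresh and adds one to the count. Fresh packets are lost only when a cycle
ends, and then at most two of them, since there are two servers. -/
theorem freshCount_next {N₁ N₂ k : ℕ} [NeZero k] {prio : Server} {x y : SysState N₁ N₂ k}
    (h : Follows prio x y) :
    x.freshCount + (label 0 y).elim 0 (1 : TState N₁ N₂ k → ℝ) ≤ y.freshCount + 2 * endInd x y := by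
  obtain ⟨o₁, o₂, n₁, n₂, ho, rfl⟩ := h
  rw [label_zero_next ho, genNext_elim_one]
  have hc := freshCount_le x
  have key : x.freshCount + (if started prio x.clock o₁ o₂ = none then 0 else 1) ≤
      (x.next prio o₁ o₂ n₁ n₂).freshCount +
        2 * (if (x.next prio o₁ o₂ n₁ n₂).aoi < x.aoi + 1 then 1 else 0) := by
    have hpos := next_aoi_pos (prio := prio) (x := x) (o₁ := o₁) (o₂ := o₂) (n₁ := n₁) (n₂ := n₂)
    rw [next_eq] at *
    unfold SysState.freshCount at *
    rcases x with ⟨s₁, s₂, l, d⟩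
    obtain ⟨ho₁, ho₂⟩ := ho
    have hs : started prio l o₁ o₂ = none ∨ (started prio l o₁ o₂ = some .S1 ∧ o₁ = none) ∨
        (started prio l o₁ o₂ = some .S2 ∧ o₂ = none) := by
      unfold started
      rcases o₁ with _ | i <;> rcases o₂ with _ | j <;> rcases prio <;> by_cases hl : l.val + 1 = k <;>
        simp [hl, sampler]
    rcases hs with hs | ⟨hs, rfl⟩ | ⟨hs, rfl⟩
    all_goals
      try rcases o₁ with _ | i
    all_goals
      try rcases o₂ with _ | j
    all_goals
      rcases s₁ with _ | ⟨i₁, a⟩ <;> rcases s₂ with _ | ⟨i₂, b⟩ <;>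
      simp [hs, deliver] at ho₁ ho₂ hpos hc ⊢ <;> grind
  have h2 : ((x.freshCount + (if started prio x.clock o₁ o₂ = none then 0 else 1) : ℕ) : ℝ) ≤
      ((x.next prio o₁ o₂ n₁ n₂).freshCount +
        2 * (if (x.next prio o₁ o₂ n₁ n₂).aoi < x.aoi + 1 then 1 else 0) : ℕ) := by exact_mod_cast key
  simpa [endInd] using h2

end DTDQ

end

/-! ### Rates per slot of cycles, of peaks and of generated packets. -/

noncomputable section

namespace DTDQ

theorem tendsto_cesaro_shift {a b : ℕ → ℝ} {m : ℕ} {L : ℝ} (hab : ∀ s, a (s + m) = b s)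
    (hb : Tendsto (fun T : ℕ => (∑ s ∈ Finset.range T, b s) / T) atTop (𝓝 L)) :
    Tendsto (fun T : ℕ => (∑ s ∈ Finset.range T, a s) / T) atTop (𝓝 L) := by
  rw [← tendsto_add_atTop_iff_nat m]
  have h1 : Tendsto (fun T : ℕ => (∑ t ∈ Finset.range m, a t) / ((T + m : ℕ) : ℝ)) atTop (𝓝 0) :=
    (tendsto_add_atTop_iff_nat (f := fun T : ℕ => (∑ t ∈ Finset.range m, a t) / (T : ℝ)) m).2
      (tendsto_const_div_atTop_nhds_zero_nat _)
  have h2 : Tendsto (fun T : ℕ => (T : ℝ) / ((T + m : ℕ) : ℝ)) atTop (𝓝 1) := by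
    simpa using tendsto_natCast_div_add_atTop (m : ℝ)
  have h3 := h1.add (hb.mul h2)
  rw [zero_add, mul_one] at h3
  refine h3.congr fun T => ?_
  rw [add_comm T m, Finset.sum_range_add, add_div]
  congr 1
  rw [Finset.sum_congr rfl fun s _ => (by rw [add_comm, hab] : a (m + s) = b s)]
  rcases Nat.eq_zero_or_pos T with rfl | hT
  · simp
  · have : (T : ℝ) ≠ 0 := by positivity
    field_simp

section rates

variable {N₁ N₂ k : ℕ} [NeZero k] {D₁ : DPH N₁} {D₂ : DPH N₂} {prio : Server}
  {Ω : Type*} [MeasurableSpace Ω] {P : Measure Ω} [IsProbabilityMeasure P]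
  {X : ℕ → Ω → SysState N₁ N₂ k} {p : RMCState N₁ N₂ k → ℝ}

theorem integrable_sum_pair (hX : IsMarkovChain (sysKernel D₁ D₂ prio) P X)
    {H : ℕ → SysState N₁ N₂ k → SysState N₁ N₂ k → ℝ} {C : ℝ} (hH : ∀ t x y, |H t x y| ≤ C) (T : ℕ) :
    Integrable (fun ω => ∑ t ∈ Finset.range T, H t (X t ω) (X (t + 1) ω)) P :=
  integrable_finsetSum _ fun t _ =>
    Integrable.of_bound (measurable_pair hX t (H t)).aestronglyMeasurable C
      (Eventually.of_forall fun _ => hH t _ _)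

/-- The number of cycles completed up to time `T` is asymptotically proportional to `T`, in mean. -/
theorem tendsto_integral_abs_sum_endInd (hX : IsMarkovChain (sysKernel D₁ D₂ prio) P X)
    (hp_unique : ∀ p' : RMCState N₁ N₂ k → ℝ, IsStationary (rmcMatrix D₁ D₂ prio) p' →
      (∀ w, p' w ≠ 0 → ∃ t, P {ω | (X t ω).toRMC = w} ≠ 0) → p' = p)
    {e : TState N₁ N₂ k → ℝ} (he : amcA D₁ D₂ prio *ᵥ e = e - amcCs D₁ D₂) :
    Tendsto (fun T : ℕ => (∫ ω, |∑ t ∈ Finset.range T, endInd (X t ω) (X (t + 1) ω) -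
      (p ⬝ᵥ genMean D₁ D₂ prio e) * T| ∂P) / T) atTop (𝓝 0) := by
  set lam := p ⬝ᵥ genMean D₁ D₂ prio e
  have hb := tendsto_integral_sub hX
  refine tendsto_order.2 ⟨fun a ha => Eventually.of_forall fun T => ha.trans_le
    (div_nonneg (integral_nonneg fun ω => abs_nonneg _) (Nat.cast_nonneg _)), fun a ha => ?_⟩
  -- Three errors below `a / 3` each: the martingale estimate, its additive constant divided by `T`,
  -- and the cycles due to the initial state.
  obtain ⟨K, hK⟩ := exists_bound_freshInd hX hp_unique he (ε := a / 3) (by positivity)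
  have hK0 := tendsto_const_div_atTop_nhds_zero_nat K
  filter_upwards [hb.eventually_lt_const (show 0 < a / 3 by positivity),
    hK0.eventually_lt_const (show 0 < a / 3 by positivity), eventually_gt_atTop 0] with T h1 h2 hT
  have hT' : (0 : ℝ) < T := by exact_mod_cast hT
  have i1 := integrable_sum_pair hX (H := fun _ => endInd) (fun _ => abs_endInd_le) T
  have i2 := integrable_sum_pair hX (H := freshInd) abs_freshInd_le T
  have h3 : ∫ ω, |∑ t ∈ Finset.range T, endInd (X t ω) (X (t + 1) ω) - lam * T| ∂P ≤
      ∫ ω, |∑ t ∈ Finset.range T, freshInd t (X t ω) (X (t + 1) ω) - lam * T| ∂P +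
        ∫ ω, ∑ t ∈ Finset.range T, (endInd (X t ω) (X (t + 1) ω) -
          freshInd t (X t ω) (X (t + 1) ω)) ∂P := by
    simp only [Finset.sum_sub_distrib]
    have i3 : Integrable (fun ω => |∑ t ∈ Finset.range T, freshInd t (X t ω) (X (t + 1) ω) -
      lam * T|) P := (i2.sub (integrable_const _)).abs
    have i4 : Integrable (fun ω => ∑ t ∈ Finset.range T, endInd (X t ω) (X (t + 1) ω) -
      ∑ t ∈ Finset.range T, freshInd t (X t ω) (X (t + 1) ω)) P := i1.sub i2
    rw [← integral_add i3 i4]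
    refine integral_mono (i1.sub (integrable_const _)).abs (i3.add i4) fun ω => ?_
    have h4 : 0 ≤ ∑ t ∈ Finset.range T, endInd (X t ω) (X (t + 1) ω) -
        ∑ t ∈ Finset.range T, freshInd t (X t ω) (X (t + 1) ω) :=
      sub_nonneg.2 (Finset.sum_le_sum fun t _ => freshInd_le_endInd _ _ _)
    have h5 := abs_add_le (∑ t ∈ Finset.range T, freshInd t (X t ω) (X (t + 1) ω) - lam * T)
      (∑ t ∈ Finset.range T, endInd (X t ω) (X (t + 1) ω) -
        ∑ t ∈ Finset.range T, freshInd t (X t ω) (X (t + 1) ω))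
    rw [abs_of_nonneg h4] at h5
    refine le_trans (le_of_eq ?_) h5
    congr 1
    ring
  rw [integral_div, div_lt_iff₀ hT'] at h1
  rw [div_lt_iff₀ hT'] at h2 ⊢
  have := hK T
  linarith

theorem tendsto_mean_sum_endInd (hX : IsMarkovChain (sysKernel D₁ D₂ prio) P X)
    (hp_unique : ∀ p' : RMCState N₁ N₂ k → ℝ, IsStationary (rmcMatrix D₁ D₂ prio) p' →
      (∀ w, p' w ≠ 0 → ∃ t, P {ω | (X t ω).toRMC = w} ≠ 0) → p' = p)
    {e : TState N₁ N₂ k → ℝ} (he : amcA D₁ D₂ prio *ᵥ e = e - amcCs D₁ D₂) :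
    Tendsto (fun T : ℕ => (∫ ω, ∑ t ∈ Finset.range T, endInd (X t ω) (X (t + 1) ω) ∂P) / T) atTop
      (𝓝 (p ⬝ᵥ genMean D₁ D₂ prio e)) := by
  rw [tendsto_iff_norm_sub_tendsto_zero]
  refine squeeze_zero' (Eventually.of_forall fun T => norm_nonneg _) ?_
    (tendsto_integral_abs_sum_endInd hX hp_unique he)
  filter_upwards [eventually_gt_atTop 0] with T hT
  have hT' : (0 : ℝ) < T := by exact_mod_cast hT
  have i1 := integrable_sum_pair hX (H := fun _ => endInd) (fun _ => abs_endInd_le) T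
  have h1 : (∫ ω, ∑ t ∈ Finset.range T, endInd (X t ω) (X (t + 1) ω) ∂P) / T -
      p ⬝ᵥ genMean D₁ D₂ prio e = (∫ ω, (∑ t ∈ Finset.range T, endInd (X t ω) (X (t + 1) ω) -
        (p ⬝ᵥ genMean D₁ D₂ prio e) * T) ∂P) / T := by
    rw [integral_sub i1 (integrable_const _)]
    simp only [integral_const, probReal_univ, one_smul]
    field_simp
  rw [h1, Real.norm_eq_abs, abs_div, abs_of_pos hT']
  exact div_le_div_of_nonneg_right abs_integral_le_integral_abs hT'.le

/-- A packet generated on the transition from `s` to `s + 1` has age `h` at time `s + 1 + h`. Its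
label has by then made `h` steps of `A`, the age always being smaller than the time, as
`sysMean_label_succ` requires. -/
theorem integral_label (hX : IsMarkovChain (sysKernel D₁ D₂ prio) P X) (h s : ℕ)
    (v : TState N₁ N₂ k → ℝ) :
    ∫ ω, (label h (X (s + 1 + h) ω)).elim 0 v ∂P =
      ∫ ω, genMean D₁ D₂ prio (amcA D₁ D₂ prio ^ h *ᵥ v) (X s ω).toRMC ∂P := by
  induction h generalizing v with
  | zero =>
    rw [add_zero, integral_succ hX s (F := fun x => (label 0 x).elim 0 v) fun x => abs_elim_le v _]
    simp only [sysMean_label_zero, pow_zero, one_mulVec]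
  | succ h ih =>
    rw [pow_succ, ← mulVec_mulVec, ← ih, ← add_assoc,
      integral_succ hX (s + 1 + h) (F := fun x => (label (h + 1) x).elim 0 v) fun x => abs_elim_le v _]
    refine integral_congr_ae ?_
    filter_upwards [ae_regular hX] with ω hω
    exact sysMean_label_succ D₁ D₂ prio (by omega) (hω _) v

/-- A peak `h` observed at time `s + 1 + h` belongs to the packet generated on the transition from
`s` to `s + 1`, and the next slot completes the success. -/
theorem integral_peakInd (hX : IsMarkovChain (sysKernel D₁ D₂ prio) P X) (h s : ℕ) :
    ∫ ω, peakInd h (X (s + (1 + h)) ω) (X (s + (1 + h) + 1) ω) ∂P =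
      ∫ ω, genMean D₁ D₂ prio (amcA D₁ D₂ prio ^ h *ᵥ amcCs D₁ D₂) (X s ω).toRMC ∂P := by
  rw [← integral_label hX, integral_pair hX _ (H := peakInd h) (abs_peakInd_le h), add_assoc]
  refine integral_congr_ae ?_
  filter_upwards [ae_regular hX] with ω hω
  exact sysMean_peakInd (by omega) (hω _)

theorem tendsto_mean_sum_peakInd (hX : IsMarkovChain (sysKernel D₁ D₂ prio) P X)
    (hp_unique : ∀ p' : RMCState N₁ N₂ k → ℝ, IsStationary (rmcMatrix D₁ D₂ prio) p' →
      (∀ w, p' w ≠ 0 → ∃ t, P {ω | (X t ω).toRMC = w} ≠ 0) → p' = p) (h : ℕ) :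
    Tendsto (fun T : ℕ => (∫ ω, ∑ t ∈ Finset.range T, peakInd h (X t ω) (X (t + 1) ω) ∂P) / T) atTop
      (𝓝 (p ⬝ᵥ genMean D₁ D₂ prio (amcA D₁ D₂ prio ^ h *ᵥ amcCs D₁ D₂))) := by
  refine (tendsto_cesaro_shift (m := 1 + h)
    (a := fun t => ∫ ω, peakInd h (X t ω) (X (t + 1) ω) ∂P) (integral_peakInd hX h)
    (tendsto_cesaro_integral hX hp_unique _)).congr fun T => ?_
  rw [integral_finsetSum _ fun t _ => ?_]
  exact Integrable.of_bound (measurable_pair hX t (peakInd h)).aestronglyMeasurable 1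
    (Eventually.of_forall fun _ => abs_peakInd_le h _ _)

/-- The slotwise balance of fresh packets telescopes, and the count at time `T` is at most two. -/
theorem sum_label_zero_le {x : ℕ → SysState N₁ N₂ k} (hx : ∀ t, Follows prio (x t) (x (t + 1))) (T : ℕ) :
    ∑ t ∈ Finset.range T, (label 0 (x (t + 1))).elim 0 (1 : TState N₁ N₂ k → ℝ) ≤
      2 + 2 * ∑ t ∈ Finset.range T, endInd (x t) (x (t + 1)) := by
  have key : ∑ t ∈ Finset.range T, (label 0 (x (t + 1))).elim 0 (1 : TState N₁ N₂ k → ℝ) +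
      (x 0).freshCount ≤
        (x T).freshCount + 2 * ∑ t ∈ Finset.range T, endInd (x t) (x (t + 1)) := by
    induction T with
    | zero => simp
    | succ T ih =>
      rw [Finset.sum_range_succ, Finset.sum_range_succ]
      linarith [freshCount_next (hx T)]
  have h1 : ((x T).freshCount : ℝ) ≤ 2 := by exact_mod_cast freshCount_le _
  have h2 : (0 : ℝ) ≤ (x 0).freshCount := Nat.cast_nonneg _
  linarith

/-- At most two packets are generated per cycle, on average. -/
theorem dotProduct_genMean_one_le (hX : IsMarkovChain (sysKernel D₁ D₂ prio) P X)
    (hp_unique : ∀ p' : RMCState N₁ N₂ k → ℝ, IsStationary (rmcMatrix D₁ D₂ prio) p' →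
      (∀ w, p' w ≠ 0 → ∃ t, P {ω | (X t ω).toRMC = w} ≠ 0) → p' = p)
    {e : TState N₁ N₂ k → ℝ} (he : amcA D₁ D₂ prio *ᵥ e = e - amcCs D₁ D₂) :
    p ⬝ᵥ genMean D₁ D₂ prio 1 ≤ 2 * (p ⬝ᵥ genMean D₁ D₂ prio e) := by
  have h1 := tendsto_cesaro_integral hX hp_unique (genMean D₁ D₂ prio 1)
  have h2 := (tendsto_const_div_atTop_nhds_zero_nat (2 : ℝ)).add
    ((tendsto_mean_sum_endInd hX hp_unique he).const_mul 2)
  rw [zero_add] at h2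
  refine le_of_tendsto_of_tendsto' h1 h2 fun T => ?_
  rw [← mul_div_assoc, ← add_div]
  refine div_le_div_of_nonneg_right ?_ (Nat.cast_nonneg _)
  have i1 := integrable_sum_pair hX (H := fun _ => endInd) (fun _ => abs_endInd_le) T
  have i2 : ∀ t, Integrable
      (fun ω => (label 0 (X (t + 1) ω)).elim 0 (1 : TState N₁ N₂ k → ℝ)) P := fun t =>
    integrable_comp_of_countable (hX.measurable (t + 1))
      (F := fun x => (label 0 x).elim 0 (1 : TState N₁ N₂ k → ℝ)) fun x => abs_elim_le _ _
  calc ∑ t ∈ Finset.range T, ∫ ω, genMean D₁ D₂ prio 1 (X t ω).toRMC ∂P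
      = ∫ ω, ∑ t ∈ Finset.range T,
          (label 0 (X (t + 1) ω)).elim 0 (1 : TState N₁ N₂ k → ℝ) ∂P := by
        rw [integral_finsetSum _ fun t _ => i2 t]
        refine Finset.sum_congr rfl fun t _ => ?_
        have := integral_label hX 0 t (1 : TState N₁ N₂ k → ℝ)
        simpa using this.symm
    _ ≤ ∫ ω, (2 + 2 * ∑ t ∈ Finset.range T, endInd (X t ω) (X (t + 1) ω)) ∂P := by
        refine integral_mono_ae (integrable_finsetSum _ fun t _ => i2 t)
          ((integrable_const _).add (i1.const_mul 2)) ?_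
        filter_upwards [ae_follows hX] with ω hω
        exact sum_label_zero_le hω T
    _ = 2 + 2 * ∫ ω, ∑ t ∈ Finset.range T, endInd (X t ω) (X (t + 1) ω) ∂P := by
        rw [integral_add (integrable_const _) (i1.const_mul 2), integral_const_mul]
        simp

end rates

end DTDQ

end

/-! ### The absorbing chain: invertibility, initial law and successful absorption. -/

noncomputable section

namespace DTDQ

section absorbing

variable {N₁ N₂ k : ℕ}

theorem amcCs_nonneg (D₁ : DPH N₁) (D₂ : DPH N₂) (y : TState N₁ N₂ k) : 0 ≤ amcCs D₁ D₂ y := by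
  have h1 : ∀ i, D₁.b i ≤ 1 := fun i => by
    rw [DPH.b_eq]; linarith [Finset.sum_nonneg fun j (_ : j ∈ Finset.univ) => D₁.B_nonneg i j]
  cases y <;> simp only [amcCs, le_refl, DPH.b_nonneg]
  rename_i i j
  nlinarith [h1 i, D₁.b_nonneg i, D₂.b_nonneg j]

variable [NeZero k] (D₁ : DPH N₁) (D₂ : DPH N₂) (prio : Server)

theorem summable_amcA_pow (y y' : TState N₁ N₂ k) : Summable fun n => (amcA D₁ D₂ prio ^ n) y y' := by
  obtain ⟨V, hV, hdrift⟩ := exists_drift (k := k) D₁ D₂ prio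
  exact summable_pow_of_drift (amcA_nonneg D₁ D₂ prio) V hV hdrift y y'

theorem isUnit_one_sub_amcA : IsUnit (1 - amcA (k := k) D₁ D₂ prio) :=
  isUnit_one_sub_of_tendsto_pow fun y y' => (summable_amcA_pow D₁ D₂ prio y y').tendsto_atTop_zero

theorem amcA_mulVec_inv : amcA (k := k) D₁ D₂ prio *ᵥ ((1 - amcA D₁ D₂ prio)⁻¹ *ᵥ amcCs D₁ D₂) =
    (1 - amcA D₁ D₂ prio)⁻¹ *ᵥ amcCs D₁ D₂ - amcCs D₁ D₂ := by
  have h : (1 - amcA (k := k) D₁ D₂ prio) *ᵥ ((1 - amcA D₁ D₂ prio)⁻¹ *ᵥ amcCs D₁ D₂) =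
      amcCs D₁ D₂ := by
    rw [mulVec_mulVec, mul_nonsing_inv _ ((isUnit_iff_isUnit_det _).1 (isUnit_one_sub_amcA D₁ D₂ prio)),
      one_mulVec]
  rw [sub_mulVec, one_mulVec] at h
  exact eq_sub_iff_add_eq.2 (sub_eq_iff_eq_add'.1 h).symm

theorem hasSum_dotProduct_pow (v : TState N₁ N₂ k → ℝ) :
    HasSum (fun n => v ⬝ᵥ (amcA D₁ D₂ prio ^ n *ᵥ amcCs D₁ D₂))
      (v ⬝ᵥ ((1 - amcA D₁ D₂ prio)⁻¹ *ᵥ amcCs D₁ D₂)) :=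
  hasSum_sum fun y _ => (hasSum_pow_mulVec (summable_amcA_pow D₁ D₂ prio)
    (isUnit_one_sub_amcA D₁ D₂ prio) _ y).mul_left _

theorem pow_mulVec_amcCs_nonneg (h : ℕ) (y : TState N₁ N₂ k) :
    0 ≤ (amcA D₁ D₂ prio ^ h *ᵥ amcCs D₁ D₂) y :=
  Finset.sum_nonneg fun y' _ =>
    mul_nonneg (pow_entry_nonneg (amcA_nonneg D₁ D₂ prio) h y y') (amcCs_nonneg D₁ D₂ y')

variable (p : RMCState N₁ N₂ k → ℝ)

/-- The total mass of `initWeight` is the generation rate. It is a common factor of numerator and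
denominator of `u` and cancels there. -/
theorem sigma_dotProduct (v : TState N₁ N₂ k → ℝ) : sigma D₁ D₂ prio p ⬝ᵥ v =
    (p ⬝ᵥ genMean D₁ D₂ prio v) / (p ⬝ᵥ genMean D₁ D₂ prio 1) := by
  rw [sum_genMean, sum_genMean, dotProduct_one, dotProduct, dotProduct, Finset.sum_div]
  exact Finset.sum_congr rfl fun y _ => div_mul_eq_mul_div _ _ _

/-- Right after its generation `P*` is still in service, and success is impossible in the next slot.
Hence the series may start at `h = 1`, and `A (1 - A)⁻¹` and `(1 - A)⁻¹` give the same `κ`. -/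
theorem sigma_dotProduct_amcCs : sigma D₁ D₂ prio p ⬝ᵥ amcCs D₁ D₂ = 0 :=
  Finset.sum_eq_zero fun y _ => by cases y <;> simp [sigma, initWeight, amcCs]

theorem amcLaw_succ (h : ℕ) :
    amcLaw D₁ D₂ prio p (h + 1) = amcLaw D₁ D₂ prio p h ᵥ* amcQ D₁ D₂ prio := by
  rw [amcLaw, pow_succ, ← vecMul_vecMul, amcLaw]

theorem amcLaw_inl (h : ℕ) :
    amcLaw D₁ D₂ prio p h ∘ Sum.inl = sigma D₁ D₂ prio p ᵥ* amcA D₁ D₂ prio ^ h := by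
  induction h with
  | zero => ext y; simp [amcLaw]
  | succ h ih =>
    rw [pow_succ, ← vecMul_vecMul, ← ih, amcLaw_succ]
    ext y
    change ∑ s, amcLaw D₁ D₂ prio p h s * amcQ D₁ D₂ prio s (Sum.inl y) = _
    have h1 : ∀ y', amcQ D₁ D₂ prio (Sum.inl y') (Sum.inl y) = amcA D₁ D₂ prio y' y := fun _ => rfl
    have h2 : ∀ o, amcQ D₁ D₂ prio (Sum.inr o) (Sum.inl y) = 0 := fun _ => rfl
    simp [Fintype.sum_sum_type, h1, h2, vecMul, dotProduct]

/-- The successful state keeps its mass, so its probability accumulates the one-step absorption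
probabilities. -/
theorem amcLaw_success (h : ℕ) : amcLaw D₁ D₂ prio p h (Sum.inr .success) =
    ∑ n ∈ Finset.range h, sigma D₁ D₂ prio p ⬝ᵥ (amcA D₁ D₂ prio ^ n *ᵥ amcCs D₁ D₂) := by
  induction h with
  | zero => simp [amcLaw]
  | succ h ih =>
    rw [Finset.sum_range_succ, ← ih, amcLaw_succ, dotProduct_mulVec, ← amcLaw_inl, add_comm]
    change ∑ s, amcLaw D₁ D₂ prio p h s * amcQ D₁ D₂ prio s (Sum.inr .success) = _
    have h1 : ∀ y', amcQ D₁ D₂ prio (Sum.inl y') (Sum.inr .success) = amcCs (k := k) D₁ D₂ y' :=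
      fun _ => rfl
    have h2 : ∀ o, amcQ (k := k) D₁ D₂ prio (Sum.inr o) (Sum.inr .success) =
      (1 : Matrix Absorbed Absorbed ℝ) o .success := fun _ => rfl
    simp [Fintype.sum_sum_type, h1, h2, dotProduct, Matrix.one_apply]

end absorbing

end DTDQ

end

/-! ### From averages over slots to averages over cycles. -/

noncomputable section

namespace DTDQ

theorem abs_sum_range_sub_le {f : ℕ → ℝ} (hf : ∀ m, |f m| ≤ 1) (n c : ℕ) :
    |∑ m ∈ Finset.range n, f m - ∑ m ∈ Finset.range c, f m| ≤ |(c : ℝ) - n| := by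
  wlog h : c ≤ n generalizing n c
  · rw [abs_sub_comm, abs_sub_comm (c : ℝ)]
    exact this c n (le_of_not_ge h)
  · rw [← Finset.sum_Ico_eq_sub f h, abs_sub_comm, abs_of_nonneg (sub_nonneg.2 (Nat.cast_le.2 h))]
    refine (Finset.abs_sum_le_sum_abs _ _).trans ((Finset.sum_le_sum fun m _ => hf m).trans_eq ?_)
    simp [Nat.cast_sub h]

/-- Comparison of averages per cycle and averages per slot. -/
theorem tendsto_div_of_abs_sub_le {S M D : ℕ → ℝ} {lam u : ℝ} (hlam : 0 < lam)
    (hS : ∀ n T : ℕ, |S n - M T| ≤ D T + |lam * T - n|)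
    (hD : Tendsto (fun T : ℕ => D T / T) atTop (𝓝 0))
    (hM : Tendsto (fun T : ℕ => M T / T) atTop (𝓝 (lam * u))) :
    Tendsto (fun n : ℕ => S n / n) atTop (𝓝 u) := by
  -- About `n / λ` slots contain about `n` cycles. With this choice of `T` the error `|λ * T - n|`
  -- is negligible compared with `n`.
  set τ : ℕ → ℕ := fun n => ⌈lam⁻¹ * (n : ℝ)⌉₊
  have hτ : Tendsto τ atTop atTop :=
    tendsto_nat_ceil_atTop.comp (tendsto_natCast_atTop_atTop.const_mul_atTop (inv_pos.2 hlam))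
  have hτn : Tendsto (fun n : ℕ => (τ n : ℝ) / n) atTop (𝓝 lam⁻¹) :=
    (tendsto_nat_ceil_mul_div_atTop (inv_pos.2 hlam).le).comp tendsto_natCast_atTop_atTop
  have h1 := (hM.comp hτ).mul hτn
  have h2 := ((hD.comp hτ).mul hτn).add ((hτn.const_mul lam).sub_const 1).abs
  rw [zero_mul, mul_inv_cancel₀ hlam.ne', sub_self, abs_zero, add_zero] at h2
  rw [mul_comm lam, mul_assoc, mul_inv_cancel₀ hlam.ne', mul_one] at h1
  rw [← tendsto_sub_nhds_zero_iff] at h1 ⊢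
  have h3 : Tendsto (fun n : ℕ => (S n - M (τ n)) / n) atTop (𝓝 0) := by
    refine squeeze_zero_norm' ?_ h2
    filter_upwards [eventually_gt_atTop 0, hτ.eventually_gt_atTop 0] with n hn hτn
    have hn' : (0 : ℝ) < n := by exact_mod_cast hn
    have hτ' : (0 : ℝ) < τ n := by exact_mod_cast hτn
    rw [Real.norm_eq_abs, abs_div, abs_of_pos hn', div_le_iff₀ hn']
    refine (hS n (τ n)).trans_eq ?_
    rw [add_mul, ← abs_of_pos hn', ← abs_mul, abs_of_pos hn']
    simp only [Function.comp]
    congr 1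
    · field_simp
    · congr 1
      field_simp
  have h4 := h1.add h3
  rw [add_zero] at h4
  refine h4.congr' ?_
  filter_upwards [eventually_gt_atTop 0, hτ.eventually_gt_atTop 0] with n hn hτn
  have hn' : (0 : ℝ) < n := by exact_mod_cast hn
  have hτ' : (0 : ℝ) < τ n := by exact_mod_cast hτn
  simp only [Function.comp]
  field_simp
  ring

section peaks

variable {N₁ N₂ k : ℕ}

open scoped Classical in
theorem count_isCycleEnd (x : ℕ → SysState N₁ N₂ k) (T : ℕ) :
    (Nat.count (IsCycleEnd x) T : ℝ) = ∑ t ∈ Finset.range T, endInd (x t) (x (t + 1)) := by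
  induction T with
  | zero => simp
  | succ T ih =>
    rw [Nat.count_succ, Finset.sum_range_succ, ← ih]
    simp only [endInd, IsCycleEnd]
    split_ifs with h <;> simpa using h

open scoped Classical in
-- The cycles ended before slot `T` are exactly those with index below `Nat.count`, and a cycle
-- ending in slot `T` has that count as its index.
theorem sum_peakInd_eq (x : ℕ → SysState N₁ N₂ k) (h T : ℕ) :
    ∑ t ∈ Finset.range T, peakInd h (x t) (x (t + 1)) =
      ∑ m ∈ Finset.range (Nat.count (IsCycleEnd x) T), if peakAoI x m = h then (1 : ℝ) else 0 := by
  induction T with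
  | zero => simp
  | succ T ih =>
    rw [Nat.count_succ, Finset.sum_range_succ, ih]
    by_cases hT : IsCycleEnd x T
    · rw [if_pos hT, Finset.sum_range_succ, peakAoI, Nat.nth_count hT]
      congr 1
      refine if_congr ⟨fun h => h.1, fun h' => ⟨h', ?_⟩⟩ rfl rfl
      rw [← h']
      exact hT
    · rw [if_neg hT, add_zero, peakInd, if_neg, add_zero]
      rintro ⟨rfl, h'⟩
      exact hT h'

/-- The first `n` cycles and those ended in the first `T` slots differ by as many cycles as their
numbers do, and each contributes at most one. -/
theorem abs_sum_peak_sub_le (x : ℕ → SysState N₁ N₂ k) (h n T : ℕ) :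
    |∑ m ∈ Finset.range n, (if peakAoI x m = h then (1 : ℝ) else 0) -
      ∑ t ∈ Finset.range T, peakInd h (x t) (x (t + 1))| ≤
        |∑ t ∈ Finset.range T, endInd (x t) (x (t + 1)) - n| := by
  classical
  rw [sum_peakInd_eq, ← count_isCycleEnd]
  convert abs_sum_range_sub_le (fun m => ?_) n _ using 2
  split_ifs <;> simp

variable [NeZero k] {D₁ : DPH N₁} {D₂ : DPH N₂} {prio : Server}
  {Ω : Type*} [MeasurableSpace Ω] {P : Measure Ω} {X : ℕ → Ω → SysState N₁ N₂ k}

theorem measurableSet_peakAoI (hX : IsMarkovChain (sysKernel D₁ D₂ prio) P X) (m h : ℕ) :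
    MeasurableSet {ω | peakAoI (fun t => X t ω) m = h} := by
  classical
  have hA : ∀ t, MeasurableSet {ω | (X t ω).aoi = h} := fun t => by
    have := measurable_path hX t (fun x => (x.aoi : ℝ)) (measurableSet_singleton (h : ℝ))
    convert this using 1
    ext ω
    simp
  set E : ℕ → Set Ω := fun t =>
    {ω | IsCycleEnd (fun t => X t ω) t ∧ Nat.count (IsCycleEnd fun t => X t ω) t = m} with hE
  have hEm : ∀ t, MeasurableSet (E t) := fun t => by
    have h1 := measurable_pair hX t endInd (measurableSet_singleton (1 : ℝ))
    have h2 : Measurable fun ω => ∑ s ∈ Finset.range t, endInd (X s ω) (X (s + 1) ω) :=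
      Finset.measurable_sum _ fun s _ => measurable_pair hX s endInd
    convert h1.inter (h2 (measurableSet_singleton (m : ℝ))) using 1
    ext ω
    simp only [hE, Set.mem_ofPred_eq, Set.mem_inter_iff, Set.mem_preimage, Set.mem_singleton_iff]
    rw [← count_isCycleEnd fun t => X t ω, Nat.cast_inj]
    simp [endInd, IsCycleEnd]
  have hnth : ∀ ω t, ω ∈ E t → Nat.nth (IsCycleEnd fun t => X t ω) m = t := fun ω t hω => by
    rw [← hω.2, Nat.nth_count hω.1]
  -- If cycle `m` never ends, `Nat.nth` takes the default value 0 and the peak is by convention the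
  -- initial age of information; this null or non-null event still has to be measurable.
  have hzero : ∀ ω, ω ∉ ⋃ t, E t → Nat.nth (IsCycleEnd fun t => X t ω) m = 0 := fun ω hω => by
    by_contra h0
    have hn : ∀ hf : (Set.ofPred (IsCycleEnd fun t => X t ω)).Finite, m < hf.toFinset.card := by
      intro hf
      by_contra hle
      exact h0 (Nat.nth_of_card_le hf (not_lt.1 hle))
    exact hω (Set.mem_iUnion.2 ⟨_, Nat.nth_mem m hn, Nat.count_nth hn⟩)
  have : {ω | peakAoI (fun t => X t ω) m = h} = (⋃ t, E t ∩ {ω | (X t ω).aoi = h}) ∪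
      ((⋃ t, E t)ᶜ ∩ {ω | (X 0 ω).aoi = h}) := by
    ext ω
    simp only [Set.mem_union, Set.mem_iUnion, Set.mem_inter_iff, Set.mem_ofPred_eq, Set.mem_compl_iff]
    by_cases hω : ∃ t, ω ∈ E t
    · obtain ⟨t, ht⟩ := hω
      rw [peakAoI, hnth ω t ht]
      refine ⟨fun h' => Or.inl ⟨t, ht, h'⟩, ?_⟩
      rintro (⟨s, hs, h'⟩ | ⟨h', -⟩)
      · rwa [← hnth ω t ht, hnth ω s hs]
      · exact absurd ⟨t, ht⟩ h'
    · rw [peakAoI, hzero ω (by simpa using hω)]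
      refine ⟨fun h' => Or.inr ⟨hω, h'⟩, ?_⟩
      rintro (⟨s, hs, h'⟩ | ⟨-, h'⟩)
      · exact absurd ⟨s, hs⟩ hω
      · exact h'
  rw [this]
  exact (MeasurableSet.iUnion fun t => (hEm t).inter (hA t)).union
    ((MeasurableSet.iUnion hEm).compl.inter (hA 0))

variable [IsProbabilityMeasure P] {p : RMCState N₁ N₂ k → ℝ}

/-- The frequency of the peak `h` among the first cycles. -/
theorem tendsto_cesaro_peakAoI (hX : IsMarkovChain (sysKernel D₁ D₂ prio) P X)
    (hp_unique : ∀ p' : RMCState N₁ N₂ k → ℝ, IsStationary (rmcMatrix D₁ D₂ prio) p' →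
      (∀ w, p' w ≠ 0 → ∃ t, P {ω | (X t ω).toRMC = w} ≠ 0) → p' = p)
    {e : TState N₁ N₂ k → ℝ} (he : amcA D₁ D₂ prio *ᵥ e = e - amcCs D₁ D₂)
    (hpos : 0 < p ⬝ᵥ genMean D₁ D₂ prio e) (h : ℕ) :
    Tendsto (fun n : ℕ =>
      (∑ m ∈ Finset.range n, P.real {ω | peakAoI (fun t => X t ω) m = h}) / n) atTop
      (𝓝 ((p ⬝ᵥ genMean D₁ D₂ prio (amcA D₁ D₂ prio ^ h *ᵥ amcCs D₁ D₂)) /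
        (p ⬝ᵥ genMean D₁ D₂ prio e))) := by
  set lam := p ⬝ᵥ genMean D₁ D₂ prio e with hlam
  refine tendsto_div_of_abs_sub_le hpos
    (M := fun T => ∫ ω, ∑ t ∈ Finset.range T, peakInd h (X t ω) (X (t + 1) ω) ∂P)
    (D := fun T => ∫ ω, |∑ t ∈ Finset.range T, endInd (X t ω) (X (t + 1) ω) - lam * T| ∂P)
    (fun n T => ?_) (tendsto_integral_abs_sum_endInd hX hp_unique he) ?_
  · have i1 := integrable_sum_pair hX (H := fun _ => endInd) (fun _ => abs_endInd_le) T
    have i2 := integrable_sum_pair hX (H := fun _ => peakInd h) (fun _ => abs_peakInd_le h) T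
    have hind : ∀ m, (fun ω => if peakAoI (fun t => X t ω) m = h then (1 : ℝ) else 0) =
        {ω | peakAoI (fun t => X t ω) m = h}.indicator 1 := fun m => by
      ext ω
      simp [Set.indicator_apply]
    have i3 : ∀ m, Integrable
        (fun ω => if peakAoI (fun t => X t ω) m = h then (1 : ℝ) else 0) P := fun m => by
      rw [hind]
      exact (integrable_indicator_iff (measurableSet_peakAoI hX m h)).2
        (integrable_const (1 : ℝ)).integrableOn
    have i4 : Integrable (fun ω => ∑ m ∈ Finset.range n,
        if peakAoI (fun t => X t ω) m = h then (1 : ℝ) else 0) P := integrable_finsetSum _ fun m _ => i3 m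
    have i5 : Integrable (fun ω => |∑ t ∈ Finset.range T, endInd (X t ω) (X (t + 1) ω) - lam * T|) P :=
      (i1.sub (integrable_const _)).abs
    have h1 : ∑ m ∈ Finset.range n, P.real {ω | peakAoI (fun t => X t ω) m = h} =
        ∫ ω, ∑ m ∈ Finset.range n, (if peakAoI (fun t => X t ω) m = h then (1 : ℝ) else 0) ∂P := by
      rw [integral_finsetSum _ fun m _ => i3 m]
      refine Finset.sum_congr rfl fun m _ => ?_
      rw [hind, integral_indicator_one (measurableSet_peakAoI hX m h)]
    rw [h1, ← integral_sub i4 i2]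
    calc _ ≤ ∫ ω, (|∑ t ∈ Finset.range T, endInd (X t ω) (X (t + 1) ω) - lam * T| +
          |lam * T - n|) ∂P := by
          refine abs_integral_le_integral_abs.trans
            (integral_mono (i4.sub i2).abs (i5.add (integrable_const _)) fun ω => ?_)
          refine (abs_sum_peak_sub_le (fun t => X t ω) h n T).trans ?_
          exact abs_sub_le _ (lam * T) _
      _ = _ := by rw [integral_add i5 (integrable_const _)]; simp
  · rw [mul_div_cancel₀ _ hpos.ne']
    exact tendsto_mean_sum_peakInd hX hp_unique h

end peaks

end DTDQ

end

/-! ### The theorem. -/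

theorem mainTheorem2 {N₁ N₂ k : ℕ} [NeZero k] (D₁ : DTDQ.DPH N₁) (D₂ : DTDQ.DPH N₂)
    (prio : DTDQ.Server)
    {Ω : Type*} [MeasurableSpace Ω] (P : Measure Ω) [IsProbabilityMeasure P]
    (X : ℕ → Ω → DTDQ.SysState N₁ N₂ k)
    (hX : DTDQ.IsMarkovChain (DTDQ.sysKernel D₁ D₂ prio) P X)
    (p : DTDQ.RMCState N₁ N₂ k → ℝ)
    (hp : DTDQ.IsStationary (DTDQ.rmcMatrix D₁ D₂ prio) p)
    (hp_unique : ∀ p' : DTDQ.RMCState N₁ N₂ k → ℝ,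
      DTDQ.IsStationary (DTDQ.rmcMatrix D₁ D₂ prio) p' →
      (∀ w, p' w ≠ 0 → ∃ t, P {ω | (X t ω).toRMC = w} ≠ 0) → p' = p) :
    let A := DTDQ.amcA (k := k) D₁ D₂ prio
    let c := DTDQ.amcCs (k := k) D₁ D₂
    let σ := DTDQ.sigma D₁ D₂ prio p
    let κ : ℝ := σ ⬝ᵥ ((A * (1 - A)⁻¹) *ᵥ c)
    let u : ℕ → ℝ := fun h => (σ ⬝ᵥ (A ^ h *ᵥ c)) / κ
    let absorbed : ℕ → ℝ := fun h => DTDQ.amcLaw D₁ D₂ prio p h (Sum.inr .success)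
    IsUnit (1 - A) ∧ 0 < κ ∧
    (∀ h, 1 ≤ h → 0 ≤ u h) ∧ HasSum (fun h : ℕ => u (h + 1)) 1 ∧
    (∀ h, 1 ≤ h →
      Tendsto (fun n : ℕ =>
          (∑ m ∈ Finset.range n, P.real {ω | DTDQ.peakAoI (fun t => X t ω) m = h}) / n)
        atTop (𝓝 (u h)) ∧
      (∀ L : ℝ, Tendsto (fun n : ℕ => P.real {ω | DTDQ.peakAoI (fun t => X t ω) n = h})
        atTop (𝓝 L) → L = u h)) ∧
    Tendsto absorbed atTop (𝓝 κ) ∧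
    (∀ h, 1 ≤ h → u h = (absorbed (h + 1) - absorbed h) / κ) := by
  intro A c σ κ u absorbed
  set e := (1 - A)⁻¹ *ᵥ c with he_def
  have he : A *ᵥ e = e - c := DTDQ.amcA_mulVec_inv D₁ D₂ prio
  have hG := DTDQ.sum_initWeight_pos D₁ D₂ prio hp
  -- Packets are generated at a positive rate, with at most two per cycle, so cycles end at a
  -- positive rate too.
  have hlam : 0 < p ⬝ᵥ DTDQ.genMean D₁ D₂ prio e := by
    linarith [DTDQ.dotProduct_genMean_one_le hX hp_unique he]
  have hκe : κ = σ ⬝ᵥ e := by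
    have hσc : σ ⬝ᵥ c = 0 := DTDQ.sigma_dotProduct_amcCs D₁ D₂ prio p
    simp only [κ]
    rw [← mulVec_mulVec, ← he_def, he, dotProduct_sub, hσc, sub_zero]
  have hκ : κ = (p ⬝ᵥ DTDQ.genMean D₁ D₂ prio e) / (p ⬝ᵥ DTDQ.genMean D₁ D₂ prio 1) :=
    hκe.trans (DTDQ.sigma_dotProduct D₁ D₂ prio p e)
  have hκpos : 0 < κ := hκ ▸ div_pos hlam hG
  have hu : ∀ h, u h = (p ⬝ᵥ DTDQ.genMean D₁ D₂ prio (A ^ h *ᵥ c)) /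
      (p ⬝ᵥ DTDQ.genMean D₁ D₂ prio e) := fun h => by
    simp only [u]
    rw [hκ, DTDQ.sigma_dotProduct, div_div_div_cancel_right₀ hG.ne']
  have hsum : HasSum (fun n => σ ⬝ᵥ (A ^ n *ᵥ c)) κ := by
    rw [hκe]
    exact DTDQ.hasSum_dotProduct_pow D₁ D₂ prio σ
  have habs : absorbed = fun h => ∑ n ∈ Finset.range h, σ ⬝ᵥ (A ^ n *ᵥ c) :=
    funext fun h => DTDQ.amcLaw_success D₁ D₂ prio p h
  have hlim : ∀ h, Tendsto (fun n : ℕ =>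
      (∑ m ∈ Finset.range n, P.real {ω | DTDQ.peakAoI (fun t => X t ω) m = h}) / n)
      atTop (𝓝 (u h)) := fun h => by
    rw [hu]
    exact DTDQ.tendsto_cesaro_peakAoI hX hp_unique he hlam h
  refine ⟨DTDQ.isUnit_one_sub_amcA D₁ D₂ prio, hκpos, fun h _ => ?_, ?_, fun h _ => ⟨hlim h, ?_⟩, ?_,
    fun h _ => ?_⟩
  · rw [hu]
    refine div_nonneg (Finset.sum_nonneg fun w _ => mul_nonneg (hp.nonneg w) ?_) hlam.le
    exact DTDQ.genMean_nonneg D₁ D₂ prio (DTDQ.pow_mulVec_amcCs_nonneg D₁ D₂ prio h) w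
  · have h1 : HasSum (fun n => σ ⬝ᵥ (A ^ (n + 1) *ᵥ c)) κ := by
      rw [hasSum_nat_add_iff (f := fun n => σ ⬝ᵥ (A ^ n *ᵥ c)) 1]
      have hσc : σ ⬝ᵥ c = 0 := DTDQ.sigma_dotProduct_amcCs D₁ D₂ prio p
      simpa [hσc] using hsum
    simpa [u, div_self hκpos.ne'] using h1.div_const κ
  · intro L hL
    -- A convergent sequence has the same limit as its averages.
    refine tendsto_nhds_unique (hL.cesaro.congr fun n => ?_) (hlim h)
    rw [inv_mul_eq_div]
  · rw [habs]
    exact hsum.tendsto_sum_nat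
  · rw [habs]
    simp only [u]
    rw [Finset.sum_range_succ, add_sub_cancel_left]
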